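/- Let $n\ge 2$ and let $d_1,\dots,d_n\ge 2$ be integers. Let $H(d_1,\dots,d_n)$ be the space of polynomial maps $F=(f_1,\dots,f_n):\mathbb{C}^n\to\mathbb{C}^n$ with each $f_i$ homogeneous of degree $d_i$ (or zero), with the Zariski topology in which closed sets are the common zero sets of families of polynomials in the coefficients of $f_1,\dots,f_n$. For $F\in H(d_1,\dots,d_n)$ let $C(F)\subseteq\mathbb{C}^n$ be the zero set of the Jacobian determinant of $F$, let $\Delta(F)=F(C(F))$, and let $Z(f_i)$ be the zero set of $f_i$. A ray is a complex line $\mathbb{C}\cdot p$ with $p\in\mathbb{C}^n\setminus\{0\}$. Assume $\gcd(d_i,d_j)\le 2$ for $1\le i<j\le n$ and $\gcd(d_i,d_j,d_k)=1$ for $1\le i<j<k\le n$. Then there is a dense Zariski open subset $U\subseteq H(d_1,\dots,d_n)$ such that every $F\in U$ has the following properties. 1. $F^{-1}(0)=\{0\}$. 2. If $d_1,\dots,d_n$ are pairwise coprime, then $F$ is injective on every ray contained in $C(F)$. If $d_{i_1}$ and $d_{i_2}$ are not coprime, $i_1\ne i_2$ (so that these two are even and all other $d_j$ are odd), then (a)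 $F$ is injective on every ray $L\subseteq C(F)$ for which $(L\setminus\{0\})\cap Z(f_j)=\emptyset$ for some $j\notin\{i_1,i_2\}$; (b) only finitely many rays are contained in $C(F)\cap\bigcap_{j\ne i_1,i_2}Z(f_j)$; and (c) on each of these rays $L$ the map $F$ is two-to-one, that is, for every $x\in L\setminus\{0\}$ there are exactly two $y\in L$ with $F(y)=F(x)$. If moreover $\gcd(d_1,\dots,d_n)=1$ (which is automatic for $n\ge 3$, and for $n=2$ excludes only the case of two even degrees), then every $F\in U$ also satisfies: 3. There is an algebraic set $Z\subseteq\mathbb{C}^n$ of dimension at most $n-2$ such that $F$ is injective on $C(F)\setminus Z$. 4. For every $p\in\Delta(F)$ the set $F^{-1}(p)\cap C(F)$ has at most $n-1$ elements. -/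

import Mathlib

open MvPolynomial

/-- The set of common zeros in affine space `ι → ℂ` of a set of polynomials. -/
def zeroSet {ι : Type*} (S : Set (MvPolynomial ι ℂ)) : Set (ι → ℂ) :=
  {x | ∀ p ∈ S, eval x p = 0}

/-- The Zariski topology on affine space: the closed sets are exactly the sets `zeroSet S`. It is
not an instance, since `ι → ℂ` already carries the Euclidean topology. -/
@[reducible] def zariski (ι : Type*) : TopologicalSpace (ι → ℂ) :=
  TopologicalSpace.ofClosed {Z | ∃ S : Set (MvPolynomial ι ℂ), Z = zeroSet S}
    ⟨{1}, by ext x; simp [zeroSet]⟩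
    (by
      intro A hA
      refine ⟨{p | ∃ S : Set (MvPolynomial ι ℂ), zeroSet S ∈ A ∧ p ∈ S}, ?_⟩
      ext x
      simp only [Set.mem_sInter, zeroSet, Set.mem_ofPred_eq]
      constructor
      · rintro h p ⟨S, hS, hp⟩
        exact h _ hS p hp
      · intro h Z hZ
        obtain ⟨S, rfl⟩ := hA hZ
        exact fun p hp => h p ⟨S, hZ, hp⟩)
    (by
      rintro _ ⟨S, rfl⟩ _ ⟨T, rfl⟩
      refine ⟨{r | ∃ p ∈ S, ∃ q ∈ T, r = p * q}, ?_⟩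
      ext x
      simp only [Set.mem_union, zeroSet, Set.mem_ofPred_eq]
      constructor
      · rintro (h | h) _ ⟨p, hp, q, hq, rfl⟩
        · simp [h p hp]
        · simp [h q hq]
      · intro h
        by_contra! hc
        obtain ⟨⟨p, hp, hpx⟩, q, hq, hqx⟩ := hc
        have h0 := h _ ⟨p, hp, q, hq, rfl⟩
        rw [map_mul] at h0
        exact (mul_ne_zero hpx hqx) h0)

/-- `Z` is an algebraic subset of affine space. -/
def IsAlgebraicSet {ι : Type*} (Z : Set (ι → ℂ)) : Prop :=
  @IsClosed _ (zariski ι) Z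

/-- The dimension of an algebraic set: the supremum of the lengths of chains of irreducible closed
subsets, for the Zariski topology (it is `⊥` for the empty set). -/
noncomputable def zariskiDim {ι : Type*} (Z : Set (ι → ℂ)) : WithBot ℕ∞ :=
  @topologicalKrullDim Z (TopologicalSpace.induced Subtype.val (zariski ι))

/-- The space `H(d₁, …, dₙ)` of maps `ℂⁿ → ℂⁿ` whose `i`-th component is a homogeneous polynomial
of degree `dᵢ` (or zero). -/
structure HomMap {n : ℕ} (d : Fin n → ℕ) where
  /-- the components `f₁, …, fₙ` -/
  poly : Fin n → MvPolynomial (Fin n) ℂ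
  homogeneous : ∀ i, (poly i).IsHomogeneous (d i)

namespace HomMap

variable {n : ℕ} {d : Fin n → ℕ}

/-- The coefficients of all the components of `F`. Those of the wrong degree are zero, so that
`H(d₁, …, dₙ)` is identified with the affine space of the coefficients of the right degree. -/
def coeffs (F : HomMap d) : Fin n × (Fin n →₀ ℕ) → ℂ :=
  fun a => (F.poly a.1).coeff a.2

/-- The Zariski topology on `H(d₁, …, dₙ)`: the closed sets are the common zeros of sets of
polynomials in the coefficients. -/
instance : TopologicalSpace (HomMap d) :=
  TopologicalSpace.induced coeffs (zariski (Fin n × (Fin n →₀ ℕ)))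

/-- `F` as a map `ℂⁿ → ℂⁿ`. -/
noncomputable def toMap (F : HomMap d) (x : Fin n → ℂ) : Fin n → ℂ :=
  fun i => eval x (F.poly i)

/-- The Jacobian determinant `J(F)`. -/
noncomputable def jacobian (F : HomMap d) : MvPolynomial (Fin n) ℂ :=
  (Matrix.of fun i j => pderiv j (F.poly i)).det

/-- The critical set `C(F)`, the zero set of `J(F)`. -/
def critSet (F : HomMap d) : Set (Fin n → ℂ) :=
  {x | eval x F.jacobian = 0}

/-- The discriminant `Δ(F) = F(C(F))`. -/
def discr (F : HomMap d) : Set (Fin n → ℂ) :=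
  F.toMap '' F.critSet

end HomMap

/-- A ray in `ℂⁿ`: a complex line `ℂ · p` through the origin. -/
def IsRay {n : ℕ} (L : Set (Fin n → ℂ)) : Prop :=
  ∃ p : Fin n → ℂ, p ≠ 0 ∧ L = Set.range fun c : ℂ => c • p

/-! Dimension counts on incidence varieties are replaced by transcendence degrees (`rk`) over ℚ for
a map `F` whose N coefficients are algebraically independent (`Generic`). If auxiliary points and
vectors of rank at most k impose r independent linear conditions on the coefficients, then together
with the coefficients they have rank at most k + N - r; as the coefficients alone have rank N, this
forces r ≤ k (`rk_union_coeffSet_add_le`, `Generic.numCoeffs_le`). Independence of the conditions is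
interpolation of values and derivatives by products of linear forms (`JetIndep`).

Being critical is not linear in `F`, but it is linear in a single component. The vector `cof l x`
depends only on x and the f_j with j ≠ l and is killed by their differentials at x; when it is
nonzero, x is critical exactly if the derivative of f_l along it vanishes. Critical points with a
common image lie in one fibre of the components other than `l`, which is a curve. Each further point
brings one parameter, balanced by the equality of values of f_l, and each derivative condition
lowers the rank by one (`Generic.rk_add_card_le`). So double points form a set of codimension one in
C(F), and n points on distinct rays cannot occur (`Generic.not_isCritFamily`). Points with `cof l x
= 0` have codimension two and are counted separately.

Interpolating n values and n derivatives needs d_l ≥ 2n - 1. The gcd conditions make the odd degrees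
distinct and allow at most two even ones, which gives this bound or nearly this bound. In the
remaining cases degree 2n - 3 suffices for points that are not coplanar, and coplanar points are
excluded by a direct count.

On a ray, F(cx) = F(x) forces the order of c to divide the degree of every component not vanishing
at x. A critical point has at least two such components, so c = ±1, and c = -1 requires exactly two,
both of even degree. Critical rays of this kind are isolated (`Generic.rk_isolated`).

Finally `exists_eliminant` passes from generic `F` to all `F` outside a hypersurface over ℚ: a
system over ℚ without solutions of algebraically independent data yields a nonzero eliminant. For
codimension two, any n - 1 coordinates of double points satisfy an equation, and a prime ideal
containing, for each variable, a nonzero polynomial free of it has height at least two. -/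

/-! ### Transcendence degree over ℚ as a dimension -/

/-- The matroid of algebraic independence over `ℚ` of complex numbers. -/
noncomputable def algMatroid : Matroid ℂ := AlgebraicIndependent.matroid ℚ ℂ

/-- The algebraic closure in `ℂ` of the field generated by a set. -/
noncomputable def acl (S : Set ℂ) : IntermediateField ℚ ℂ :=
  Subalgebra.toIntermediateField
    ((Subalgebra.algebraicClosure (Algebra.adjoin ℚ S) ℂ).restrictScalars ℚ)
    (fun _ hx => IsAlgebraic.inv hx)

theorem mem_acl_iff {S : Set ℂ} {a : ℂ} :
    a ∈ acl S ↔ IsAlgebraic (Algebra.adjoin ℚ S) a := Iff.rfl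

theorem coe_acl (S : Set ℂ) : (acl S : Set ℂ) = algMatroid.closure S := by
  rw [algMatroid, AlgebraicIndependent.matroid_closure_eq]
  rfl

theorem subset_acl (S : Set ℂ) : S ⊆ acl S := by
  rw [coe_acl]
  exact Matroid.subset_closure _ S (Set.subset_univ _)

theorem acl_subset_acl_iff {S T : Set ℂ} : (acl S : Set ℂ) ⊆ acl T ↔ S ⊆ acl T := by
  rw [coe_acl, coe_acl]
  exact Matroid.closure_subset_closure_iff_subset_closure (Set.subset_univ _)

theorem acl_mono {S T : Set ℂ} (h : S ⊆ T) : (acl S : Set ℂ) ⊆ acl T :=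
  acl_subset_acl_iff.2 (h.trans (subset_acl T))

theorem mem_acl_of_isAlgebraic {S : Set ℂ} {a : ℂ} (h : IsAlgebraic (acl S) a) : a ∈ acl S := by
  have h2 : IsAlgebraic (Algebra.adjoin ℚ (acl S : Set ℂ)) a := by
    have : (acl S).toSubalgebra = Algebra.adjoin ℚ (acl S : Set ℂ) :=
      (Algebra.adjoin_eq (acl S).toSubalgebra).symm
    rw [← this]
    exact h
  exact acl_subset_acl_iff.2 (subset_refl (acl S : Set ℂ)) (mem_acl_iff.2 h2)

/-- The transcendence degree over `ℚ` of the field generated by a finite set (and `0` for sets of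
infinite transcendence degree). -/
noncomputable def rk (S : Set ℂ) : ℕ := (algMatroid.eRk S).toNat

theorem eRk_ne_top (S : Set ℂ) [Finite S] : algMatroid.eRk S ≠ ⊤ := by
  have h := algMatroid.eRk_le_encard S
  have h2 : S.encard ≠ ⊤ := by
    rw [Set.encard_ne_top_iff]; exact S.toFinite
  exact ne_top_of_le_ne_top h2 h

theorem coe_rk (S : Set ℂ) [Finite S] : (rk S : ℕ∞) = algMatroid.eRk S :=
  ENat.natCast_toNat (eRk_ne_top S)

theorem rk_mono {S T : Set ℂ} [Finite T] (h : S ⊆ acl T) : rk S ≤ rk T := by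
  apply ENat.toNat_le_toNat _ (eRk_ne_top T)
  rw [coe_acl] at h
  exact (algMatroid.eRk_mono h).trans (algMatroid.eRk_closure_eq T).le

theorem rk_union_le (S T : Set ℂ) [Finite S] [Finite T] : rk (S ∪ T) ≤ rk S + rk T := by
  have h := algMatroid.eRk_union_le_eRk_add_eRk S T
  rw [← coe_rk, ← coe_rk, ← coe_rk] at h
  exact_mod_cast h

theorem rk_range_le {ι : Type*} [Fintype ι] (x : ι → ℂ) : rk (Set.range x) ≤ Fintype.card ι := by
  have h := algMatroid.eRk_le_encard (Set.range x)
  rw [← coe_rk] at h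
  have h2 : (Set.range x).encard ≤ (Fintype.card ι : ℕ∞) := by
    rw [← Set.image_univ]
    refine (Set.encard_image_le _ _).trans ?_
    simp
  exact_mod_cast h.trans h2

theorem rk_range_of_algebraicIndependent {ι : Type*} [Fintype ι] {x : ι → ℂ}
    (h : AlgebraicIndependent ℚ x) : rk (Set.range x) = Fintype.card ι := by
  have h1 : algMatroid.Indep (Set.range x) := by
    rw [algMatroid, AlgebraicIndependent.matroid_indep_iff]
    exact h.coe_range
  have h2 := h1.eRk_eq_encard
  rw [← coe_rk, ← Set.image_univ, h.injective.encard_image, Set.encard_univ] at h2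
  simpa using h2

/-- Adjoining elements that are algebraic over `m` further elements raises the transcendence degree
by at most `m`. -/
theorem rk_le_add_card {S T : Set ℂ} [Finite S] {ι : Type*} [Fintype ι] (y : ι → ℂ)
    (h : T ⊆ acl (S ∪ Set.range y)) : rk T ≤ rk S + Fintype.card ι :=
  (rk_mono h).trans ((rk_union_le _ _).trans (Nat.add_le_add_left (rk_range_le y) _))

/-- A family satisfying `r` independent linear equations over `acl X` raises the transcendence
degree by at most its size minus `r`. -/
theorem rk_union_range_add_card_le {ι κ : Type*} [Fintype ι] [Fintype κ] (X : Set ℂ) [Finite X]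
    (c : ι → ℂ) (φ : κ → ι → ℂ) (hφ : ∀ a i, φ a i ∈ acl X) (hli : LinearIndependent ℂ φ)
    (h : ∀ a, ∑ i, φ a i * c i = 0) :
    rk (X ∪ Set.range c) + Fintype.card κ ≤ rk X + Fintype.card ι := by
  classical
  set K := acl X
  let φ' : κ → ι → K := fun a i => ⟨φ a i, hφ a i⟩
  have hli' : LinearIndependent K φ' := by
    have h1 : LinearIndependent K φ := hli.restrict_scalars' K
    let m : (ι → K) →ₗ[K] (ι → ℂ) :=
      LinearMap.pi fun i => (Algebra.linearMap K ℂ) ∘ₗ LinearMap.proj i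
    have h2 : φ = m ∘ φ' := by
      ext a i; rfl
    rw [h2] at h1
    exact h1.of_comp
  -- The equations lie in the kernel of this map, so the `K`-span of the numbers `c i` has dimension
  -- at most card ι - card κ. A basis chosen among them generates all of them over `K`, which bounds
  -- the transcendence degree.
  let T : (ι → K) →ₗ[K] ℂ := Fintype.linearCombination K c
  have hT : ∀ a, φ' a ∈ LinearMap.ker T := by
    intro a
    rw [LinearMap.mem_ker, Fintype.linearCombination_apply]
    simpa [φ', Algebra.smul_def] using h a
  have hk : Fintype.card κ ≤ Module.finrank K (LinearMap.ker T) := by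
    let ψ : κ → LinearMap.ker T := fun a => ⟨φ' a, hT a⟩
    have : LinearIndependent K ψ := by
      have h3 : φ' = (LinearMap.ker T).subtype ∘ ψ := rfl
      rw [h3] at hli'
      exact hli'.of_comp
    exact this.fintype_card_le_finrank
  have hrn := LinearMap.finrank_range_add_finrank_ker T
  rw [Module.finrank_fintype_fun_eq_card] at hrn
  have hrange : LinearMap.range T = Submodule.span K (Set.range c) :=
    Fintype.range_linearCombination K c
  obtain ⟨b, hb, hspan, hbli⟩ := exists_linearIndependent K (Set.range c)
  have hbf : b.Finite := (Set.finite_range c).subset hb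
  have : Fintype b := hbf.fintype
  have hcard : Fintype.card b = Module.finrank K (LinearMap.range T) := by
    rw [hrange, ← hspan, ← finrank_span_eq_card hbli, Subtype.range_coe]
  have hsub : X ∪ Set.range c ⊆ acl (X ∪ Set.range ((↑) : b → ℂ)) := by
    rw [Subtype.range_coe]
    apply Set.union_subset
    · exact Set.subset_union_left.trans (subset_acl _)
    · intro z hz
      have hz' : z ∈ Submodule.span K b := by
        rw [hspan]; exact Submodule.subset_span hz
      clear hz
      induction hz' using Submodule.span_induction with
      | mem x hx => exact subset_acl _ (Or.inr hx)
      | zero => exact zero_mem _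
      | add x y _ _ hx hy => exact add_mem hx hy
      | smul a x _ hx => exact mul_mem (acl_mono Set.subset_union_left a.2) hx
  have := rk_le_add_card (ι := b) _ hsub
  omega

/-! ### Linear conditions on the coefficients of a form -/

/-- The exponents of degree `e` in `n` variables. -/
def monos (n e : ℕ) : Finset (Fin n →₀ ℕ) := Finset.univ.finsuppAntidiag e

theorem mem_monos {n e : ℕ} {m : Fin n →₀ ℕ} : m ∈ monos n e ↔ m.degree = e := by
  simp [monos, Finsupp.degree_eq_sum]

/-- The derivative at `x` in the direction `v`, as a functional on polynomials. -/
noncomputable def dirDeriv {n : ℕ} (x v : Fin n → ℂ) : MvPolynomial (Fin n) ℂ →ₗ[ℂ] ℂ :=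
  ∑ l, v l • (aeval x).toLinearMap ∘ₗ (pderiv l).toLinearMap

/-- Evaluation at `x`, as a functional on polynomials. -/
noncomputable def evalAt {n : ℕ} (x : Fin n → ℂ) : MvPolynomial (Fin n) ℂ →ₗ[ℂ] ℂ :=
  (aeval x).toLinearMap

section Functionals

variable {n e : ℕ}

@[simp] theorem evalAt_apply (x : Fin n → ℂ) (g : MvPolynomial (Fin n) ℂ) :
    evalAt x g = eval x g := by
  simp [evalAt, aeval_eq_eval]

theorem dirDeriv_apply (x v : Fin n → ℂ) (g : MvPolynomial (Fin n) ℂ) :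
    dirDeriv x v g = ∑ l, v l * eval x (pderiv l g) := by
  simp [dirDeriv, aeval_eq_eval]

theorem dirDeriv_mul (x v : Fin n → ℂ) (g h : MvPolynomial (Fin n) ℂ) :
    dirDeriv x v (g * h) = eval x g * dirDeriv x v h + eval x h * dirDeriv x v g := by
  simp only [dirDeriv_apply, Finset.mul_sum, ← Finset.sum_add_distrib]
  refine Finset.sum_congr rfl fun l _ => ?_
  rw [pderiv_mul]
  simp only [map_add, map_mul]
  ring

theorem dirDeriv_add_right (x v w : Fin n → ℂ) (g : MvPolynomial (Fin n) ℂ) :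
    dirDeriv x (v + w) g = dirDeriv x v g + dirDeriv x w g := by
  simp [dirDeriv_apply, add_mul, Finset.sum_add_distrib]

theorem dirDeriv_smul_right (x v : Fin n → ℂ) (c : ℂ) (g : MvPolynomial (Fin n) ℂ) :
    dirDeriv x (c • v) g = c * dirDeriv x v g := by
  simp [dirDeriv_apply, Finset.mul_sum, mul_assoc]

theorem dirDeriv_self {g : MvPolynomial (Fin n) ℂ} (hg : g.IsHomogeneous e) (x : Fin n → ℂ) :
    dirDeriv x x g = e * eval x g := by
  have h := congrArg (eval x) hg.sum_X_mul_pderiv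
  simpa [dirDeriv_apply] using h

theorem eval_smul_of_isHomogeneous {g : MvPolynomial (Fin n) ℂ} (hg : g.IsHomogeneous e) (c : ℂ)
    (x : Fin n → ℂ) : eval (c • x) g = c ^ e * eval x g := by
  rw [eval_eq, eval_eq, Finset.mul_sum]
  refine Finset.sum_congr rfl fun m hm => ?_
  have hd : ∑ i, m i = e := by
    rw [← Finsupp.degree_eq_sum]
    by_contra hne
    exact (mem_support_iff.1 hm) (hg.coeff_eq_zero hne)
  have : ∏ i ∈ m.support, (c • x) i ^ m i = c ^ e * ∏ i ∈ m.support, x i ^ m i := by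
    simp only [Pi.smul_apply, smul_eq_mul, mul_pow, Finset.prod_mul_distrib]
    congr 1
    rw [Finset.prod_pow_eq_pow_sum, ← hd]
    congr 1
    exact Finset.sum_subset (Finset.subset_univ _) (by simp)
  rw [this]
  ring

/-- The functional `φ` takes monomials to numbers algebraic over `X`. -/
def DefinedOver (X : Set ℂ) (φ : MvPolynomial (Fin n) ℂ →ₗ[ℂ] ℂ) : Prop :=
  ∀ m, φ (monomial m 1) ∈ acl X

theorem eval_monomial_mem {K : IntermediateField ℚ ℂ} {x : Fin n → ℂ} (hx : ∀ i, x i ∈ K)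
    (m : Fin n →₀ ℕ) {c : ℂ} (hc : c ∈ K) : eval x (monomial m c) ∈ K := by
  rw [eval_monomial]
  exact mul_mem hc (prod_mem fun i _ => pow_mem (hx i) _)

theorem definedOver_evalAt {X : Set ℂ} {x : Fin n → ℂ} (hx : ∀ i, x i ∈ acl X) :
    DefinedOver X (evalAt x) := fun m => by
  rw [evalAt_apply]
  exact eval_monomial_mem hx m (one_mem _)

theorem definedOver_dirDeriv {X : Set ℂ} {x v : Fin n → ℂ} (hx : ∀ i, x i ∈ acl X)
    (hv : ∀ i, v i ∈ acl X) : DefinedOver X (dirDeriv x v) := fun m => by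
  rw [dirDeriv_apply]
  refine sum_mem fun l _ => mul_mem (hv l) ?_
  rw [pderiv_monomial]
  exact eval_monomial_mem hx _ (mul_mem (one_mem _) (natCast_mem _ _))

theorem DefinedOver.sub {X : Set ℂ} {φ ψ : MvPolynomial (Fin n) ℂ →ₗ[ℂ] ℂ}
    (hφ : DefinedOver X φ) (hψ : DefinedOver X ψ) : DefinedOver X (φ - ψ) :=
  fun m => sub_mem (hφ m) (hψ m)

/-- Linear independence of functionals on the forms of degree `e`. -/
def IndepOnForms {κ : Type*} [Fintype κ] (e : ℕ) (φ : κ → MvPolynomial (Fin n) ℂ →ₗ[ℂ] ℂ) : Prop :=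
  ∀ b : κ → ℂ, (∀ g : MvPolynomial (Fin n) ℂ, g.IsHomogeneous e → ∑ a, b a * φ a g = 0) →
    ∀ a, b a = 0

theorem map_eq_sum_coeff {f : MvPolynomial (Fin n) ℂ} (hf : f.IsHomogeneous e)
    (φ : MvPolynomial (Fin n) ℂ →ₗ[ℂ] ℂ) :
    φ f = ∑ m : monos n e, φ (monomial m 1) * f.coeff m := by
  have h : f = ∑ m ∈ monos n e, f.coeff m • monomial m (1 : ℂ) := by
    conv_lhs => rw [f.as_sum]
    refine (Finset.sum_subset (s₂ := monos n e) ?_ ?_).trans ?_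
    · intro m hm
      rw [mem_monos]
      by_contra hne
      exact (mem_support_iff.1 hm) (hf.coeff_eq_zero hne)
    · intro m _ hm
      simp [notMem_support_iff.1 hm]
    · refine Finset.sum_congr rfl fun m _ => ?_
      rw [smul_monomial, smul_eq_mul, mul_one]
  conv_lhs => rw [h]
  rw [map_sum, Finset.sum_coe_sort (monos n e) fun m => φ (monomial m 1) * f.coeff m]
  refine Finset.sum_congr rfl fun m _ => ?_
  rw [map_smul, smul_eq_mul, mul_comm]

/-- The coefficients of the form `f` of degree `e`. -/
def formCoeffs (e : ℕ) (f : MvPolynomial (Fin n) ℂ) : Set ℂ :=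
  Set.range fun m : monos n e => f.coeff m

instance (f : MvPolynomial (Fin n) ℂ) : Finite (formCoeffs e f) := by
  unfold formCoeffs; infer_instance

/-- A functional is a linear equation in the coefficients of `f`, with coefficients its values on
monomials; independence on forms is independence of these equations. -/
theorem rk_union_formCoeffs_add_card_le {κ : Type*} [Fintype κ] {f : MvPolynomial (Fin n) ℂ}
    (hf : f.IsHomogeneous e) (X : Set ℂ) [Finite X] {φ : κ → MvPolynomial (Fin n) ℂ →ₗ[ℂ] ℂ}
    (hφ : ∀ a, DefinedOver X (φ a)) (hi : IndepOnForms e φ) (h : ∀ a, φ a f = 0) :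
    rk (X ∪ formCoeffs e f) + Fintype.card κ ≤ rk X + (monos n e).card := by
  have := rk_union_range_add_card_le X (fun m : monos n e => f.coeff m)
    (fun (a : κ) (m : monos n e) => φ a (monomial (m : Fin n →₀ ℕ) 1)) ?_ ?_ ?_
  · rwa [Fintype.card_coe] at this
  · intro a m
    exact hφ a m
  · rw [Fintype.linearIndependent_iff]
    intro b hb
    apply hi b
    intro g hg
    simp_rw [map_eq_sum_coeff hg, Finset.mul_sum]
    rw [Finset.sum_comm]
    refine Finset.sum_eq_zero fun m _ => ?_
    have := congrFun hb m
    simp only [Finset.sum_apply, Pi.smul_apply, smul_eq_mul, Pi.zero_apply] at this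
    simp_rw [← mul_assoc, ← Finset.sum_mul, this, zero_mul]
  · intro a
    rw [← map_eq_sum_coeff hf, h]

/-- Values at the points `x i` and derivatives in the directions `v i`, `i ∈ T`, are independent
functionals on forms of degree `e`. -/
def JetIndep {ι : Type*} [Fintype ι] (e : ℕ) (x v : ι → Fin n → ℂ) (T : Finset ι) : Prop :=
  ∀ a b : ι → ℂ, (∀ g : MvPolynomial (Fin n) ℂ, g.IsHomogeneous e →
    ∑ i, a i * eval (x i) g + ∑ i ∈ T, b i * dirDeriv (x i) (v i) g = 0) →
    (∀ i, a i = 0) ∧ ∀ i ∈ T, b i = 0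

theorem JetIndep.rk_of_vanishing {ι : Type*} [Fintype ι] {x v : ι → Fin n → ℂ} {T : Finset ι}
    (hi : JetIndep e x v T) {f : MvPolynomial (Fin n) ℂ}
    (hf : f.IsHomogeneous e) (X : Set ℂ) [Finite X] (hx : ∀ i l, x i l ∈ acl X)
    (hv : ∀ i ∈ T, ∀ l, v i l ∈ acl X) (h0 : ∀ i, eval (x i) f = 0)
    (h1 : ∀ i ∈ T, dirDeriv (x i) (v i) f = 0) :
    rk (X ∪ formCoeffs e f) + Fintype.card ι + T.card ≤ rk X + (monos n e).card := by
  classical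
  have := rk_union_formCoeffs_add_card_le (κ := ι ⊕ T) hf X
    (φ := Sum.elim (fun i => evalAt (x i)) (fun i => dirDeriv (x i) (v i))) ?_ ?_ ?_
  · rw [Fintype.card_sum, Fintype.card_coe] at this
    omega
  · rintro (i | i)
    · exact definedOver_evalAt (hx i)
    · exact definedOver_dirDeriv (hx i) (hv i i.2)
  · intro b hb
    have := hi (fun i => b (Sum.inl i)) (fun i => if h : i ∈ T then b (Sum.inr ⟨i, h⟩) else 0) ?_
    · rintro (i | i)
      · exact this.1 i
      · simpa using this.2 i i.2
    · intro g hg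
      have h := hb g hg
      rw [Fintype.sum_sum_type] at h
      simp only [Sum.elim_inl, Sum.elim_inr, evalAt_apply] at h
      rw [← h, ← Finset.sum_coe_sort T]
      simp
  · rintro (i | i)
    · simpa using h0 i
    · exact h1 i i.2

/-- Equality of the values amounts to one condition fewer than their vanishing, hence the `+ 1`. -/
theorem JetIndep.rk_of_eq {ι : Type*} [Fintype ι] {x v : ι → Fin n → ℂ} {T : Finset ι}
    (hi : JetIndep e x v T) {f : MvPolynomial (Fin n) ℂ}
    (hf : f.IsHomogeneous e) (X : Set ℂ) [Finite X] (hx : ∀ i l, x i l ∈ acl X)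
    (hv : ∀ i ∈ T, ∀ l, v i l ∈ acl X) (i₀ : ι) (h0 : ∀ i, eval (x i) f = eval (x i₀) f)
    (h1 : ∀ i ∈ T, dirDeriv (x i) (v i) f = 0) :
    rk (X ∪ formCoeffs e f) + Fintype.card ι + T.card ≤ rk X + (monos n e).card + 1 := by
  classical
  have := rk_union_formCoeffs_add_card_le (κ := {i // i ≠ i₀} ⊕ T) hf X
    (φ := Sum.elim (fun i => evalAt (x i) - evalAt (x i₀)) (fun i => dirDeriv (x i) (v i))) ?_ ?_ ?_
  · rw [Fintype.card_sum, Fintype.card_coe] at this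
    have h2 : Fintype.card {i // i ≠ i₀} + 1 = Fintype.card ι := by
      rw [Fintype.card_subtype_compl, Fintype.card_subtype_eq]
      have : 0 < Fintype.card ι := Fintype.card_pos_iff.2 ⟨i₀⟩
      omega
    omega
  · rintro (i | i)
    · exact (definedOver_evalAt (hx i)).sub (definedOver_evalAt (hx i₀))
    · exact definedOver_dirDeriv (hx i) (hv i i.2)
  · intro b hb
    -- A combination of differences with the value at `x i₀` is a combination of values of total
    -- weight zero, which fixes the weight at `i₀`.
    have := hi (fun i => if h : i ≠ i₀ then b (Sum.inl ⟨i, h⟩) else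
        - ∑ j : {i // i ≠ i₀}, b (Sum.inl j))
      (fun i => if h : i ∈ T then b (Sum.inr ⟨i, h⟩) else 0) ?_
    · rintro (i | i)
      · simpa [i.2] using this.1 i
      · simpa using this.2 i i.2
    · intro g hg
      have h := hb g hg
      rw [Fintype.sum_sum_type] at h
      simp only [Sum.elim_inl, Sum.elim_inr, evalAt_apply, LinearMap.sub_apply] at h
      rw [← h, ← Finset.sum_coe_sort T]
      congr 1
      · have h3 : ∀ i : {i // i ≠ i₀}, (if h : (i : ι) ≠ i₀ then b (Sum.inl ⟨i, h⟩) else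
            - ∑ j : {i // i ≠ i₀}, b (Sum.inl j)) = b (Sum.inl i) := fun i => dif_pos i.2
        rw [← Finset.add_sum_erase _ _ (Finset.mem_univ i₀),
          Finset.sum_subtype (p := fun i => i ≠ i₀) (F := inferInstance)
            (Finset.univ.erase i₀) (by simp)]
        simp only [h3, mul_sub, Finset.sum_sub_distrib, ← Finset.sum_mul]
        simp only [ne_eq, not_true_eq_false, dif_neg, not_false_eq_true]
        ring
      · refine Finset.sum_congr rfl fun i _ => ?_
        simp
  · rintro (i | i)
    · simp [h0 i]
    · exact h1 i i.2

end Functionals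

/-! ### Interpolation by products of linear forms -/

section Interpolation

variable {n e : ℕ}

theorem exists_linear_form {W : Submodule ℂ (Fin n → ℂ)} {y : Fin n → ℂ} (hy : y ∉ W) :
    ∃ p : MvPolynomial (Fin n) ℂ, p.IsHomogeneous 1 ∧ (∀ x ∈ W, eval x p = 0) ∧ eval y p ≠ 0 ∧
      ∀ x v, dirDeriv x v p = eval v p := by
  classical
  obtain ⟨f, hf, hW⟩ := Submodule.exists_le_ker_of_notMem hy
  have hev : ∀ x : Fin n → ℂ, eval x (∑ l, C (f (Pi.single l 1)) * X l) = f x := by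
    intro x
    rw [f.pi_apply_eq_sum_univ x]
    simp [mul_comm, ← Pi.single_apply]
    refine Finset.sum_congr rfl fun i _ => ?_
    congr 2
    ext j
    simp [Pi.single_apply, eq_comm]
  refine ⟨∑ l, C (f (Pi.single l 1)) * X l, ?_, ?_, ?_, ?_⟩
  · exact IsHomogeneous.sum _ _ _ fun l _ => isHomogeneous_C_mul_X _ _
  · intro x hx
    rw [hev]
    exact hW hx
  · rwa [hev]
  · intro x v
    rw [dirDeriv_apply]
    simp [pderiv_X, Pi.single_apply, mul_comm]

theorem dirDeriv_eq_zero_of_sq_dvd {p g : MvPolynomial (Fin n) ℂ} {x : Fin n → ℂ}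
    (hp : eval x p = 0) (h : p ^ 2 ∣ g) (v : Fin n → ℂ) : dirDeriv x v g = 0 := by
  obtain ⟨r, rfl⟩ := h
  rw [dirDeriv_mul, pow_two, dirDeriv_mul]
  simp [hp]

theorem eval_eq_zero_of_dvd {p g : MvPolynomial (Fin n) ℂ} {x : Fin n → ℂ}
    (hp : eval x p = 0) (h : p ∣ g) : eval x g = 0 := by
  obtain ⟨r, rfl⟩ := h
  simp [hp]

theorem ne_zero_of_notMem_span {x y : Fin n → ℂ} (h : y ∉ Submodule.span ℂ {x}) : y ≠ 0 := by
  rintro rfl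
  exact h (zero_mem _)

/-- If for every `i` there is a form of small degree that vanishes to the required order at all the
other points but not at `x i`, then the jets at the points are independent. -/
theorem jetIndep_of_separating {ι : Type*} [Fintype ι] [DecidableEq ι] {x v : ι → Fin n → ℂ}
    {T : Finset ι} (hx : ∀ i, x i ≠ 0) (hv : ∀ i ∈ T, v i ∉ Submodule.span ℂ {x i})
    (h : ∀ i, ∃ g : MvPolynomial (Fin n) ℂ, ∃ e', g.IsHomogeneous e' ∧
      e' + (if i ∈ T then 1 else 0) ≤ e ∧ eval (x i) g ≠ 0 ∧
      ∀ j, j ≠ i → eval (x j) g = 0 ∧ (j ∈ T → dirDeriv (x j) (v j) g = 0)) :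
    JetIndep e x v T := by
  intro a b hab
  have key : ∀ i, a i = 0 ∧ (i ∈ T → b i = 0) := by
    intro i
    obtain ⟨g, e', hg, he, hgi, hgj⟩ := h i
    -- Powers of `m`, which does not vanish at `x i`, raise test forms to degree `e`.
    obtain ⟨m, hm, -, hmi, -⟩ := exists_linear_form (W := ⊥) (y := x i) (by simpa using hx i)
    have hval : ∀ q r, q.IsHomogeneous r → e' + r = e →
        a i * (eval (x i) g * eval (x i) q) + (if i ∈ T then b i *
          (eval (x i) g * dirDeriv (x i) (v i) q + eval (x i) q * dirDeriv (x i) (v i) g) else 0)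
          = 0 := by
      intro q r hq her
      have := hab (g * q) (her ▸ hg.mul hq)
      refine Eq.trans ?_ this
      congr 1
      · rw [Finset.sum_eq_single i]
        · simp
        · intro j _ hj
          simp [(hgj j hj).1]
        · simp
      · split_ifs with hi
        · rw [Finset.sum_eq_single i, dirDeriv_mul]
          · intro j hjT hj
            simp [dirDeriv_mul, (hgj j hj).1, (hgj j hj).2 hjT]
          · intro h; exact absurd hi h
        · refine (Finset.sum_eq_zero fun j hjT => ?_).symm
          have hj : j ≠ i := fun h => hi (h ▸ hjT)
          simp [dirDeriv_mul, (hgj j hj).1, (hgj j hj).2 hjT]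
    by_cases hi : i ∈ T
    · simp only [hi, if_true] at he hval
      -- The factor `u` vanishes at `x i` but not along `v i`: a test form containing it isolates `b
      -- i`, and one without it then isolates `a i`. This is where the extra degree for `i ∈ T` is
      -- spent.
      obtain ⟨u, hu, hux, huv, hud⟩ := exists_linear_form (hv i hi)
      have hux := hux (x i) (Submodule.mem_span_singleton_self _)
      have h1 := hval (m ^ (e - e' - 1) * u) (1 * (e - e' - 1) + 1) ((hm.pow _).mul hu) (by omega)
      simp only [dirDeriv_mul, hud, map_mul, map_pow, hux, mul_zero, zero_mul, add_zero,
        zero_add, mul_eq_zero, pow_eq_zero_iff', hgi, huv, hmi, false_and, or_false] at h1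
      have h2 := hval (m ^ (e - e')) (1 * (e - e')) (hm.pow _) (by omega)
      rw [h1] at h2
      simp only [zero_mul, add_zero, map_pow, mul_eq_zero, pow_eq_zero_iff', hgi, hmi, false_and,
        or_false] at h2
      exact ⟨h2, fun _ => h1⟩
    · simp only [hi, if_false] at he hval
      have h2 := hval (m ^ (e - e')) (1 * (e - e')) (hm.pow _) (by omega)
      simp only [add_zero, map_pow, mul_eq_zero, pow_eq_zero_iff', hgi, hmi, false_and,
        or_false] at h2
      exact ⟨h2, fun h => absurd h hi⟩
  exact ⟨fun i => (key i).1, fun i hi => (key i).2 hi⟩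

/-- Jets at points on distinct rays are independent on forms of large degree. -/
theorem jetIndep_of_card_le {ι : Type*} [Fintype ι] {x v : ι → Fin n → ℂ}
    {T : Finset ι} (hx : ∀ i, x i ≠ 0) (hxx : ∀ i j, i ≠ j → x i ∉ Submodule.span ℂ {x j})
    (hv : ∀ i ∈ T, v i ∉ Submodule.span ℂ {x i}) (he : Fintype.card ι + T.card ≤ e + 1) :
    JetIndep e x v T := by
  classical
  refine jetIndep_of_separating hx hv fun i => ?_
  have hl : ∀ j, ∃ p : MvPolynomial (Fin n) ℂ, j ≠ i →
      (p.IsHomogeneous 1 ∧ eval (x j) p = 0 ∧ eval (x i) p ≠ 0) := by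
    intro j
    by_cases hj : j = i
    · exact ⟨0, fun h => absurd hj h⟩
    · obtain ⟨p, hp, hpj, hpi, -⟩ := exists_linear_form (hxx i j (Ne.symm hj))
      exact ⟨p, fun _ => ⟨hp, hpj _ (Submodule.mem_span_singleton_self _), hpi⟩⟩
  choose p hp using hl
  -- A squared factor kills the derivative at `x j` as well as the value.
  refine ⟨∏ j ∈ Finset.univ.erase i, p j ^ (if j ∈ T then 2 else 1),
    ∑ j ∈ Finset.univ.erase i, 1 * (if j ∈ T then 2 else 1), ?_, ?_, ?_, ?_⟩
  · exact IsHomogeneous.prod _ _ _ fun j hj => (hp j (Finset.ne_of_mem_erase hj)).1.pow _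
  · have h1 : ∀ j, 1 * (if j ∈ T then 2 else 1) = 1 + (if j ∈ T then 1 else 0) := by
      intro j; split_ifs <;> rfl
    simp_rw [h1]
    have h2 : ∑ j ∈ Finset.univ.erase i, (1 + (if j ∈ T then 1 else 0)) + (1 +
      (if i ∈ T then 1 else 0)) = Fintype.card ι + T.card := by
      rw [Finset.sum_erase_add _ _ (Finset.mem_univ i), Finset.sum_add_distrib]
      simp
    omega
  · rw [map_prod, Finset.prod_ne_zero_iff]
    intro j hj
    rw [map_pow]
    exact pow_ne_zero _ (hp j (Finset.ne_of_mem_erase hj)).2.2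
  · intro j hj
    have hdvd := Finset.dvd_prod_of_mem (fun j => p j ^ (if j ∈ T then 2 else 1))
      (Finset.mem_erase.2 ⟨hj, Finset.mem_univ j⟩)
    constructor
    · refine eval_eq_zero_of_dvd (hp j hj).2.1 ((dvd_pow_self _ ?_).trans hdvd)
      split_ifs <;> simp
    · intro hjT
      refine dirDeriv_eq_zero_of_sq_dvd (hp j hj).2.1 ?_ _
      simpa [hjT] using hdvd

/-- A sharper version for points that do not all lie on a plane through the origin. -/
theorem jetIndep_of_not_coplanar {ι : Type*} [Fintype ι] {x v : ι → Fin n → ℂ}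
    {T : Finset ι} (hx : ∀ i, x i ≠ 0) (hxx : ∀ i j, i ≠ j → x i ∉ Submodule.span ℂ {x j})
    (hv : ∀ i ∈ T, v i ∉ Submodule.span ℂ {x i})
    (hpair : ∀ i, ∃ a b, a ≠ b ∧ a ≠ i ∧ b ≠ i ∧ x i ∉ Submodule.span ℂ {x a, x b})
    (he : 2 * Fintype.card ι ≤ e + 3) :
    JetIndep e x v T := by
  classical
  refine jetIndep_of_separating hx hv fun i => ?_
  have hl : ∀ j, ∃ p : MvPolynomial (Fin n) ℂ, j ≠ i →
      (p.IsHomogeneous 1 ∧ eval (x j) p = 0 ∧ eval (x i) p ≠ 0) := by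
    intro j
    by_cases hj : j = i
    · exact ⟨0, fun h => absurd hj h⟩
    · obtain ⟨p, hp, hpj, hpi, -⟩ := exists_linear_form (hxx i j (Ne.symm hj))
      exact ⟨p, fun _ => ⟨hp, hpj _ (Submodule.mem_span_singleton_self _), hpi⟩⟩
  choose p hp using hl
  obtain ⟨a, b, hab, hai, hbi, hiab⟩ := hpair i
  -- One linear form through both `x a` and `x b` replaces two, so squaring all the factors costs
  -- only degree 2(card ι - 2).
  obtain ⟨q, hq, hqab, hqi, -⟩ := exists_linear_form hiab
  set s := ((Finset.univ.erase i).erase a).erase b with hs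
  have hsi : ∀ j ∈ s, j ≠ i := fun j hj =>
    Finset.ne_of_mem_erase (Finset.mem_of_mem_erase (Finset.mem_of_mem_erase hj))
  have hcard : s.card + 3 = Fintype.card ι := by
    have h1 : s.card + 1 = ((Finset.univ.erase i).erase a).card :=
      Finset.card_erase_add_one (by simp [hbi, hab.symm])
    have h2 : ((Finset.univ.erase i).erase a).card + 1 = (Finset.univ.erase i).card :=
      Finset.card_erase_add_one (by simp [hai])
    have h3 : (Finset.univ.erase i).card + 1 = Fintype.card ι :=
      Finset.card_erase_add_one (by simp)
    omega
  have hq2 : ∀ j, j ≠ i → j ∉ s → eval (x j) q = 0 := by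
    intro j hj hjs
    refine hqab _ (Submodule.subset_span ?_)
    simp only [hs, Finset.mem_erase, Finset.mem_univ] at hjs
    simp only [Set.mem_insert_iff, Set.mem_singleton_iff]
    by_cases h : j = a
    · simp [h]
    · have : j = b := by tauto
      simp [this]
  refine ⟨q ^ 2 * ∏ j ∈ s, p j ^ 2, 1 * 2 + ∑ j ∈ s, 1 * 2, ?_, ?_, ?_, ?_⟩
  · exact (hq.pow 2).mul (IsHomogeneous.prod _ _ _ fun j hj => (hp j (hsi j hj)).1.pow _)
  · rw [Finset.sum_const, smul_eq_mul]
    split_ifs <;> omega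
  · rw [map_mul, map_prod, map_pow]
    refine mul_ne_zero (pow_ne_zero _ hqi) (Finset.prod_ne_zero_iff.2 fun j hj => ?_)
    rw [map_pow]
    exact pow_ne_zero _ (hp j (hsi j hj)).2.2
  · intro j hj
    by_cases hjs : j ∈ s
    · have hdvd : p j ^ 2 ∣ q ^ 2 * ∏ j ∈ s, p j ^ 2 :=
        (Finset.dvd_prod_of_mem (fun j => p j ^ 2) hjs).mul_left _
      exact ⟨eval_eq_zero_of_dvd (hp j hj).2.1 ((dvd_pow_self _ two_ne_zero).trans hdvd),
        fun _ => dirDeriv_eq_zero_of_sq_dvd (hp j hj).2.1 hdvd _⟩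
    · have hdvd : q ^ 2 ∣ q ^ 2 * ∏ j ∈ s, p j ^ 2 := dvd_mul_right _ _
      exact ⟨eval_eq_zero_of_dvd (hq2 j hj hjs) ((dvd_pow_self _ two_ne_zero).trans hdvd),
        fun _ => dirDeriv_eq_zero_of_sq_dvd (hq2 j hj hjs) hdvd _⟩

/-- The value at `x` and the derivatives at `x` in independent directions, transversal to `x`, are
independent functionals on forms. -/
theorem indepOnForms_evalAt_dirDeriv {κ : Type*} [Fintype κ] (he : 1 ≤ e) {x : Fin n → ℂ}
    {v : κ → Fin n → ℂ} (h : LinearIndependent ℂ (Option.elim · x v)) :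
    IndepOnForms e (fun o : Option κ => o.elim (evalAt x) (fun i => dirDeriv x (v i))) := by
  classical
  intro b hb
  have hx : x ∉ (⊥ : Submodule ℂ (Fin n → ℂ)) := by simpa using h.ne_zero none
  obtain ⟨m, hm, -, hmx, hmd⟩ := exists_linear_form hx
  have key : ∀ i, b (some i) = 0 := by
    intro i
    have hi := h.notMem_span_image (s := {some i}ᶜ) (x := some i) (by simp)
    obtain ⟨u, hu, hu0, hui, hud⟩ := exists_linear_form hi
    have hux : eval x u = 0 := hu0 x (Submodule.subset_span ⟨none, by simp, rfl⟩)
    have huj : ∀ j, j ≠ i → eval (v j) u = 0 := fun j hj =>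
      hu0 _ (Submodule.subset_span ⟨some j, by simpa using hj, rfl⟩)
    have hui : eval (v i) u ≠ 0 := hui
    have h1 := hb (m ^ (e - 1) * u) (by
      have := (hm.pow (e - 1)).mul hu
      rwa [show 1 * (e - 1) + 1 = e by omega] at this)
    rw [Fintype.sum_option, Finset.sum_eq_single i] at h1
    · simp only [Option.elim, evalAt_apply, dirDeriv_mul, hud, map_mul, map_pow, hux, mul_zero,
        zero_mul, add_zero, zero_add, mul_eq_zero, pow_eq_zero_iff', hui, hmx, false_and,
        or_false] at h1
      exact h1
    · intro j _ hj
      simp [dirDeriv_mul, hud, hux, huj j hj]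
    · simp
  intro o
  cases o with
  | some i => exact key i
  | none =>
    have h1 := hb (m ^ e) (by simpa using hm.pow e)
    rw [Fintype.sum_option, Finset.sum_eq_zero (fun i _ => by rw [key, zero_mul])] at h1
    simpa [hmx] using h1

end Interpolation

/-! ### Finiteness of homogeneous maps, and zeros of generic forms -/

/-- If a system of forms over `acl S` has only the trivial zero, then every point at which it takes
values in `acl S` has coordinates in `acl S`. -/
theorem mem_acl_of_forall_eval_mem {n : ℕ} {ι : Type*} (S : Set ℂ)
    (f : ι → MvPolynomial (Fin n) ℂ) (e : ι → ℕ) (he : ∀ i, 0 < e i)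
    (hf : ∀ i, (f i).IsHomogeneous (e i)) (hc : ∀ i m, (f i).coeff m ∈ acl S)
    (hz : ∀ y : Fin n → ℂ, (∀ i, eval y (f i) = 0) → y = 0) (x : Fin n → ℂ)
    (hx : ∀ i, eval x (f i) ∈ acl S) (l : Fin n) : x l ∈ acl S := by
  classical
  set K := acl S
  have hlift : ∀ i, ∃ g : MvPolynomial (Fin n) K, map (algebraMap K ℂ) g = f i := by
    intro i
    change f i ∈ Set.range (map (algebraMap K ℂ))
    rw [mem_range_map_iff_coeffs_subset]
    intro c hc'
    rw [Finset.mem_coe, mem_coeffs_iff] at hc'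
    obtain ⟨m, -, rfl⟩ := hc'
    exact ⟨⟨_, hc i m⟩, rfl⟩
  choose g hg using hlift
  have hghom : ∀ i, (g i).IsHomogeneous (e i) := fun i =>
    IsHomogeneous.of_map (algebraMap K ℂ).injective (by rw [hg i]; exact hf i)
  have hae : ∀ i (y : Fin n → ℂ), aeval y (g i) = eval y (f i) := by
    intro i y
    rw [← hg i, eval_map, aeval_def]
  set I := Ideal.span (Set.range g)
  -- Nullstellensatz over `K`, with zeros in the algebraically closed field ℂ.
  have hrad : ∀ l, ∃ N, (X l : MvPolynomial (Fin n) K) ^ N ∈ I := by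
    intro l
    have : (X l : MvPolynomial (Fin n) K) ∈ vanishingIdeal K (zeroLocus ℂ I) := by
      intro y hy
      have : y = 0 := hz y fun i => by
        rw [← hae]; exact hy _ (Ideal.subset_span ⟨i, rfl⟩)
      simp [this]
    rw [vanishingIdeal_zeroLocus_eq_radical] at this
    exact this
  choose N hN using hrad
  set D := ∑ l, N l
  have hmon : ∀ m : Fin n →₀ ℕ, D < m.degree → monomial m (1 : K) ∈ I := by
    intro m hm
    have : ∃ l, N l ≤ m l := by
      by_contra! hlt
      rw [Finsupp.degree_eq_sum] at hm
      exact absurd hm (not_lt.2 (Finset.sum_le_sum fun l _ => (hlt l).le))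
    obtain ⟨l, hl⟩ := this
    have hdvd : (X l : MvPolynomial (Fin n) K) ^ N l ∣ monomial m 1 := by
      rw [X_pow_eq_monomial]
      exact monomial_dvd_monomial.2 ⟨Or.inr (by simpa using hl), dvd_rfl⟩
    exact I.mem_of_dvd hdvd (hN l)
  -- A monomial of degree t > `D` lies in `I`, hence is a combination of products of monomials of
  -- degree less than t with forms `g i`. At `x` the `g i` take values in `K`, so induction on t
  -- puts all monomials at `x` into this finite-dimensional space, which makes `x l` integral over
  -- `K`.
  set V : Submodule K ℂ := Submodule.span K
    ((fun m : Fin n →₀ ℕ => aeval x (monomial m (1 : K))) '' {m | m.degree ≤ D})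
  have hVfin : Module.Finite K V := by
    apply Module.Finite.span_of_finite
    apply Set.Finite.image
    have : {m : Fin n →₀ ℕ | m.degree ≤ D} ⊆ ⋃ e ∈ Finset.range (D + 1), ↑(monos n e) := by
      intro m hm
      simp only [Set.mem_iUnion]
      exact ⟨m.degree, Finset.mem_range.2 (Nat.lt_succ_of_le hm), by simp [mem_monos]⟩
    exact (Set.Finite.biUnion (Finset.finite_toSet _) fun e _ => Finset.finite_toSet _).subset this
  have hV : ∀ t, ∀ m : Fin n →₀ ℕ, m.degree = t → aeval x (monomial m (1 : K)) ∈ V := by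
    intro t
    induction t using Nat.strong_induction_on with
    | _ t ih =>
      intro m hm
      by_cases hD : m.degree ≤ D
      · exact Submodule.subset_span ⟨m, hD, rfl⟩
      have hterm : ∀ i (q : MvPolynomial (Fin n) K),
          aeval x (homogeneousComponent t (q * g i)) ∈ V := by
        intro i q
        induction q using MvPolynomial.induction_on' with
        | monomial k c =>
          have hh : (monomial k c * g i).IsHomogeneous (k.degree + e i) :=
            (isHomogeneous_monomial c rfl).mul (hghom i)
          rw [homogeneousComponent_of_mem hh]
          split_ifs with ht
          · have h1 : aeval x (monomial k c * g i) =
                (⟨eval x (f i), hx i⟩ * c : K) • aeval x (monomial k (1 : K)) := by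
              rw [map_mul, hae]
              simp only [aeval_monomial, Algebra.smul_def, map_mul, map_one, one_mul]
              rw [show (algebraMap K ℂ) ⟨eval x (f i), hx i⟩ = eval x (f i) from rfl]
              ring
            rw [h1]
            exact V.smul_mem _ (ih k.degree (by have := he i; omega) k rfl)
          · simp
        | add p q hp hq =>
          rw [add_mul, map_add, map_add]
          exact V.add_mem hp hq
      obtain ⟨c, hc⟩ := Finsupp.mem_ideal_span_range_iff_exists_finsupp.1 (hmon m (not_le.1 hD))
      have h2 : monomial m (1 : K) = homogeneousComponent t (monomial m (1 : K)) :=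
        (homogeneousComponent_eq_self (isHomogeneous_monomial _ hm)).symm
      rw [h2, ← hc, Finsupp.sum, map_sum, map_sum]
      exact V.sum_mem fun i _ => hterm i _
  apply mem_acl_of_isAlgebraic
  have hle : Subalgebra.toSubmodule (Algebra.adjoin K {x l}) ≤ V := by
    rw [Algebra.adjoin_singleton_eq_range_aeval]
    rintro _ ⟨p, rfl⟩
    simp only [AlgHom.toRingHom_eq_coe, RingHom.coe_coe, Polynomial.aeval_eq_sum_range]
    refine V.sum_mem fun k _ => V.smul_mem _ ?_
    have := hV k (Finsupp.single l k) (by simp)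
    simpa [aeval_monomial] using this
  have : Module.Finite K (Subalgebra.toSubmodule (Algebra.adjoin K {x l})) :=
    Submodule.finiteDimensional_of_le hle
  exact (IsIntegral.of_mem_of_fg (Algebra.adjoin K {x l}) (Module.Finite.iff_fg.1 this) _
    (Algebra.subset_adjoin rfl)).isAlgebraic

theorem dirDeriv_smul_left {n e : ℕ} {g : MvPolynomial (Fin n) ℂ} (hg : g.IsHomogeneous e) (c : ℂ)
    (x v : Fin n → ℂ) : dirDeriv (c • x) v g = c ^ (e - 1) * dirDeriv x v g := by
  simp only [dirDeriv_apply, eval_smul_of_isHomogeneous hg.pderiv, Finset.mul_sum]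
  exact Finset.sum_congr rfl fun l _ => by ring

/-- Coordinates outside `s` do not contribute to the transcendence degree if they are algebraic. -/
theorem rk_le_add_card_of_forall_notMem {ι : Type*} {S : Set ℂ} [Finite S] (x : ι → ℂ)
    (s : Finset ι)
    (h : ∀ i, i ∉ s → x i ∈ acl S) : rk (S ∪ Set.range x) ≤ rk S + s.card := by
  have := rk_le_add_card (S := S) (T := S ∪ Set.range x) (fun i : s => x i) ?_
  · rwa [Fintype.card_coe] at this
  · rintro z (hz | ⟨i, rfl⟩)
    · exact subset_acl _ (Or.inl hz)
    · by_cases hi : i ∈ s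
      · exact subset_acl _ (Or.inr ⟨⟨i, hi⟩, rfl⟩)
      · exact acl_mono Set.subset_union_left (h i hi)

theorem rk_empty : rk ∅ = 0 := by
  simp [rk]

namespace HomMap

variable {n : ℕ} {d : Fin n → ℕ}

/-- The coefficients of `F` as a finite family. -/
def coeffFamily (F : HomMap d) : (Σ j, monos n (d j)) → ℂ := fun a => (F.poly a.1).coeff a.2

/-- The coefficients of `F` are algebraically independent over `ℚ`. -/
def Generic (F : HomMap d) : Prop := AlgebraicIndependent ℚ F.coeffFamily

/-- The coefficients of the components of `F` with index in `J`. -/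
def coeffSet (F : HomMap d) (J : Finset (Fin n)) : Set ℂ :=
  ⋃ j ∈ J, formCoeffs (d j) (F.poly j)

/-- The number of coefficients of the components with index in `J`. -/
def numCoeffs (d : Fin n → ℕ) (J : Finset (Fin n)) : ℕ := ∑ j ∈ J, (monos n (d j)).card

instance (F : HomMap d) (J : Finset (Fin n)) : Finite (F.coeffSet J) :=
  J.finite_toSet.biUnion fun _ _ => Set.toFinite _

theorem coeffSet_insert (F : HomMap d) (j : Fin n) (J : Finset (Fin n)) :
    F.coeffSet (insert j J) = F.coeffSet J ∪ formCoeffs (d j) (F.poly j) := by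
  rw [coeffSet, Finset.set_biUnion_insert, Set.union_comm]
  rfl

theorem coeffSet_univ (F : HomMap d) (l : Fin n) :
    F.coeffSet Finset.univ = F.coeffSet (Finset.univ.erase l) ∪ formCoeffs (d l) (F.poly l) := by
  rw [← coeffSet_insert, Finset.insert_erase (Finset.mem_univ l)]

theorem numCoeffs_univ (d : Fin n → ℕ) (l : Fin n) :
    numCoeffs d Finset.univ = numCoeffs d (Finset.univ.erase l) + (monos n (d l)).card :=
  (Finset.sum_erase_add _ _ (Finset.mem_univ l)).symm

theorem coeff_mem_acl (F : HomMap d) {J : Finset (Fin n)} {j : Fin n} (hj : j ∈ J)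
    (m : Fin n →₀ ℕ) : (F.poly j).coeff m ∈ acl (F.coeffSet J) := by
  by_cases hm : m ∈ monos n (d j)
  · exact subset_acl _ (Set.mem_biUnion hj ⟨⟨m, hm⟩, rfl⟩)
  · rw [(F.homogeneous j).coeff_eq_zero (by rwa [mem_monos] at hm)]
    exact zero_mem _

theorem eval_mem_acl {K : IntermediateField ℚ ℂ} {p : MvPolynomial (Fin n) ℂ}
    (hp : ∀ m, p.coeff m ∈ K) {x : Fin n → ℂ} (hx : ∀ i, x i ∈ K) : eval x p ∈ K := by
  rw [p.as_sum, map_sum]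
  exact sum_mem fun m _ => eval_monomial_mem hx m (hp m)

theorem Generic.rk_coeffSet {F : HomMap d} (hF : F.Generic) (J : Finset (Fin n)) :
    rk (F.coeffSet J) = numCoeffs d J := by
  have h : AlgebraicIndependent ℚ
      (fun a : (Σ j : J, monos n (d j)) => F.coeffFamily ⟨a.1, a.2⟩) := by
    refine hF.comp (fun a : (Σ j : J, monos n (d j)) => ⟨a.1, a.2⟩) ?_
    rintro ⟨⟨a, ha⟩, b⟩ ⟨⟨a', ha'⟩, b'⟩ hab
    simp only [Sigma.mk.injEq] at hab
    obtain ⟨rfl, hb⟩ := hab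
    rw [heq_eq_eq] at hb
    rw [hb]
  have h1 := rk_range_of_algebraicIndependent h
  have h2 : F.coeffSet J = Set.range
      (fun a : (Σ j : J, monos n (d j)) => F.coeffFamily ⟨a.1, a.2⟩) := by
    ext z
    simp only [coeffSet, formCoeffs, coeffFamily, Set.mem_iUnion, Set.mem_range, Sigma.exists]
    constructor
    · rintro ⟨j, hj, m, rfl⟩
      exact ⟨⟨j, hj⟩, m, rfl⟩
    · rintro ⟨j, m, rfl⟩
      exact ⟨j, j.2, m, rfl⟩
  rw [h2, h1, Fintype.card_sigma, numCoeffs, ← Finset.sum_coe_sort J]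
  simp

theorem Generic.numCoeffs_le {F : HomMap d} (hF : F.Generic) (J : Finset (Fin n)) (X : Set ℂ)
    [Finite X] : numCoeffs d J ≤ rk (X ∪ F.coeffSet J) := by
  rw [← hF.rk_coeffSet J]
  exact rk_mono (Set.subset_union_right.trans (subset_acl _))

/-- If each component of index `j ∈ J` satisfies `r j` independent linear conditions over `X`, then
adjoining its coefficients to `X` loses this much transcendence degree. -/
theorem rk_union_coeffSet_add_le (F : HomMap d) (J : Finset (Fin n)) (X : Set ℂ) [Finite X]
    (r : Fin n → ℕ) (h : ∀ j ∈ J, ∀ Y : Set ℂ, Finite Y → (acl X : Set ℂ) ⊆ acl Y →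
      rk (Y ∪ formCoeffs (d j) (F.poly j)) + r j ≤ rk Y + (monos n (d j)).card) :
    rk (X ∪ F.coeffSet J) + ∑ j ∈ J, r j ≤ rk X + numCoeffs d J := by
  induction J using Finset.induction_on with
  | empty => simp [coeffSet, numCoeffs]
  | insert j J hj ih =>
    have h1 := ih fun i hi => h i (Finset.mem_insert_of_mem hi)
    have h2 := h j (Finset.mem_insert_self j J) (X ∪ F.coeffSet J) inferInstance
      (acl_mono Set.subset_union_left)
    rw [Set.union_assoc, ← coeffSet_insert] at h2
    rw [Finset.sum_insert hj, numCoeffs, Finset.sum_insert hj, ← numCoeffs]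
    omega

/-- A nontrivial zero of `r` generic forms has at most `n - 1 - r` vanishing coordinates. -/
theorem Generic.eq_zero_of_eval_eq_zero {F : HomMap d} (hF : F.Generic) {J B : Finset (Fin n)}
    (hJB : n ≤ J.card + B.card) {x : Fin n → ℂ} (hB : ∀ i ∈ B, x i = 0)
    (hJ : ∀ j ∈ J, eval x (F.poly j) = 0) : x = 0 := by
  classical
  by_contra hx
  obtain ⟨m, hm⟩ := Function.ne_iff.1 hx
  have hm : x m ≠ 0 := hm
  -- Normalising one coordinate leaves n - 1 - |B| free ones, against the |J| conditions of
  -- vanishing at `y`.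
  set y := (x m)⁻¹ • x
  have hym : y m = 1 := by simp [y, hm]
  have hy0 : y ≠ 0 := fun h => by simp [h] at hym
  have hyB : ∀ i ∈ B, y i = 0 := fun i hi => by simp [y, hB i hi]
  have hyJ : ∀ j ∈ J, eval y (F.poly j) = 0 := fun j hj => by
    rw [eval_smul_of_isHomogeneous (F.homogeneous j), hJ j hj, mul_zero]
  have h1 := F.rk_union_coeffSet_add_le J (Set.range y) (fun _ => 1) ?_
  · have h2 := hF.numCoeffs_le J (Set.range y)
    have h3 := rk_le_add_card_of_forall_notMem (S := ∅) y (insert m B)ᶜ ?_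
    · rw [Set.empty_union, rk_empty] at h3
      have hmB : m ∉ B := fun h => by simp [hyB m h] at hym
      have h4 := Finset.card_compl (insert m B)
      rw [Finset.card_insert_of_notMem hmB, Fintype.card_fin] at h4
      rw [Finset.sum_const, smul_eq_mul, mul_one] at h1
      have h5 : (insert m B).card ≤ Fintype.card (Fin n) := Finset.card_le_univ _
      rw [Finset.card_insert_of_notMem hmB, Fintype.card_fin] at h5
      omega
    · intro i hi
      rw [Finset.mem_compl, not_not, Finset.mem_insert] at hi
      rcases hi with rfl | hi
      · rw [hym]; exact one_mem _
      · rw [hyB i hi]; exact zero_mem _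
  · intro j hj Y _ hXY
    have hi : JetIndep (d j) (fun _ : Unit => y) (fun _ : Unit => y) ∅ :=
      jetIndep_of_card_le (fun _ => hy0) (fun i j h => absurd (Subsingleton.elim i j) h)
        (by simp) (by simp)
    have := hi.rk_of_vanishing (F.homogeneous j) Y
      (fun _ l => hXY (subset_acl _ ⟨l, rfl⟩)) (by simp) (fun _ => hyJ j hj) (by simp)
    simpa using this

/-- `n - 1` generic forms cut out finitely many reduced rays. -/
theorem Generic.mem_span_of_dirDeriv_eq_zero {F : HomMap d} (hF : F.Generic) (hn : 2 ≤ n)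
    (hd : ∀ i, 2 ≤ d i) {J : Finset (Fin n)} (hJ : J.card + 1 = n) {x v : Fin n → ℂ} (hx : x ≠ 0)
    (h0 : ∀ j ∈ J, eval x (F.poly j) = 0) (h1 : ∀ j ∈ J, dirDeriv x v (F.poly j) = 0) :
    v ∈ Submodule.span ℂ {x} := by
  classical
  by_contra hv
  obtain ⟨m, hm⟩ := Function.ne_iff.1 hx
  have hm : x m ≠ 0 := hm
  set y := (x m)⁻¹ • x with hy
  have hym : y m = 1 := by simp [y, hm]
  have hy0 : y ≠ 0 := fun h => by simp [h] at hym
  have hspan : ∀ z, z ∈ Submodule.span ℂ {y} → z ∈ Submodule.span ℂ {x} := by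
    intro z hz
    refine (Submodule.span_le (p := Submodule.span ℂ {x})).2 ?_ hz
    rintro _ rfl
    exact Submodule.smul_mem _ _ (Submodule.mem_span_singleton_self x)
  have hyJ : ∀ j ∈ J, eval y (F.poly j) = 0 := fun j hj => by
    rw [eval_smul_of_isHomogeneous (F.homogeneous j), h0 j hj, mul_zero]
  -- Modulo `y` the tangent vector may be taken with coordinate `m` zero; after scaling it has n - 2
  -- free coordinates, and `y` has n - 1. The n - 1 forms of `J` impose 2(n - 1) conditions, one too
  -- many.
  set u := v - v m • y with hu
  have hum : u m = 0 := by simp [u, hym]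
  have hu0 : u ∉ Submodule.span ℂ {y} := by
    intro h
    apply hv
    have : v = u + v m • y := by simp [u]
    rw [this]
    exact hspan _ (add_mem h (Submodule.smul_mem _ _ (Submodule.mem_span_singleton_self y)))
  obtain ⟨m', hm'⟩ := Function.ne_iff.1 (ne_zero_of_notMem_span hu0)
  have hm' : u m' ≠ 0 := hm'
  have hmm : m' ≠ m := by rintro rfl; exact hm' hum
  set w := (u m')⁻¹ • u with hw
  have hw0 : w ∉ Submodule.span ℂ {y} := by
    intro h
    apply hu0
    have : u = u m' • w := by simp [w, smul_smul, hm']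
    rw [this]
    exact Submodule.smul_mem _ _ h
  have hwJ : ∀ j ∈ J, dirDeriv y w (F.poly j) = 0 := by
    intro j hj
    have h2 : dirDeriv y v (F.poly j) = 0 := by
      rw [hy, dirDeriv_smul_left (F.homogeneous j), h1 j hj, mul_zero]
    have h3 : dirDeriv y y (F.poly j) = 0 := by
      rw [dirDeriv_self (F.homogeneous j), hyJ j hj, mul_zero]
    rw [hw, dirDeriv_smul_right, hu, sub_eq_add_neg, ← neg_smul, dirDeriv_add_right,
      dirDeriv_smul_right, h2, h3]
    simp
  have h1 := F.rk_union_coeffSet_add_le J (Set.range y ∪ Set.range w) (fun _ => 2) ?_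
  · have h2 := hF.numCoeffs_le J (Set.range y ∪ Set.range w)
    have h3 := rk_le_add_card_of_forall_notMem (S := ∅) y {m}ᶜ ?_
    · have h4 := rk_le_add_card_of_forall_notMem (S := Set.range y) w {m, m'}ᶜ ?_
      · rw [Finset.card_compl, Fintype.card_fin, Finset.card_pair hmm.symm] at h4
        rw [Finset.card_compl, Fintype.card_fin, Finset.card_singleton, Set.empty_union,
          rk_empty] at h3
        rw [Finset.sum_const, smul_eq_mul] at h1
        omega
      · intro i hi
        simp only [Finset.mem_compl, not_not, Finset.mem_insert, Finset.mem_singleton] at hi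
        rcases hi with rfl | rfl
        · simp [w, hum]
        · simp [w, hm']
    · intro i hi
      simp only [Finset.mem_compl, not_not, Finset.mem_singleton] at hi
      subst hi
      simp [hym]
  · intro j hj Y _ hXY
    have hi : JetIndep (d j) (fun _ : Unit => y) (fun _ : Unit => w) Finset.univ :=
      jetIndep_of_card_le (fun _ => hy0) (fun i j h => absurd (Subsingleton.elim i j) h)
        (fun _ _ => hw0) (by have := hd j; simp; omega)
    have := hi.rk_of_vanishing (F.homogeneous j) Y
      (fun _ l => hXY (subset_acl _ (Or.inl ⟨l, rfl⟩)))
      (fun _ _ l => hXY (subset_acl _ (Or.inr ⟨l, rfl⟩))) (fun _ => hyJ j hj)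
      (fun _ _ => hwJ j hj)
    simp only [Fintype.card_unit, Finset.card_univ] at this
    omega

end HomMap

/-! ### Cofactors of the Jacobian matrix and fibres of n - 1 components -/

theorem isHomogeneous_det {n : ℕ} {M : Matrix (Fin n) (Fin n) (MvPolynomial (Fin n) ℂ)}
    {e : Fin n → ℕ} (h : ∀ i j, (M i j).IsHomogeneous (e i)) :
    M.det.IsHomogeneous (∑ i, e i) := by
  rw [← M.det_transpose, Matrix.det_apply]
  refine IsHomogeneous.sum _ _ _ fun σ _ => ?_
  have h1 : (∏ i, M.transpose (σ i) i).IsHomogeneous (∑ i, e i) :=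
    IsHomogeneous.prod _ _ _ fun i _ => h i (σ i)
  rcases Int.units_eq_one_or (Equiv.Perm.sign σ) with h2 | h2 <;> rw [h2]
  · simpa using h1
  · simpa using h1.neg

namespace HomMap

variable {n : ℕ} {d : Fin n → ℕ}

/-- The Jacobian matrix of `F`. -/
noncomputable def jacMatrix (F : HomMap d) : Matrix (Fin n) (Fin n) (MvPolynomial (Fin n) ℂ) :=
  Matrix.of fun i j => pderiv j (F.poly i)

/-- The cofactors of row `l` of the Jacobian matrix of `F`, as polynomials. -/
noncomputable def cofPoly (F : HomMap d) (l : Fin n) (i : Fin n) : MvPolynomial (Fin n) ℂ :=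
  F.jacMatrix.adjugate i l

/-- The cofactors of row `l` of the Jacobian matrix of `F` at `x`. -/
noncomputable def cof (F : HomMap d) (l : Fin n) (x : Fin n → ℂ) : Fin n → ℂ :=
  fun i => eval x (F.cofPoly l i)

/-- This is the product of the Jacobian matrix with its adjugate, read at `x`. It makes criticality
a linear condition on the component `l`. -/
theorem dirDeriv_cof (F : HomMap d) (l i : Fin n) (x : Fin n → ℂ) :
    dirDeriv x (F.cof l x) (F.poly i) = if i = l then eval x F.jacobian else 0 := by
  have h := congrFun (congrFun (Matrix.mul_adjugate F.jacMatrix) i) l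
  have h2 := congrArg (eval x) h
  rw [Matrix.mul_apply, map_sum] at h2
  rw [dirDeriv_apply]
  refine Eq.trans (Finset.sum_congr rfl fun j _ => ?_) (h2.trans ?_)
  · rw [map_mul, mul_comm]
    rfl
  · rw [Matrix.smul_apply, Matrix.one_apply]
    split_ifs
    · simp [jacobian, jacMatrix]
    · simp

theorem dirDeriv_cof_of_mem_critSet {F : HomMap d} {x : Fin n → ℂ} (hx : x ∈ F.critSet)
    (l i : Fin n) : dirDeriv x (F.cof l x) (F.poly i) = 0 := by
  rw [dirDeriv_cof]
  split_ifs
  · exact hx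
  · rfl

theorem cofPoly_eq_det (F : HomMap d) (l i : Fin n) :
    F.cofPoly l i = (F.jacMatrix.updateRow l (Pi.single i 1)).det := by
  rw [cofPoly, Matrix.adjugate_apply]

theorem isHomogeneous_cofPoly (F : HomMap d) (l i : Fin n) :
    (F.cofPoly l i).IsHomogeneous (∑ j, if j = l then 0 else d j - 1) := by
  rw [cofPoly_eq_det]
  refine isHomogeneous_det fun a b => ?_
  split_ifs with h
  · subst h
    rw [Matrix.updateRow_self]
    by_cases hb : b = i
    · subst hb; simpa using isHomogeneous_one _ _
    · simpa [Pi.single_eq_of_ne hb] using isHomogeneous_zero _ _ _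
  · rw [Matrix.updateRow_ne h]
    exact (F.homogeneous a).pderiv

/-- Row `l` does not enter its own cofactors. The direction `cof l x` is therefore known before the
component `l` is chosen. -/
theorem coeff_cofPoly_mem (F : HomMap d) (l i : Fin n) (m : Fin n →₀ ℕ) :
    (F.cofPoly l i).coeff m ∈ acl (F.coeffSet (Finset.univ.erase l)) := by
  set K := acl (F.coeffSet (Finset.univ.erase l))
  have hK : ∀ p : MvPolynomial (Fin n) ℂ, p ∈ (map (algebraMap K ℂ)).range ↔
      ∀ m, p.coeff m ∈ K := by
    intro p
    change p ∈ Set.range (map (algebraMap K ℂ)) ↔ _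
    rw [mem_range_map_iff_coeffs_subset]
    constructor
    · intro h m
      by_cases hm : p.coeff m = 0
      · rw [hm]; exact zero_mem _
      · obtain ⟨c, hc⟩ := h (Finset.mem_coe.2 (mem_coeffs_iff.2 ⟨m, mem_support_iff.2 hm, rfl⟩))
        rw [← hc]
        exact c.2
    · intro h c hc
      rw [Finset.mem_coe, mem_coeffs_iff] at hc
      obtain ⟨m, -, rfl⟩ := hc
      exact ⟨⟨_, h m⟩, rfl⟩
  revert m
  rw [← hK, cofPoly_eq_det, Matrix.det_apply]
  refine sum_mem fun σ _ => ?_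
  have hp : ∏ j, F.jacMatrix.updateRow l (Pi.single i 1) (σ j) j ∈
      (map (algebraMap K ℂ) : MvPolynomial (Fin n) K →+* _).range := by
    refine prod_mem fun j _ => ?_
    by_cases h : σ j = l
    · rw [h, Matrix.updateRow_self]
      by_cases hb : j = i
      · subst hb; rw [Pi.single_eq_same]; exact one_mem _
      · rw [Pi.single_eq_of_ne hb]; exact zero_mem _
    · rw [Matrix.updateRow_ne h, hK]
      intro m
      change (pderiv j (F.poly (σ j))).coeff m ∈ K
      rw [coeff_pderiv]
      have := F.coeff_mem_acl (J := Finset.univ.erase l) (j := σ j) (by simp [h])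
        (m + Finsupp.single j 1)
      exact mul_mem this (add_mem (natCast_mem _ _) (one_mem _))
  rcases Int.units_eq_one_or (Equiv.Perm.sign σ) with h2 | h2 <;> rw [h2]
  · simpa using hp
  · simpa using neg_mem hp

theorem cof_mem_acl (F : HomMap d) {l : Fin n} {S : Set ℂ}
    (hS : F.coeffSet (Finset.univ.erase l) ⊆ acl S) {x : Fin n → ℂ} (hx : ∀ i, x i ∈ acl S)
    (i : Fin n) : F.cof l x i ∈ acl S :=
  eval_mem_acl (fun m => acl_subset_acl_iff.2 hS (F.coeff_cofPoly_mem l i m)) hx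

/-- If the cofactors of row `l` vanish, then the other rows have a kernel of dimension at
least `2`. -/
theorem exists_kernel_of_cof_eq_zero (F : HomMap d) {l : Fin n} {x : Fin n → ℂ}
    (h : F.cof l x = 0) : ∃ (w z : Fin n → ℂ) (a b : Fin n), a ≠ b ∧ w a = 1 ∧ w b = 0 ∧ z a = 0 ∧
      z b = 1 ∧ ∀ j, j ≠ l → dirDeriv x w (F.poly j) = 0 ∧ dirDeriv x z (F.poly j) = 0 := by
  have key : ∀ a : Fin n, ∃ z : Fin n → ℂ, z ≠ 0 ∧ z a = 0 ∧
      ∀ j, j ≠ l → dirDeriv x z (F.poly j) = 0 := by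
    intro a
    have hdet : ((F.jacMatrix.updateRow l (Pi.single a 1)).map (eval x)).det = 0 := by
      have := congrFun h a
      rw [cof, cofPoly_eq_det] at this
      rwa [← RingHom.mapMatrix_apply, ← RingHom.map_det]
    obtain ⟨z, hz, hz0⟩ := Matrix.exists_mulVec_eq_zero_iff.2 hdet
    refine ⟨z, hz, ?_, ?_⟩
    · have := congrFun hz0 l
      simpa [Matrix.mulVec, dotProduct, Matrix.updateRow_self, Pi.single_apply, apply_ite (eval x)]
        using this
    · intro j hj
      have := congrFun hz0 j
      simp only [Matrix.mulVec, dotProduct, Matrix.map_apply, Matrix.updateRow_ne hj,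
        Pi.zero_apply] at this
      rw [dirDeriv_apply, ← this]
      exact Finset.sum_congr rfl fun i _ => mul_comm _ _
  -- Two kernel vectors are brought into echelon form with pivots `a` and `b`, so that each has only
  -- n - 2 free coordinates. The index `l` in this first use of `key` is arbitrary.
  obtain ⟨k, hk, -, hkD⟩ := key l
  obtain ⟨a, ha⟩ := Function.ne_iff.1 hk
  have ha : k a ≠ 0 := ha
  obtain ⟨z', hz', hza, hzD⟩ := key a
  obtain ⟨b, hb⟩ := Function.ne_iff.1 hz'
  have hb : z' b ≠ 0 := hb
  have hab : a ≠ b := by rintro rfl; exact hb hza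
  set z := (z' b)⁻¹ • z' with hz
  set k' := (k a)⁻¹ • k with hk'
  have hDz : ∀ j, j ≠ l → dirDeriv x z (F.poly j) = 0 := fun j hj => by
    rw [hz, dirDeriv_smul_right, hzD j hj, mul_zero]
  have hDk : ∀ j, j ≠ l → dirDeriv x k' (F.poly j) = 0 := fun j hj => by
    rw [hk', dirDeriv_smul_right, hkD j hj, mul_zero]
  refine ⟨k' + (-(k' b)) • z, z, a, b, hab, ?_, ?_, ?_, ?_, fun j hj => ⟨?_, hDz j hj⟩⟩
  · simp [hk', hz, hza, ha]
  · simp [hz, hb]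
  · simp [hz, hza]
  · simp [hz, hb]
  · rw [dirDeriv_add_right, dirDeriv_smul_right _ _ (-(k' b)), hDz j hj, hDk j hj]
    simp

/-- Points of a fibre of the components other than `l` are algebraic over one coordinate. -/
theorem Generic.mem_acl_of_eval_mem {F : HomMap d} (hF : F.Generic) (hn : 2 ≤ n)
    (hd : ∀ i, 2 ≤ d i) {l m : Fin n} {S : Set ℂ}
    (hS : F.coeffSet (Finset.univ.erase l) ⊆ acl S) {x : Fin n → ℂ}
    (hx : ∀ j, j ≠ l → eval x (F.poly j) ∈ acl S) (hm : x m ∈ acl S) (i : Fin n) :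
    x i ∈ acl S := by
  -- With f_l replaced by the coordinate `X m` the system still has only the trivial zero, so this
  -- coordinate is a finite parameter on the fibre.
  refine mem_acl_of_forall_eval_mem S (fun j => if j = l then X m else F.poly j)
    (fun j => if j = l then 1 else d j) ?_ ?_ ?_ ?_ x ?_ i
  · intro j
    have := hd j
    split_ifs <;> omega
  · intro j
    split_ifs
    · exact isHomogeneous_X _ _
    · exact F.homogeneous j
  · intro j k
    split_ifs with h
    · rw [coeff_X]
      split_ifs
      · exact one_mem _
      · exact zero_mem _
    · exact acl_subset_acl_iff.2 hS (F.coeff_mem_acl (by simp [h]) k)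
  · intro y hy
    refine hF.eq_zero_of_eval_eq_zero (J := Finset.univ.erase l) (B := {m}) ?_ ?_ ?_
    · rw [Finset.card_erase_of_mem (Finset.mem_univ l), Finset.card_univ, Fintype.card_fin,
        Finset.card_singleton]
      omega
    · simpa using hy l
    · intro j hj
      simpa [Finset.ne_of_mem_erase hj] using hy j
  · intro j
    split_ifs with h
    · simpa using hm
    · exact hx j h

/-- Singular points of a fibre of the components other than `l` are algebraic. -/
theorem Generic.mem_acl_of_cof_eq_zero {F : HomMap d} (hF : F.Generic) (hn : 2 ≤ n)
    (hd : ∀ i, 2 ≤ d i) {l : Fin n} {S : Set ℂ}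
    (hS : F.coeffSet (Finset.univ.erase l) ⊆ acl S) {x : Fin n → ℂ}
    (hx : ∀ j, j ≠ l → eval x (F.poly j) ∈ acl S) (hm : F.cof l x = 0) (i : Fin n) :
    x i ∈ acl S := by
  have hJ : (Finset.univ.erase l).card + 1 = n := by
    rw [Finset.card_erase_of_mem (Finset.mem_univ l), Finset.card_univ, Fintype.card_fin]
    omega
  -- The other components and the cofactors of row `l` have no common nontrivial zero: there the
  -- kernel would be at least two-dimensional, while generic forms cut out reduced rays.
  refine mem_acl_of_forall_eval_mem S
    (Sum.elim (fun j : {j // j ≠ l} => F.poly j) (F.cofPoly l))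
    (Sum.elim (fun j => d j) (fun _ => ∑ j, if j = l then 0 else d j - 1)) ?_ ?_ ?_ ?_ x ?_ i
  · rintro (j | j)
    · have := hd j
      simp only [Sum.elim_inl]
      omega
    · have : Nontrivial (Fin n) := Fin.nontrivial_iff_two_le.2 hn
      obtain ⟨k, hk⟩ := exists_ne l
      have h1 := Finset.single_le_sum (f := fun j => if j = l then 0 else d j - 1)
        (fun _ _ => Nat.zero_le _) (Finset.mem_univ k)
      have := hd k
      simp only [hk, if_false] at h1
      simp only [Sum.elim_inr]
      omega
  · rintro (j | j)
    · exact F.homogeneous j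
    · exact F.isHomogeneous_cofPoly l j
  · rintro (j | j) k
    · exact acl_subset_acl_iff.2 hS (F.coeff_mem_acl (by simp [j.2]) k)
    · exact acl_subset_acl_iff.2 hS (F.coeff_cofPoly_mem l j k)
  · intro y hy
    by_contra hy0
    have hcof : F.cof l y = 0 := by
      ext i
      have := hy (Sum.inr i)
      rwa [Sum.elim_inr] at this
    obtain ⟨w, z, a, b, hab, hwa, hwb, hza, hzb, hD⟩ := F.exists_kernel_of_cof_eq_zero hcof
    have h0 : ∀ j ∈ Finset.univ.erase l, eval y (F.poly j) = 0 := by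
      intro j hj
      have := hy (Sum.inl ⟨j, Finset.ne_of_mem_erase hj⟩)
      rwa [Sum.elim_inl] at this
    have hw := hF.mem_span_of_dirDeriv_eq_zero hn hd hJ hy0 h0
      fun j hj => (hD j (Finset.ne_of_mem_erase hj)).1
    have hz := hF.mem_span_of_dirDeriv_eq_zero hn hd hJ hy0 h0
      fun j hj => (hD j (Finset.ne_of_mem_erase hj)).2
    obtain ⟨s, rfl⟩ := Submodule.mem_span_singleton.1 hw
    obtain ⟨t, rfl⟩ := Submodule.mem_span_singleton.1 hz
    simp only [Pi.smul_apply, smul_eq_mul] at hwa hwb hza hzb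
    have : (1 : ℂ) = 0 := by
      calc (1 : ℂ) = (s * y a) * (t * y b) := by rw [hwa, hzb, mul_one]
        _ = (s * y b) * (t * y a) := by ring
        _ = 0 := by rw [hwb, zero_mul]
    exact one_ne_zero this
  · rintro (j | j)
    · rw [Sum.elim_inl]
      exact hx j j.2
    · have : eval x (F.cofPoly l j) = 0 := congrFun hm j
      rw [Sum.elim_inr, this]
      exact zero_mem _

end HomMap

/-! ### Dimension counts for critical points in one fibre -/

/-- The coordinates of a family of points. -/
def pts {n : ℕ} {ι : Type*} (x : ι → Fin n → ℂ) : Set ℂ := Set.range fun p : ι × Fin n => x p.1 p.2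

instance {n : ℕ} {ι : Type*} [Finite ι] (x : ι → Fin n → ℂ) : Finite (pts x) := by
  unfold pts; infer_instance

theorem mem_pts {n : ℕ} {ι : Type*} (x : ι → Fin n → ℂ) (i : ι) (l : Fin n) : x i l ∈ pts x :=
  ⟨(i, l), rfl⟩

namespace HomMap

variable {n : ℕ} {d : Fin n → ℕ}

theorem exists_kernel_of_mem_critSet {F : HomMap d} {x : Fin n → ℂ} (hx : x ∈ F.critSet) :
    ∃ v : Fin n → ℂ, v ≠ 0 ∧ ∀ j, dirDeriv x v (F.poly j) = 0 := by
  have hdet : (F.jacMatrix.map (eval x)).det = 0 := by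
    have h : eval x F.jacobian = 0 := hx
    rwa [← RingHom.mapMatrix_apply, ← RingHom.map_det]
  obtain ⟨v, hv, hv0⟩ := Matrix.exists_mulVec_eq_zero_iff.2 hdet
  refine ⟨v, hv, fun j => ?_⟩
  have := congrFun hv0 j
  simp only [Matrix.mulVec, dotProduct, Matrix.map_apply, Pi.zero_apply] at this
  rw [dirDeriv_apply, ← this]
  exact Finset.sum_congr rfl fun i _ => mul_comm _ _

theorem card_univ_erase_add_one (l : Fin n) : (Finset.univ.erase l).card + 1 = n := by
  rw [Finset.card_erase_add_one (Finset.mem_univ l), Finset.card_univ, Fintype.card_fin]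

/-- At a critical point at least two components do not vanish. -/
theorem Generic.exists_eval_ne_zero {F : HomMap d} (hF : F.Generic) (hn : 2 ≤ n)
    (hd : ∀ i, 2 ≤ d i) {x : Fin n → ℂ} (hx : x ≠ 0) (hc : x ∈ F.critSet) (l : Fin n) :
    ∃ j, j ≠ l ∧ eval x (F.poly j) ≠ 0 := by
  by_contra! h
  obtain ⟨v, hv, hvD⟩ := exists_kernel_of_mem_critSet hc
  -- If all components except f_l vanish, the kernel vector is tangent to a reduced ray, hence
  -- proportional to `x`. Euler's relation then makes f_l vanish at `x` too.
  have hs := hF.mem_span_of_dirDeriv_eq_zero hn hd (card_univ_erase_add_one l) hx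
    (fun j hj => h j (Finset.ne_of_mem_erase hj)) (fun j _ => hvD j)
  obtain ⟨c, rfl⟩ := Submodule.mem_span_singleton.1 hs
  have hc0 : c ≠ 0 := by rintro rfl; simp at hv
  have hl : eval x (F.poly l) = 0 := by
    have := hvD l
    rw [dirDeriv_smul_right, dirDeriv_self (F.homogeneous l)] at this
    have hdl : (d l : ℂ) ≠ 0 := by have := hd l; exact_mod_cast (by omega)
    simpa [hc0, hdl] using this
  refine hx (hF.eq_zero_of_eval_eq_zero (J := Finset.univ) (B := ∅) (by simp) (by simp) ?_)
  intro j _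
  by_cases hj : j = l
  · rw [hj, hl]
  · exact h j hj

/-- By Euler's relation the derivative along `x` of a component not vanishing at `x` is nonzero.
Transversality to the ray is what independence of jets requires. -/
theorem Generic.cof_notMem_span {F : HomMap d} (hF : F.Generic) (hn : 2 ≤ n)
    (hd : ∀ i, 2 ≤ d i) {x : Fin n → ℂ} (hx : x ≠ 0) (hc : x ∈ F.critSet) {l : Fin n}
    (hl : F.cof l x ≠ 0) : F.cof l x ∉ Submodule.span ℂ {x} := by
  intro h
  obtain ⟨c, hcx⟩ := Submodule.mem_span_singleton.1 h
  obtain ⟨j, -, hj⟩ := hF.exists_eval_ne_zero hn hd hx hc l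
  have := dirDeriv_cof_of_mem_critSet hc l j
  have hdl : (d j : ℂ) ≠ 0 := by have := hd j; exact_mod_cast (by omega)
  rw [← hcx, dirDeriv_smul_right, dirDeriv_self (F.homogeneous j)] at this
  have hc0 : c = 0 := by simpa [hj, hdl] using this
  rw [hc0, zero_smul] at hcx
  exact hl hcx.symm

/-- The points where the fibres of the components other than `l` are singular form a set of
codimension two, which meets the zero sets of these components properly. -/
theorem Generic.rk_of_cof_eq_zero {F : HomMap d} (hF : F.Generic) (hn : 2 ≤ n)
    (hd : ∀ i, 2 ≤ d i) {x : Fin n → ℂ} {l m : Fin n} (hm : x m = 1) (hl : F.cof l x = 0)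
    {Z : Finset (Fin n)} (hZl : l ∉ Z) (hZ : ∀ j ∈ Z, eval x (F.poly j) = 0) :
    rk (F.coeffSet (Finset.univ.erase l) ∪ Set.range x) + Z.card + 2 ≤
      numCoeffs d (Finset.univ.erase l) + (n - 1) := by
  classical
  have hx : x ≠ 0 := fun h => by simp [h] at hm
  obtain ⟨w, z, a, b, hab, hwa, hwb, hza, hzb, hD⟩ := F.exists_kernel_of_cof_eq_zero hl
  have hdep : ∀ s t : ℂ, s • w + t • z = 0 → s = 0 ∧ t = 0 := by
    intro s t h
    have h1 := congrFun h a
    have h2 := congrFun h b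
    simp only [Pi.add_apply, Pi.smul_apply, smul_eq_mul, hwa, hza, hwb, hzb, Pi.zero_apply] at h1 h2
    exact ⟨by simpa using h1, by simpa using h2⟩
  have hG : ∃ j, j ≠ l ∧ eval x (F.poly j) ≠ 0 := by
    by_contra! h
    have hw := hF.mem_span_of_dirDeriv_eq_zero hn hd (card_univ_erase_add_one l) hx
      (fun j hj => h j (Finset.ne_of_mem_erase hj))
      (fun j hj => (hD j (Finset.ne_of_mem_erase hj)).1)
    have hz := hF.mem_span_of_dirDeriv_eq_zero hn hd (card_univ_erase_add_one l) hx
      (fun j hj => h j (Finset.ne_of_mem_erase hj))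
      (fun j hj => (hD j (Finset.ne_of_mem_erase hj)).2)
    obtain ⟨s, rfl⟩ := Submodule.mem_span_singleton.1 hw
    obtain ⟨t, rfl⟩ := Submodule.mem_span_singleton.1 hz
    have := (hdep t (-s) (by module)).1
    subst this
    simp at hzb
  have hlin : LinearIndependent ℂ (fun o : Option (Fin 2) => o.elim x ![w, z]) := by
    rw [Fintype.linearIndependent_iff]
    intro g hg
    rw [Fintype.sum_option, Fin.sum_univ_two] at hg
    simp only [Option.elim, Matrix.cons_val_zero, Matrix.cons_val_one] at hg
    obtain ⟨j, hj, hjx⟩ := hG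
    have h1 : dirDeriv x (g none • x + (g (some 0) • w + g (some 1) • z)) (F.poly j) = 0 := by
      rw [hg]; simp [dirDeriv_apply]
    rw [dirDeriv_add_right, dirDeriv_add_right, dirDeriv_smul_right, dirDeriv_smul_right,
      dirDeriv_smul_right, (hD j hj).1, (hD j hj).2, dirDeriv_self (F.homogeneous j)] at h1
    have hdl : (d j : ℂ) ≠ 0 := by have := hd j; exact_mod_cast (by omega)
    have h2 : g none = 0 := by simpa [hjx, hdl] using h1
    rw [h2, zero_smul, zero_add] at hg
    have h3 := hdep _ _ hg
    rintro (_ | i)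
    · exact h2
    · fin_cases i
      · exact h3.1
      · exact h3.2
  -- The vectors `x`, `w`, `z` have n - 1, n - 2 and n - 2 free coordinates. Each component other
  -- than `l` has zero derivative along `w` and `z`, and those in `Z` also vanish at `x`: 2(n - 1) +
  -- |Z| conditions.
  have h1 := F.rk_union_coeffSet_add_le (Finset.univ.erase l)
    (Set.range x ∪ (Set.range w ∪ Set.range z)) (fun j => 2 + if j ∈ Z then 1 else 0) ?_
  · have h3 := rk_le_add_card_of_forall_notMem (S := ∅) x {m}ᶜ ?_
    · have h4 := rk_le_add_card_of_forall_notMem (S := Set.range x) w {a, b}ᶜ ?_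
      · have h5 := rk_le_add_card_of_forall_notMem (S := Set.range x ∪ Set.range w) z {a, b}ᶜ ?_
        · rw [Finset.card_compl, Fintype.card_fin, Finset.card_pair hab] at h4 h5
          rw [Finset.card_compl, Fintype.card_fin, Finset.card_singleton, Set.empty_union,
            rk_empty] at h3
          have h6 : ∑ j ∈ Finset.univ.erase l, (2 + if j ∈ Z then 1 else 0) =
              2 * (n - 1) + Z.card := by
            rw [Finset.sum_add_distrib, Finset.sum_const, smul_eq_mul, ← Finset.sum_filter,
              Finset.sum_const, smul_eq_mul, mul_one]
            have h7 : (Finset.univ.erase l).filter (· ∈ Z) = Z := by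
              ext j
              simp only [Finset.mem_filter, Finset.mem_erase, Finset.mem_univ, and_true]
              exact ⟨fun h => h.2, fun h => ⟨fun h' => hZl (h' ▸ h), h⟩⟩
            have h8 := card_univ_erase_add_one l
            rw [h7]
            omega
          have h9 : rk (F.coeffSet (Finset.univ.erase l) ∪ Set.range x) ≤
              rk (Set.range x ∪ (Set.range w ∪ Set.range z) ∪ F.coeffSet (Finset.univ.erase l)) := by
            refine rk_mono (Set.Subset.trans ?_ (subset_acl _))
            intro t ht
            rcases ht with ht | ht
            · exact Or.inr ht
            · exact Or.inl (Or.inl ht)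
          rw [← Set.union_assoc] at h1
          rw [← Set.union_assoc] at h9
          omega
        · intro i hi
          simp only [Finset.mem_compl, not_not, Finset.mem_insert, Finset.mem_singleton] at hi
          rcases hi with rfl | rfl
          · rw [hza]; exact zero_mem _
          · rw [hzb]; exact one_mem _
      · intro i hi
        simp only [Finset.mem_compl, not_not, Finset.mem_insert, Finset.mem_singleton] at hi
        rcases hi with rfl | rfl
        · rw [hwa]; exact one_mem _
        · rw [hwb]; exact zero_mem _
    · intro i hi
      simp only [Finset.mem_compl, not_not, Finset.mem_singleton] at hi
      subst hi
      simp [hm]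
  · intro j hj Y _ hXY
    have hj := Finset.ne_of_mem_erase hj
    have hind := indepOnForms_evalAt_dirDeriv (e := d j) (by have := hd j; omega) hlin
    have hxY : ∀ i, x i ∈ acl Y := fun i => hXY (subset_acl _ (Or.inl ⟨i, rfl⟩))
    have hvY : ∀ (k : Fin 2) i, (![w, z] : Fin 2 → Fin n → ℂ) k i ∈ acl Y := by
      intro k i
      fin_cases k
      · exact hXY (subset_acl _ (Or.inr (Or.inl ⟨i, rfl⟩)))
      · exact hXY (subset_acl _ (Or.inr (Or.inr ⟨i, rfl⟩)))
    have hvD : ∀ k : Fin 2, dirDeriv x ((![w, z] : Fin 2 → Fin n → ℂ) k) (F.poly j) = 0 := by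
      intro k
      fin_cases k
      · exact (hD j hj).1
      · exact (hD j hj).2
    by_cases hjZ : j ∈ Z
    · have := rk_union_formCoeffs_add_card_le (F.homogeneous j) Y (φ := fun o : Option (Fin 2) =>
        o.elim (evalAt x) (fun i => dirDeriv x ((![w, z] : Fin 2 → Fin n → ℂ) i))) ?_ hind ?_
      · simpa [hjZ] using this
      · rintro (_ | i)
        · exact definedOver_evalAt hxY
        · exact definedOver_dirDeriv hxY (hvY i)
      · rintro (_ | i)
        · simpa using hZ j hjZ
        · exact hvD i
    · have := rk_union_formCoeffs_add_card_le (F.homogeneous j) Y (φ := fun i : Fin 2 =>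
        dirDeriv x ((![w, z] : Fin 2 → Fin n → ℂ) i)) ?_ ?_ hvD
      · simpa [hjZ] using this
      · exact fun i => definedOver_dirDeriv hxY (hvY i)
      · intro b hb i
        refine hind (fun o => o.elim 0 b) (fun g hg => ?_) (some i)
        rw [Fintype.sum_option]
        simpa using hb g hg

/-- In a fibre of the components other than `l`, each nonsingular point that is not normalised
contributes at most one to the transcendence degree, the other points contribute nothing. -/
theorem Generic.rk_union_pts_le {F : HomMap d} (hF : F.Generic) (hn : 2 ≤ n)
    (hd : ∀ i, 2 ≤ d i) {l m : Fin n} {S : Set ℂ} [Finite S]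
    (hS : F.coeffSet (Finset.univ.erase l) ⊆ acl S) {ι : Type*} [Fintype ι] {x : ι → Fin n → ℂ}
    (hx : ∀ i j, j ≠ l → eval (x i) (F.poly j) ∈ acl S) (s : Finset ι)
    (hs : ∀ i, i ∉ s → x i m ∈ acl S ∨ F.cof l (x i) = 0) :
    rk (S ∪ pts x) ≤ rk S + s.card := by
  have := rk_le_add_card (S := S) (T := S ∪ pts x) (fun i : s => x i m) ?_
  · rwa [Fintype.card_coe] at this
  · rintro t (ht | ⟨⟨i, k⟩, rfl⟩)
    · exact subset_acl _ (Or.inl ht)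
    · have hmono := acl_mono (Set.subset_union_left (s := S) (t := Set.range fun i : s => x i m))
      have hC := hS.trans hmono
      have hv : ∀ j, j ≠ l → eval (x i) (F.poly j) ∈ acl (S ∪ Set.range fun i : s => x i m) :=
        fun j hj => hmono (hx i j hj)
      by_cases hi : i ∈ s
      · exact hF.mem_acl_of_eval_mem hn hd hC hv (subset_acl _ (Or.inr ⟨⟨i, hi⟩, rfl⟩)) k
      · rcases hs i hi with h | h
        · exact hF.mem_acl_of_eval_mem hn hd hC hv (hmono h) k
        · exact hF.mem_acl_of_cof_eq_zero hn hd hC hv h k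

/-- The n - 1 common values determine a curve, on which every point except the normalised one brings
one parameter. -/
theorem Generic.rk_pts_le {F : HomMap d} (hF : F.Generic) (hn : 2 ≤ n)
    (hd : ∀ i, 2 ≤ d i) {l m : Fin n} {ι : Type*} [Fintype ι] {x : ι → Fin n → ℂ} {i₀ : ι}
    (hm : x i₀ m = 1) (heq : ∀ i j, eval (x i) (F.poly j) = eval (x i₀) (F.poly j)) :
    rk (F.coeffSet (Finset.univ.erase l) ∪ pts x) + 1 ≤
      numCoeffs d (Finset.univ.erase l) + (n - 1) + Fintype.card ι := by
  classical
  set S := F.coeffSet (Finset.univ.erase l) ∪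
    Set.range (fun j : {j // j ≠ l} => eval (x i₀) (F.poly j))
  have h1 := hF.rk_union_pts_le (S := S) (m := m) (l := l) hn hd (x := x)
    (Set.subset_union_left.trans (subset_acl _))
    (fun i j hj => subset_acl _ (Or.inr ⟨⟨j, hj⟩, (heq i j).symm⟩)) (Finset.univ.erase i₀) ?_
  · have h2 : rk S ≤ numCoeffs d (Finset.univ.erase l) + (n - 1) := by
      rw [← hF.rk_coeffSet]
      have := rk_le_add_card (S := F.coeffSet (Finset.univ.erase l)) _ (subset_acl S)
      refine this.trans (le_of_eq ?_)
      rw [Fintype.card_subtype_compl, Fintype.card_subtype_eq, Fintype.card_fin]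
    have h3 := Finset.card_erase_add_one (Finset.mem_univ i₀)
    rw [Finset.card_univ] at h3
    have h4 : rk (F.coeffSet (Finset.univ.erase l) ∪ pts x) ≤ rk (S ∪ pts x) :=
      rk_mono ((Set.union_subset_union_left _ Set.subset_union_left).trans (subset_acl _))
    omega
  · intro i hi
    have : i = i₀ := by simpa using hi
    subst this
    rw [hm]
    exact Or.inl (one_mem _)

/-- Once the points and the other components are known, the conditions on f_l are linear: card ι - 1
equalities of values and |T| vanishing derivatives along cofactors. -/
theorem rk_add_of_jetIndep {F : HomMap d} {l : Fin n} {ι : Type*} [Fintype ι]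
    {x : ι → Fin n → ℂ} (i₀ : ι) (hc : ∀ i, x i ∈ F.critSet)
    (heq : ∀ i j, eval (x i) (F.poly j) = eval (x i₀) (F.poly j)) {T : Finset ι}
    (hi : JetIndep (d l) x (fun i => F.cof l (x i)) T) :
    rk (F.coeffSet Finset.univ ∪ pts x) + Fintype.card ι + T.card ≤
      rk (F.coeffSet (Finset.univ.erase l) ∪ pts x) + (monos n (d l)).card + 1 := by
  have hx : ∀ i k, x i k ∈ acl (F.coeffSet (Finset.univ.erase l) ∪ pts x) :=
    fun i k => subset_acl _ (Or.inr (mem_pts x i k))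
  have h := hi.rk_of_eq (F.homogeneous l) (F.coeffSet (Finset.univ.erase l) ∪ pts x) hx
    (fun i _ k => F.cof_mem_acl (Set.subset_union_left.trans (subset_acl _)) (hx i) k) i₀
    (fun i => heq i l) (fun i _ => dirDeriv_cof_of_mem_critSet (hc i) l l)
  rwa [Set.union_right_comm, ← coeffSet_univ] at h

/-- The parameter of each further point cancels against its equality of values, so only the
derivative conditions are left. -/
theorem Generic.rk_add_card_le {F : HomMap d} (hF : F.Generic) (hn : 2 ≤ n)
    (hd : ∀ i, 2 ≤ d i) {l m : Fin n} {ι : Type*} [Fintype ι] {x : ι → Fin n → ℂ} {i₀ : ι}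
    (hm : x i₀ m = 1) (hc : ∀ i, x i ∈ F.critSet)
    (heq : ∀ i j, eval (x i) (F.poly j) = eval (x i₀) (F.poly j)) {T : Finset ι}
    (hi : JetIndep (d l) x (fun i => F.cof l (x i)) T) :
    rk (F.coeffSet Finset.univ ∪ pts x) + T.card ≤ numCoeffs d Finset.univ + (n - 1) := by
  have h1 := hF.rk_pts_le hn hd (l := l) hm heq
  have h2 := rk_add_of_jetIndep i₀ hc heq hi
  have h3 := numCoeffs_univ d l
  omega

/-- The singular point `x i₀` moves in codimension two and determines the fibre; only points in `s`
then bring a parameter, while every point but one still costs an equality of values. -/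
theorem Generic.rk_add_card_le_of_cof_eq_zero {F : HomMap d} (hF : F.Generic) (hn : 2 ≤ n)
    (hd : ∀ i, 2 ≤ d i) {l m : Fin n} {ι : Type*} [Fintype ι] {x : ι → Fin n → ℂ} {i₀ : ι}
    (hm : x i₀ m = 1) (hc : ∀ i, x i ∈ F.critSet) (hl : F.cof l (x i₀) = 0)
    (heq : ∀ i j, eval (x i) (F.poly j) = eval (x i₀) (F.poly j)) {T s : Finset ι}
    (hs : ∀ i, i ∉ s → F.cof l (x i) = 0)
    (hi : JetIndep (d l) x (fun i => F.cof l (x i)) T) :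
    rk (F.coeffSet Finset.univ ∪ pts x) + Fintype.card ι + T.card + 1 ≤
      numCoeffs d Finset.univ + (n - 1) + s.card := by
  have h1 := hF.rk_of_cof_eq_zero hn hd hm hl (Z := ∅) (by simp) (by simp)
  have h2 := rk_add_of_jetIndep i₀ hc heq hi
  have h3 := numCoeffs_univ d l
  have hS : F.coeffSet (Finset.univ.erase l) ⊆
      acl (F.coeffSet (Finset.univ.erase l) ∪ Set.range (x i₀)) :=
    Set.subset_union_left.trans (subset_acl _)
  have h4 := hF.rk_union_pts_le (m := m) (l := l) hn hd hS (x := x) (fun i j hj => by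
    rw [heq]
    exact eval_mem_acl (fun k => acl_subset_acl_iff.2 hS (F.coeff_mem_acl (by simp [hj]) k))
      fun k => subset_acl _ (Or.inr ⟨k, rfl⟩)) s (fun i hi => Or.inr (hs i hi))
  have h5 : rk (F.coeffSet (Finset.univ.erase l) ∪ pts x) ≤
      rk (F.coeffSet (Finset.univ.erase l) ∪ Set.range (x i₀) ∪ pts x) :=
    rk_mono ((Set.union_subset_union_left _ Set.subset_union_left).trans (subset_acl _))
  simp only [Finset.card_empty] at h1
  omega

end HomMap

theorem notMem_span_singleton_smul {n : ℕ} {x y : Fin n → ℂ} {c : ℂ} (hc : c ≠ 0)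
    (h : x ∉ Submodule.span ℂ {y}) : c • x ∉ Submodule.span ℂ {c • y} := by
  intro h'
  obtain ⟨a, ha⟩ := Submodule.mem_span_singleton.1 h'
  apply h
  refine Submodule.mem_span_singleton.2 ⟨a, smul_right_injective _ hc ?_⟩
  exact (smul_comm c a y).trans ha

namespace HomMap

variable {n : ℕ} {d : Fin n → ℕ}

theorem isHomogeneous_jacobian (F : HomMap d) : F.jacobian.IsHomogeneous (∑ i, (d i - 1)) :=
  isHomogeneous_det fun i _ => (F.homogeneous i).pderiv

theorem smul_mem_critSet {F : HomMap d} {x : Fin n → ℂ} (hx : x ∈ F.critSet) (c : ℂ) :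
    c • x ∈ F.critSet := by
  have h : eval x F.jacobian = 0 := hx
  change eval (c • x) F.jacobian = 0
  rw [eval_smul_of_isHomogeneous F.isHomogeneous_jacobian, h, mul_zero]

theorem cof_smul_eq_zero_iff (F : HomMap d) (l : Fin n) {c : ℂ} (hc : c ≠ 0) (x : Fin n → ℂ) :
    F.cof l (c • x) = 0 ↔ F.cof l x = 0 := by
  simp only [funext_iff, cof, Pi.zero_apply,
    eval_smul_of_isHomogeneous (F.isHomogeneous_cofPoly l _), mul_eq_zero]
  exact forall_congr' fun k => or_iff_right (pow_ne_zero _ hc)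

/-- A family of critical points on distinct rays in one fibre of `F`. -/
structure IsCritFamily (F : HomMap d) {ι : Type*} (x : ι → Fin n → ℂ) : Prop where
  ne_zero : ∀ i, x i ≠ 0
  notMem_span : ∀ i j, i ≠ j → x i ∉ Submodule.span ℂ {x j}
  mem_critSet : ∀ i, x i ∈ F.critSet
  eval_eq : ∀ i i' j, eval (x i) (F.poly j) = eval (x i') (F.poly j)

theorem IsCritFamily.smul {F : HomMap d} {ι : Type*} {x : ι → Fin n → ℂ} (h : F.IsCritFamily x)
    {c : ℂ} (hc : c ≠ 0) : F.IsCritFamily (fun i => c • x i) where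
  ne_zero i := smul_ne_zero hc (h.ne_zero i)
  notMem_span i j hij := notMem_span_singleton_smul hc (h.notMem_span i j hij)
  mem_critSet i := smul_mem_critSet (h.mem_critSet i) c
  eval_eq i i' j := by
    rw [eval_smul_of_isHomogeneous (F.homogeneous j), eval_smul_of_isHomogeneous (F.homogeneous j),
      h.eval_eq i i' j]

/-- A member of the family can be normalised. -/
theorem IsCritFamily.exists_normalized {F : HomMap d} {ι : Type*} {x : ι → Fin n → ℂ}
    (h : F.IsCritFamily x) (i : ι) :
    ∃ (m : Fin n) (c : ℂ), c ≠ 0 ∧ F.IsCritFamily (fun i => c • x i) ∧ (c • x i) m = 1 := by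
  obtain ⟨m, hm⟩ := Function.ne_iff.1 (h.ne_zero i)
  have hm : x i m ≠ 0 := hm
  exact ⟨m, (x i m)⁻¹, inv_ne_zero hm, h.smul (inv_ne_zero hm), by simp [hm]⟩

theorem IsCritFamily.jetIndep {F : HomMap d} (hF : F.Generic) (hn : 2 ≤ n)
    (hd : ∀ i, 2 ≤ d i) {ι : Type*} [Fintype ι] {x : ι → Fin n → ℂ} (h : F.IsCritFamily x)
    {l : Fin n} {T : Finset ι} (hT : ∀ i ∈ T, F.cof l (x i) ≠ 0)
    (hcard : Fintype.card ι + T.card ≤ d l + 1) :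
    JetIndep (d l) x (fun i => F.cof l (x i)) T :=
  jetIndep_of_card_le h.ne_zero h.notMem_span (fun i hi =>
    hF.cof_notMem_span hn hd (h.ne_zero i) (h.mem_critSet i) (hT i hi)) hcard

/-- Degree 3 is what interpolating two values and two derivatives takes. The scalar normalises a
point with vanishing cofactors if there is one, as the count for that case requires. -/
theorem Generic.rk_normalized_pair {F : HomMap d} (hF : F.Generic) (hn : 2 ≤ n)
    (hd : ∀ i, 2 ≤ d i) {l : Fin n} (hl : 3 ≤ d l) {x : Fin 2 → Fin n → ℂ}
    (h : F.IsCritFamily x) :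
    ∃ c : ℂ, c ≠ 0 ∧ rk (F.coeffSet Finset.univ ∪ pts (fun i => c • x i)) + 2 ≤
      numCoeffs d Finset.univ + (n - 1) := by
  classical
  by_cases hs : ∃ i, F.cof l (x i) = 0
  · obtain ⟨i, hi⟩ := hs
    obtain ⟨m, c, hc, hcx, hm⟩ := h.exists_normalized i
    refine ⟨c, hc, ?_⟩
    have hi' := (F.cof_smul_eq_zero_iff l hc (x i)).2 hi
    have h1 := hF.rk_add_card_le_of_cof_eq_zero (x := fun i => c • x i) (i₀ := i) hn hd hm
      hcx.mem_critSet hi'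
      (fun j k => hcx.eval_eq j i k) (s := Finset.univ.filter fun j => F.cof l (c • x j) ≠ 0)
      (T := Finset.univ.filter fun j => F.cof l (c • x j) ≠ 0) (by simp)
      (hcx.jetIndep hF hn hd (by simp) (by
        have := Finset.card_filter_le (Finset.univ : Finset (Fin 2))
          (fun j => F.cof l (c • x j) ≠ 0)
        simp only [Finset.card_univ, Fintype.card_fin] at this ⊢
        omega))
    rw [Fintype.card_fin] at h1
    omega
  · push Not at hs
    obtain ⟨m, c, hc, hcx, hm⟩ := h.exists_normalized 0
    refine ⟨c, hc, ?_⟩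
    have h1 := hF.rk_add_card_le (x := fun i => c • x i) (i₀ := 0) hn hd hm hcx.mem_critSet
      (fun j k => hcx.eval_eq j 0 k) (T := Finset.univ) (hcx.jetIndep hF hn hd (l := l)
        (fun i _ hi => hs i ((F.cof_smul_eq_zero_iff l hc (x i)).1 hi)) (by simp; omega))
    simpa using h1

/-- Undoing a normalisation costs one parameter, the scalar. -/
theorem range_subset_acl_of_smul {S : Set ℂ} {x : Fin n → ℂ} {c : ℂ} (hc : c ≠ 0)
    (h : ∀ i, (c • x) i ∈ acl S) : Set.range x ⊆ acl (S ∪ Set.range fun _ : Unit => c) := by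
  rintro _ ⟨k, rfl⟩
  have h1 : x k = c⁻¹ * (c • x) k := by simp [hc]
  rw [h1]
  exact mul_mem (inv_mem (subset_acl _ (Or.inr ⟨(), rfl⟩)))
    (acl_mono Set.subset_union_left (h k))

/-- The double points on distinct rays have codimension two. -/
theorem Generic.rk_pair {F : HomMap d} (hF : F.Generic) (hn : 2 ≤ n)
    (hd : ∀ i, 2 ≤ d i) {l : Fin n} (hl : 3 ≤ d l) {x : Fin 2 → Fin n → ℂ}
    (h : F.IsCritFamily x) (i : Fin 2) :
    rk (F.coeffSet Finset.univ ∪ Set.range (x i)) + 1 ≤ numCoeffs d Finset.univ + (n - 1) := by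
  obtain ⟨c, hc, hrk⟩ := hF.rk_normalized_pair hn hd hl h
  have := rk_le_add_card (S := F.coeffSet Finset.univ ∪ pts (fun i => c • x i))
    (T := F.coeffSet Finset.univ ∪ Set.range (x i)) (fun _ : Unit => c) ?_
  · rw [Fintype.card_unit] at this
    omega
  · refine Set.union_subset ((Set.subset_union_left.trans Set.subset_union_left).trans
      (subset_acl _)) (range_subset_acl_of_smul hc fun k => ?_)
    exact subset_acl _ (Or.inr (mem_pts (fun i => c • x i) i k))

/-- The critical rays on which all but two components vanish are isolated. -/
theorem Generic.rk_isolated {F : HomMap d} (hF : F.Generic) (hn : 2 ≤ n)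
    (hd : ∀ i, 2 ≤ d i) {x : Fin n → ℂ} {m : Fin n} (hm : x m = 1) (hc : x ∈ F.critSet)
    {Z : Finset (Fin n)} (hZ : Z.card + 2 = n) (h0 : ∀ j ∈ Z, eval x (F.poly j) = 0) :
    rk (F.coeffSet Finset.univ ∪ Set.range x) ≤ numCoeffs d Finset.univ := by
  classical
  have hx : x ≠ 0 := fun h => by simp [h] at hm
  obtain ⟨v', hv', hvD'⟩ := exists_kernel_of_mem_critSet hc
  obtain ⟨m', hm'⟩ := Function.ne_iff.1 hv'
  have hm' : v' m' ≠ 0 := hm'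
  set v := (v' m')⁻¹ • v' with hv
  have hvD : ∀ j, dirDeriv x v (F.poly j) = 0 := fun j => by
    rw [hv, dirDeriv_smul_right, hvD', mul_zero]
  have hvm : v m' = 1 := by simp [v, hm']
  have hvx : v ∉ Submodule.span ℂ {x} := by
    intro h
    obtain ⟨c, hcv⟩ := Submodule.mem_span_singleton.1 h
    obtain ⟨j, -, hj⟩ := hF.exists_eval_ne_zero hn hd hx hc m
    have := hvD j
    have hdl : (d j : ℂ) ≠ 0 := by have := hd j; exact_mod_cast (by omega)
    rw [← hcv, dirDeriv_smul_right, dirDeriv_self (F.homogeneous j)] at this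
    have hc0 : c = 0 := by simpa [hj, hdl] using this
    rw [← hcv, hc0] at hvm
    simp at hvm
  -- The point and its kernel vector have n - 1 free coordinates each, and this is exactly consumed
  -- by n derivative conditions and n - 2 vanishing values.
  have h1 := F.rk_union_coeffSet_add_le Finset.univ (Set.range x ∪ Set.range v)
    (fun j => 1 + if j ∈ Z then 1 else 0) ?_
  · have h3 := rk_le_add_card_of_forall_notMem (S := ∅) x {m}ᶜ ?_
    · have h4 := rk_le_add_card_of_forall_notMem (S := Set.range x) v {m'}ᶜ ?_
      · rw [Finset.card_compl, Fintype.card_fin, Finset.card_singleton] at h4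
        rw [Finset.card_compl, Fintype.card_fin, Finset.card_singleton, Set.empty_union,
          rk_empty] at h3
        have h6 : ∑ j, (1 + if j ∈ Z then 1 else 0) = n + Z.card := by
          rw [Finset.sum_add_distrib]
          simp
        have h9 : rk (F.coeffSet Finset.univ ∪ Set.range x) ≤
            rk (Set.range x ∪ Set.range v ∪ F.coeffSet Finset.univ) := by
          refine rk_mono (Set.Subset.trans ?_ (subset_acl _))
          intro t ht
          rcases ht with ht | ht
          · exact Or.inr ht
          · exact Or.inl (Or.inl ht)
        omega
      · intro i hi
        have : i = m' := by simpa using hi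
        rw [this, hvm]
        exact one_mem _
    · intro i hi
      have : i = m := by simpa using hi
      rw [this, hm]
      exact one_mem _
  · intro j _ Y _ hXY
    have hxY : ∀ (_ : Unit) i, x i ∈ acl Y := fun _ i => hXY (subset_acl _ (Or.inl ⟨i, rfl⟩))
    have hvY : ∀ _ ∈ (Finset.univ : Finset Unit), ∀ i, v i ∈ acl Y :=
      fun _ _ i => hXY (subset_acl _ (Or.inr ⟨i, rfl⟩))
    have hi : JetIndep (d j) (fun _ : Unit => x) (fun _ : Unit => v) Finset.univ :=
      jetIndep_of_card_le (fun _ => hx) (fun i j h => absurd (Subsingleton.elim i j) h)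
        (fun _ _ => hvx) (by have := hd j; simp; omega)
    by_cases hjZ : j ∈ Z
    · have := hi.rk_of_vanishing (F.homogeneous j) Y hxY hvY (fun _ => h0 j hjZ)
        (fun _ _ => hvD j)
      simp only [Fintype.card_unit, Finset.card_univ] at this
      simp only [hjZ, if_true]
      omega
    · have := hi.rk_of_eq (F.homogeneous j) Y hxY hvY () (fun _ => rfl) (fun _ _ => hvD j)
      simp only [Fintype.card_unit, Finset.card_univ] at this
      simp only [hjZ, if_false]
      omega

/-- A critical ray on which all but two components vanish shares no value with another critical
ray. -/
theorem Generic.exists_eval_ne_zero_of_pair {F : HomMap d} (hF : F.Generic) (hn : 2 ≤ n)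
    (hd : ∀ i, 2 ≤ d i) {l a b : Fin n} (hl : 3 ≤ d l) (hab : a ≠ b) (hla : l ≠ a) (hlb : l ≠ b)
    {x : Fin 2 → Fin n → ℂ} (h : F.IsCritFamily x) :
    ∃ j, j ≠ a ∧ j ≠ b ∧ eval (x 0) (F.poly j) ≠ 0 := by
  classical
  by_contra! h0
  have key : ∀ (y : Fin 2 → Fin n → ℂ) (i : Fin 2) (m : Fin n) (T : Finset (Fin 2)),
      F.IsCritFamily y → (∀ j, j ≠ a → j ≠ b → eval (y 0) (F.poly j) = 0) → y i m = 1 →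
      ((F.cof l (y i) = 0 ∧ T = ∅) ∨ (∀ i, F.cof l (y i) ≠ 0) ∧ T = Finset.univ) → False := by
    intro y i m T hy hy0 hm hT
    have hi : JetIndep (d l) y (fun i => F.cof l (y i)) T := by
      refine hy.jetIndep hF hn hd (fun i hi => ?_) ?_
      · rcases hT with ⟨-, rfl⟩ | ⟨hT, -⟩
        · simp at hi
        · exact hT i
      · rcases hT with ⟨-, rfl⟩ | ⟨-, rfl⟩
        · simp; omega
        · simp; omega
    have hyx : ∀ i k, y i k ∈ acl (F.coeffSet (Finset.univ.erase l) ∪ pts y) :=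
      fun i k => subset_acl _ (Or.inr (mem_pts y i k))
    have h1 := hi.rk_of_vanishing (F.homogeneous l) (F.coeffSet (Finset.univ.erase l) ∪ pts y) hyx
      (fun i _ k => F.cof_mem_acl (Set.subset_union_left.trans (subset_acl _)) (hyx i) k)
      (fun i => (hy.eval_eq i 0 l).trans (hy0 l hla hlb))
      (fun i _ => dirDeriv_cof_of_mem_critSet (hy.mem_critSet i) l l)
    rw [Set.union_right_comm, ← coeffSet_univ, Fintype.card_fin] at h1
    have h2 := hF.numCoeffs_le Finset.univ (pts y)
    rw [Set.union_comm, numCoeffs_univ d l] at h2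
    -- If the cofactors vanish at `y i`, this point is isolated (n - 1 - 2 - (n - 3) = 0), the other
    -- point adds one parameter, and f_l vanishes at both: two conditions. If they vanish nowhere,
    -- there are two nonzero values and one parameter for the second point, against two vanishing
    -- values and two derivatives of f_l.
    rcases hT with ⟨hi0, rfl⟩ | ⟨hi0, rfl⟩
    · have h3 := hF.rk_of_cof_eq_zero hn hd hm hi0 (Z := {l, a, b}ᶜ) (by simp) (by
        intro j hj
        simp only [Finset.mem_compl, Finset.mem_insert, Finset.mem_singleton, not_or] at hj
        rw [hy.eval_eq i 0 j]
        exact hy0 j hj.2.1 hj.2.2)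
      have h3c : ({l, a, b} : Finset (Fin n)).card = 3 := by
        rw [Finset.card_eq_three]
        exact ⟨l, a, b, hla, hlb, hab, rfl⟩
      rw [Finset.card_compl, h3c, Fintype.card_fin] at h3
      have hn3 : 3 ≤ n := by
        have := Finset.card_le_univ ({l, a, b} : Finset (Fin n))
        rwa [h3c, Fintype.card_fin] at this
      have hS : F.coeffSet (Finset.univ.erase l) ⊆
          acl (F.coeffSet (Finset.univ.erase l) ∪ Set.range (y i)) :=
        Set.subset_union_left.trans (subset_acl _)
      have h4 := hF.rk_union_pts_le (m := m) (l := l) hn hd hS (x := y) (fun i' j hj => by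
        rw [hy.eval_eq i' i]
        exact eval_mem_acl (fun k => acl_subset_acl_iff.2 hS (F.coeff_mem_acl (by simp [hj]) k))
          fun k => subset_acl _ (Or.inr ⟨k, rfl⟩)) (Finset.univ.erase i) (fun i' hi' => by
          have : i' = i := by simpa using hi'
          subst this
          exact Or.inr hi0)
      have h5 : rk (F.coeffSet (Finset.univ.erase l) ∪ pts y) ≤
          rk (F.coeffSet (Finset.univ.erase l) ∪ Set.range (y i) ∪ pts y) :=
        rk_mono ((Set.union_subset_union_left _ Set.subset_union_left).trans (subset_acl _))
      have h6 := Finset.card_erase_add_one (Finset.mem_univ i)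
      rw [Finset.card_univ, Fintype.card_fin] at h6
      simp only [Finset.card_empty] at h1
      omega
    · set val : Fin 2 → ℂ := ![eval (y 0) (F.poly a), eval (y 0) (F.poly b)]
      set S := F.coeffSet (Finset.univ.erase l) ∪ Set.range val with hS
      have h4 := hF.rk_union_pts_le (S := S) (m := m) (l := l) hn hd (x := y)
        (Set.subset_union_left.trans (subset_acl _))
        (fun i' j hj => by
          rw [hy.eval_eq i' 0]
          by_cases hja : j = a
          · exact subset_acl _ (Or.inr ⟨0, by simp [val, hja]⟩)
          by_cases hjb : j = b
          · exact subset_acl _ (Or.inr ⟨1, by simp [val, hjb]⟩)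
          rw [hy0 j hja hjb]
          exact zero_mem _) (Finset.univ.erase i) (fun i' hi' => by
          have : i' = i := by simpa using hi'
          rw [this, hm]
          exact Or.inl (one_mem _))
      have h5 : rk (F.coeffSet (Finset.univ.erase l) ∪ pts y) ≤ rk (S ∪ pts y) :=
        rk_mono ((Set.union_subset_union_left _ Set.subset_union_left).trans (subset_acl _))
      have h7 : rk S ≤ numCoeffs d (Finset.univ.erase l) + 2 := by
        rw [← hF.rk_coeffSet]
        exact rk_le_add_card _ (subset_acl S)
      have h6 := Finset.card_erase_add_one (Finset.mem_univ i)
      rw [Finset.card_univ, Fintype.card_fin] at h6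
      rw [Finset.card_univ, Fintype.card_fin] at h1
      omega
  have hscale : ∀ {c : ℂ}, ∀ j, j ≠ a → j ≠ b → eval (c • x 0) (F.poly j) = 0 := by
    intro c j hja hjb
    rw [eval_smul_of_isHomogeneous (F.homogeneous j), h0 j hja hjb, mul_zero]
  by_cases hs : ∃ i, F.cof l (x i) = 0
  · obtain ⟨i, hi⟩ := hs
    obtain ⟨m, c, hc, hcx, hm⟩ := h.exists_normalized i
    exact key _ i m ∅ hcx hscale hm (Or.inl ⟨(F.cof_smul_eq_zero_iff l hc (x i)).2 hi, rfl⟩)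
  · push Not at hs
    obtain ⟨m, c, hc, hcx, hm⟩ := h.exists_normalized 0
    exact key _ 0 m Finset.univ hcx hscale hm
      (Or.inr ⟨fun i hi => hs i ((F.cof_smul_eq_zero_iff l hc (x i)).1 hi), rfl⟩)

end HomMap

/-! ### Two quadrics and a cubic in three variables -/

section LowDegree

variable {n : ℕ}

theorem dirDeriv_X (x v : Fin n → ℂ) (a : Fin n) : dirDeriv x v (X a) = v a := by
  classical
  simp [dirDeriv_apply, pderiv_X, Pi.single_apply]

theorem map_eq_of_forall_monomial {e : ℕ} {f : MvPolynomial (Fin n) ℂ} (hf : f.IsHomogeneous e)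
    {φ ψ : MvPolynomial (Fin n) ℂ →ₗ[ℂ] ℂ}
    (h : ∀ m : Fin n →₀ ℕ, m.degree = e → φ (monomial m 1) = ψ (monomial m 1)) : φ f = ψ f := by
  rw [map_eq_sum_coeff hf, map_eq_sum_coeff hf]
  exact Finset.sum_congr rfl fun m _ => by rw [h m (mem_monos.1 m.2)]

theorem exists_monomial_eq_X_mul {e : ℕ} {m : Fin n →₀ ℕ} (hm : m.degree = e + 1) :
    ∃ (a : Fin n) (m' : Fin n →₀ ℕ), m'.degree = e ∧
      monomial m (1 : ℂ) = X a * monomial m' 1 := by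
  have : ∃ a, m a ≠ 0 := by
    by_contra! h
    rw [Finsupp.degree_eq_sum, Finset.sum_eq_zero fun a _ => h a] at hm
    omega
  obtain ⟨a, ha⟩ := this
  have hle : Finsupp.single a 1 ≤ m := by
    rw [Finsupp.single_le_iff]
    omega
  obtain ⟨m', rfl⟩ := exists_add_of_le hle
  refine ⟨a, m', ?_, ?_⟩
  · rw [map_add, Finsupp.degree_single] at hm
    omega
  · rw [X, monomial_mul, one_mul]

theorem eval_add_of_isHomogeneous_two {f : MvPolynomial (Fin n) ℂ} (hf : f.IsHomogeneous 2)
    (x y : Fin n → ℂ) (s t : ℂ) :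
    eval (s • x + t • y) f = s ^ 2 * eval x f + s * t * dirDeriv x y f + t ^ 2 * eval y f := by
  have := map_eq_of_forall_monomial hf (φ := evalAt (s • x + t • y))
    (ψ := s ^ 2 • evalAt x + (s * t) • dirDeriv x y + t ^ 2 • evalAt y) ?_
  · simpa using this
  · intro m hm
    obtain ⟨a, m', hm', h1⟩ := exists_monomial_eq_X_mul hm
    obtain ⟨b, m'', hm'', h2⟩ := exists_monomial_eq_X_mul hm'
    rw [Finsupp.degree_eq_zero_iff] at hm''
    subst hm''
    rw [h1, h2, monomial_zero', C_1, mul_one]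
    simp [dirDeriv_mul, dirDeriv_X]
    ring

theorem dirDeriv_comm_of_isHomogeneous_two {f : MvPolynomial (Fin n) ℂ} (hf : f.IsHomogeneous 2)
    (x y : Fin n → ℂ) : dirDeriv x y f = dirDeriv y x f := by
  refine map_eq_of_forall_monomial hf fun m hm => ?_
  obtain ⟨a, m', hm', h1⟩ := exists_monomial_eq_X_mul hm
  obtain ⟨b, m'', hm'', h2⟩ := exists_monomial_eq_X_mul hm'
  rw [Finsupp.degree_eq_zero_iff] at hm''
  subst hm''
  rw [h1, h2, monomial_zero', C_1, mul_one]
  simp [dirDeriv_mul, dirDeriv_X]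
  ring

theorem eval_add_of_isHomogeneous_three {f : MvPolynomial (Fin n) ℂ} (hf : f.IsHomogeneous 3)
    (x y : Fin n → ℂ) (s t : ℂ) :
    eval (s • x + t • y) f = s ^ 3 * eval x f + s ^ 2 * t * dirDeriv x y f +
      s * t ^ 2 * dirDeriv y x f + t ^ 3 * eval y f := by
  have := map_eq_of_forall_monomial hf (φ := evalAt (s • x + t • y))
    (ψ := s ^ 3 • evalAt x + (s ^ 2 * t) • dirDeriv x y + (s * t ^ 2) • dirDeriv y x +
      t ^ 3 • evalAt y) ?_
  · simpa using this
  · intro m hm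
    obtain ⟨a, m', hm', h1⟩ := exists_monomial_eq_X_mul hm
    obtain ⟨b, m'', hm'', h2⟩ := exists_monomial_eq_X_mul hm'
    obtain ⟨c, m''', hm''', h3⟩ := exists_monomial_eq_X_mul hm''
    rw [Finsupp.degree_eq_zero_iff] at hm'''
    subst hm'''
    rw [h1, h2, h3, monomial_zero', C_1, mul_one]
    simp [dirDeriv_mul, dirDeriv_X]
    ring

theorem smul_add_smul_notMem_span {x y : Fin n → ℂ} (hx : x ∉ Submodule.span ℂ {y})
    (hy : y ∉ Submodule.span ℂ {x}) {a b a' b' : ℂ} (h : a * b' - a' * b ≠ 0) :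
    a • x + b • y ∉ Submodule.span ℂ {a' • x + b' • y} := by
  intro hmem
  obtain ⟨c, hc⟩ := Submodule.mem_span_singleton.1 hmem
  have h1 : (c * a' - a) • x = (b - c * b') • y := by
    have : (c * a' - a) • x - (b - c * b') • y = c • (a' • x + b' • y) - (a • x + b • y) := by
      module
    rw [← sub_eq_zero, this, hc, sub_self]
  have h2 : c * a' - a = 0 := by
    by_contra hne
    apply hx
    refine Submodule.mem_span_singleton.2 ⟨(c * a' - a)⁻¹ * (b - c * b'), ?_⟩
    rw [mul_smul, ← h1, smul_smul, inv_mul_cancel₀ hne, one_smul]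
  have h3 : b - c * b' = 0 := by
    by_contra hne
    apply hy
    refine Submodule.mem_span_singleton.2 ⟨(b - c * b')⁻¹ * (c * a' - a), ?_⟩
    rw [mul_smul, h1, smul_smul, inv_mul_cancel₀ hne, one_smul]
  apply h
  linear_combination (-b') * h2 - a' * h3

end LowDegree

namespace HomMap

variable {n : ℕ} {d : Fin n → ℕ}

theorem IsCritFamily.comp {F : HomMap d} {ι κ : Type*} {x : ι → Fin n → ℂ} (h : F.IsCritFamily x)
    {f : κ → ι} (hf : Function.Injective f) : F.IsCritFamily (x ∘ f) where
  ne_zero i := h.ne_zero (f i)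
  notMem_span i j hij := h.notMem_span (f i) (f j) (hf.ne hij)
  mem_critSet i := h.mem_critSet (f i)
  eval_eq i i' j := h.eval_eq (f i) (f i') j

/-- If the cofactors of row `l` do not vanish, they span the kernel of the other rows. -/
theorem mem_span_cof (F : HomMap d) {l : Fin n} {x u : Fin n → ℂ} (h : F.cof l x ≠ 0)
    (hu : ∀ j, j ≠ l → dirDeriv x u (F.poly j) = 0) : u ∈ Submodule.span ℂ {F.cof l x} := by
  obtain ⟨a, ha⟩ := Function.ne_iff.1 h
  have ha : F.cof l x a ≠ 0 := ha
  set c := u a / F.cof l x a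
  have hdet : ((F.jacMatrix.updateRow l (Pi.single a 1)).map (eval x)).det ≠ 0 := by
    rwa [← RingHom.mapMatrix_apply, ← RingHom.map_det, ← cofPoly_eq_det]
  have hz : u + (-c) • F.cof l x = 0 := by
    by_contra hz
    refine hdet (Matrix.exists_mulVec_eq_zero_iff.1 ⟨_, hz, ?_⟩)
    ext j
    by_cases hj : j = l
    · subst hj
      have : (u + (-c) • F.cof j x) a = 0 := by
        simp [c, ha]
      simpa [Matrix.mulVec, dotProduct, Matrix.updateRow_self, Pi.single_apply,
        apply_ite (eval x)] using this
    · simp only [Matrix.mulVec, dotProduct, Matrix.map_apply, Matrix.updateRow_ne hj,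
        Pi.zero_apply]
      have h1 : dirDeriv x (u + (-c) • F.cof l x) (F.poly j) = 0 := by
        rw [dirDeriv_add_right, dirDeriv_smul_right, hu j hj, dirDeriv_cof, if_neg hj]
        simp
      rw [← h1, dirDeriv_apply]
      exact Finset.sum_congr rfl fun i _ => mul_comm _ _
  refine Submodule.mem_span_singleton.2 ⟨c, ?_⟩
  have : u = u + (-c) • F.cof l x + c • F.cof l x := by module
  rw [this, hz, zero_add]

/-- The kernel of the other rows is the line of the cofactor vector. Any kernel vector found from
the quadrics thus gives an equation for the cubic. -/
theorem dirDeriv_eq_zero_of_mem_critSet {F : HomMap d} {l : Fin n} {x u : Fin n → ℂ}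
    (hc : x ∈ F.critSet) (h : F.cof l x ≠ 0)
    (hu : ∀ j, j ≠ l → dirDeriv x u (F.poly j) = 0) : dirDeriv x u (F.poly l) = 0 := by
  obtain ⟨c, rfl⟩ := Submodule.mem_span_singleton.1 (F.mem_span_cof h hu)
  rw [dirDeriv_smul_right, dirDeriv_cof_of_mem_critSet hc, mul_zero]

/-- Two quadrics and a cubic in three variables: no three critical points on a line have the same
image. -/
theorem Generic.not_coplanar_of_quadrics_cubic {F : HomMap d} (hF : F.Generic) (hn : n = 3)
    {l m : Fin n} (hl : d l = 3) (hq : ∀ j, j ≠ l → d j = 2) {x : Fin 3 → Fin n → ℂ}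
    (h : F.IsCritFamily x) (hcof : ∀ i, F.cof l (x i) ≠ 0) (hm : x 0 m = 1) :
    x 2 ∉ Submodule.span ℂ {x 0, x 1} := by
  classical
  have hd : ∀ i, 2 ≤ d i := fun i => by
    by_cases hi : i = l
    · rw [hi, hl]; norm_num
    · rw [hq i hi]
  have hn2 : 2 ≤ n := by omega
  intro hmem
  obtain ⟨s, t, hst⟩ := Submodule.mem_span_pair.1 hmem
  have hs : s ≠ 0 := by
    rintro rfl
    apply h.notMem_span 2 1 (by decide)
    rw [← hst, zero_smul, zero_add]
    exact Submodule.smul_mem _ _ (Submodule.mem_span_singleton_self _)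
  have ht : t ≠ 0 := by
    rintro rfl
    apply h.notMem_span 2 0 (by decide)
    rw [← hst, zero_smul, add_zero]
    exact Submodule.smul_mem _ _ (Submodule.mem_span_singleton_self _)
  set X := Set.range (x 0) ∪ Set.range (x 1) ∪ Set.range ![s, t] with hX
  have hx0 : ∀ k, x 0 k ∈ acl X := fun k => subset_acl _ (Or.inl (Or.inl ⟨k, rfl⟩))
  have hx1 : ∀ k, x 1 k ∈ acl X := fun k => subset_acl _ (Or.inl (Or.inr ⟨k, rfl⟩))
  have hsX : s ∈ acl X := subset_acl _ (Or.inr ⟨0, rfl⟩)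
  have htX : t ∈ acl X := subset_acl _ (Or.inr ⟨1, rfl⟩)
  have hx2 : ∀ k, x 2 k ∈ acl X := fun k => by
    rw [← hst]
    exact add_mem (mul_mem hsX (hx0 k)) (mul_mem htX (hx1 k))
  have hxX : ∀ i k, x i k ∈ acl X := by
    intro i
    fin_cases i
    exacts [hx0, hx1, hx2]
  have h01 : rk (Set.range (x 0) ∪ Set.range (x 1)) ≤ 5 := by
    have h1 := rk_le_add_card_of_forall_notMem (S := ∅) (x 0) {m}ᶜ (fun i hi => by
      have : i = m := by simpa using hi
      rw [this, hm]
      exact one_mem _)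
    have h2 := rk_le_add_card_of_forall_notMem (S := Set.range (x 0)) (x 1) Finset.univ (by simp)
    rw [Finset.card_univ, Fintype.card_fin] at h2
    rw [Finset.card_compl, Fintype.card_fin, Finset.card_singleton, Set.empty_union,
      rk_empty] at h1
    omega
  have hquad : rk (X ∪ F.coeffSet (Finset.univ.erase l)) + 4 ≤
      rk X + numCoeffs d (Finset.univ.erase l) := by
    have h1 := F.rk_union_coeffSet_add_le (Finset.univ.erase l) X (fun _ => 2) ?_
    · have := card_univ_erase_add_one l
      rw [Finset.sum_const, smul_eq_mul] at h1
      omega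
    · intro j hj Y _ hXY
      have hi : JetIndep (d j) x x ∅ :=
        jetIndep_of_card_le h.ne_zero h.notMem_span (by simp) (by have := hd j; simpa using this)
      have := hi.rk_of_eq (F.homogeneous j) Y (fun i k => hXY (hxX i k)) (by simp) 0
        (fun i => h.eval_eq i 0 j) (by simp)
      simp only [Fintype.card_fin, Finset.card_empty] at this
      omega
  have hN := hF.numCoeffs_le Finset.univ X
  rw [numCoeffs_univ d l, coeffSet_univ F l, ← Set.union_assoc] at hN
  -- Equal values of a quadric at `x 0`, `x 1` and `s • x 0 + t • x 1` make its mixed derivative `b`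
  -- times this value. With Euler's relation both quadrics then have zero derivative at `x 0` along
  -- `-b • x 0 + 2 • x 1`, and symmetrically at `x 1`.
  set b := (1 - s ^ 2 - t ^ 2) / (s * t) with hb
  have hbst : b * (s * t) = 1 - s ^ 2 - t ^ 2 := div_mul_cancel₀ _ (mul_ne_zero hs ht)
  have hB : ∀ j, j ≠ l → dirDeriv (x 0) (x 1) (F.poly j) = b * eval (x 0) (F.poly j) := by
    intro j hj
    have hj2 : (F.poly j).IsHomogeneous 2 := hq j hj ▸ F.homogeneous j
    have h1 := eval_add_of_isHomogeneous_two hj2 (x 0) (x 1) s t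
    rw [hst, h.eval_eq 2 0, h.eval_eq 1 0] at h1
    refine mul_left_cancel₀ (mul_ne_zero hs ht) ?_
    linear_combination -h1 - eval (x 0) (F.poly j) * hbst
  have hc0 : 2 * dirDeriv (x 0) (x 1) (F.poly l) = 3 * b * eval (x 0) (F.poly l) := by
    have h1 := dirDeriv_eq_zero_of_mem_critSet (h.mem_critSet 0) (hcof 0)
      (u := (-b) • x 0 + (2 : ℂ) • x 1) (fun j hj => by
        rw [dirDeriv_add_right, dirDeriv_smul_right, dirDeriv_smul_right, hB j hj,
          dirDeriv_self (F.homogeneous j), hq j hj]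
        push_cast
        ring)
    rw [dirDeriv_add_right, dirDeriv_smul_right, dirDeriv_smul_right,
      dirDeriv_self (F.homogeneous l), hl] at h1
    push_cast at h1
    linear_combination h1
  have hc1 : 2 * dirDeriv (x 1) (x 0) (F.poly l) = 3 * b * eval (x 0) (F.poly l) := by
    have h1 := dirDeriv_eq_zero_of_mem_critSet (h.mem_critSet 1) (hcof 1)
      (u := (-b) • x 1 + (2 : ℂ) • x 0) (fun j hj => by
        have hj2 : (F.poly j).IsHomogeneous 2 := hq j hj ▸ F.homogeneous j
        rw [dirDeriv_add_right, dirDeriv_smul_right, dirDeriv_smul_right,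
          ← dirDeriv_comm_of_isHomogeneous_two hj2 (x 0) (x 1), hB j hj,
          dirDeriv_self (F.homogeneous j), hq j hj, h.eval_eq 1 0]
        push_cast
        ring)
    rw [dirDeriv_add_right, dirDeriv_smul_right, dirDeriv_smul_right,
      dirDeriv_self (F.homogeneous l), hl, h.eval_eq 1 0] at h1
    push_cast at h1
    linear_combination h1
  have hl3 : (F.poly l).IsHomogeneous 3 := hl ▸ F.homogeneous l
  have hcub := eval_add_of_isHomogeneous_three hl3 (x 0) (x 1)
  -- If the common value of the cubic is zero, so are its mixed derivatives, and it vanishes on the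
  -- whole plane: four conditions, against at most 7 - 4 = 3 parameters left by the quadrics.
  by_cases hγ : eval (x 0) (F.poly l) = 0
  · rw [hγ, mul_zero, mul_eq_zero_iff_left two_ne_zero] at hc0 hc1
    have hrkX : rk X ≤ 7 := by
      have := rk_le_add_card (S := Set.range (x 0) ∪ Set.range (x 1)) _ (subset_acl X)
      rw [Fintype.card_fin] at this
      omega
    -- Four rays of the plane, as many as a binary cubic has coefficients.
    set co : Fin 4 → ℂ × ℂ := ![(1, 0), (0, 1), (1, 1), (1, -1)] with hco
    have hpar : ∀ i j, i ≠ j → (co i).1 • x 0 + (co i).2 • x 1 ∉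
        Submodule.span ℂ {(co j).1 • x 0 + (co j).2 • x 1} := by
      intro i j hij
      refine smul_add_smul_notMem_span (h.notMem_span 0 1 (by decide))
        (h.notMem_span 1 0 (by decide)) ?_
      fin_cases i <;> fin_cases j <;> first | exact absurd rfl hij | norm_num [hco]
    have hi : JetIndep (d l) (fun i => (co i).1 • x 0 + (co i).2 • x 1) 0 ∅ :=
      jetIndep_of_card_le (fun i => ne_zero_of_notMem_span (hpar i (i + 1) (by simp))) hpar
        (by simp) (by simp [hl])
    have hcoX : ∀ i, (co i).1 ∈ acl X ∧ (co i).2 ∈ acl X := by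
      intro i
      fin_cases i
      · exact ⟨one_mem _, zero_mem _⟩
      · exact ⟨zero_mem _, one_mem _⟩
      · exact ⟨one_mem _, one_mem _⟩
      · exact ⟨one_mem _, neg_mem (one_mem _)⟩
    have hmono := acl_mono (Set.subset_union_left (s := X) (t := F.coeffSet (Finset.univ.erase l)))
    have := hi.rk_of_vanishing (F.homogeneous l) (X ∪ F.coeffSet (Finset.univ.erase l))
      (fun i k => hmono (add_mem (mul_mem (hcoX i).1 (hx0 k)) (mul_mem (hcoX i).2 (hx1 k))))
      (by simp) (fun i => by rw [hcub, h.eval_eq 1 0, hγ, hc0, hc1]; ring) (by simp)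
    simp only [Fintype.card_fin, Finset.card_empty] at this
    omega
  -- For a nonzero value, evaluating the cubic at `x 2` gives (s + t - 1)²(s + t + 2) = 0. One
  -- parameter is lost: at most 6 - 4 = 2 remain, against one equality and two derivatives of the
  -- cubic at `x 0` and `x 1`.
  · have hrel : (s + t - 1) * (s + t + 2) = 0 := by
      have h1 := hcub s t
      rw [hst, h.eval_eq 2 0, h.eval_eq 1 0] at h1
      have h2 : eval (x 0) (F.poly l) * ((s + t - 1) ^ 2 * (s + t + 2)) = 0 := by
        linear_combination 2 * h1 + s ^ 2 * t * hc0 + s * t ^ 2 * hc1 +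
          3 * (s + t) * eval (x 0) (F.poly l) * hbst
      have h3 := (mul_eq_zero.1 h2).resolve_left hγ
      rw [pow_two, mul_assoc, mul_eq_zero] at h3
      rcases h3 with h3 | h3
      · rw [h3, zero_mul]
      · exact h3
    have htS : t ∈ acl (Set.range (x 0) ∪ Set.range (x 1) ∪ Set.range fun _ : Unit => s) := by
      have hs' : s ∈ acl (Set.range (x 0) ∪ Set.range (x 1) ∪ Set.range fun _ : Unit => s) :=
        subset_acl _ (Or.inr ⟨(), rfl⟩)
      rcases mul_eq_zero.1 hrel with h1 | h1
      · rw [show t = 1 - s by linear_combination h1]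
        exact sub_mem (one_mem _) hs'
      · rw [show t = -2 - s by linear_combination h1]
        exact sub_mem (neg_mem (ofNat_mem _ 2)) hs'
    have hrkX : rk X ≤ 6 := by
      have := rk_le_add_card (S := Set.range (x 0) ∪ Set.range (x 1)) (T := X)
        (fun _ : Unit => s) ?_
      · rw [Fintype.card_unit] at this
        omega
      · refine Set.union_subset (Set.subset_union_left.trans (subset_acl _)) ?_
        rintro _ ⟨i, rfl⟩
        fin_cases i
        · exact subset_acl _ (Or.inr ⟨(), rfl⟩)
        · exact htS
    have h2 := h.comp (Fin.castLE_injective (show 2 ≤ 3 by norm_num))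
    have hi := h2.jetIndep hF hn2 hd (l := l) (T := Finset.univ) (fun i _ => hcof _) (by simp [hl])
    have hmono := acl_mono (Set.subset_union_left (s := X) (t := F.coeffSet (Finset.univ.erase l)))
    have := hi.rk_of_eq (F.homogeneous l) (X ∪ F.coeffSet (Finset.univ.erase l))
      (fun i k => hmono (hxX _ k))
      (fun i _ k => F.cof_mem_acl (Set.subset_union_right.trans (subset_acl _))
        (fun k => hmono (hxX _ k)) k) 0
      (fun i => h2.eval_eq i 0 l) (fun i _ => dirDeriv_cof_of_mem_critSet (h2.mem_critSet i) l l)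
    simp only [Fintype.card_fin, Finset.card_univ] at this
    omega

end HomMap

/-! ### Excluding n critical points on distinct rays in one fibre -/

namespace HomMap

variable {n : ℕ} {d : Fin n → ℕ}

/-- One point with vanishing cofactors leaves at most n - 1 others. The degree allows n values and n
- 2 derivatives, and the codimension two of the singular point makes up for the one derivative that
may be missing. -/
theorem Generic.cof_ne_zero_of_isCritFamily {F : HomMap d} (hF : F.Generic) (hn : 2 ≤ n)
    (hd : ∀ i, 2 ≤ d i) {l : Fin n} (hl : 2 * n ≤ d l + 3) {x : Fin n → Fin n → ℂ}
    (h : F.IsCritFamily x) (i : Fin n) : F.cof l (x i) ≠ 0 := by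
  classical
  intro hi0
  obtain ⟨m, c, hc, hcx, hm⟩ := h.exists_normalized i
  have hi' := (F.cof_smul_eq_zero_iff l hc (x i)).2 hi0
  set s := Finset.univ.filter fun j => F.cof l (c • x j) ≠ 0
  have hs : s.card + 1 ≤ n := by
    have : s ⊂ Finset.univ := Finset.filter_ssubset.2 ⟨i, Finset.mem_univ i, by simpa using hi'⟩
    have := Finset.card_lt_card this
    rwa [Finset.card_univ, Fintype.card_fin] at this
  obtain ⟨T, hTs, hT⟩ := Finset.exists_subset_card_eq (s := s) (n := min s.card (n - 2))
    (min_le_left _ _)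
  have h1 := hF.rk_add_card_le_of_cof_eq_zero (x := fun i => c • x i) (i₀ := i) hn hd hm
    hcx.mem_critSet hi' (fun j k => hcx.eval_eq j i k) (s := s) (T := T) (by simp [s])
    (hcx.jetIndep hF hn hd (fun j hj => (Finset.mem_filter.1 (hTs hj)).2) (by
      rw [Fintype.card_fin, hT]
      omega))
  have h2 := hF.numCoeffs_le Finset.univ (pts fun i => c • x i)
  rw [Set.union_comm] at h2
  rw [Fintype.card_fin, hT] at h1
  omega

/-- The values of the components other than `l` at coplanar points. -/
theorem IsCritFamily.rk_coplanar {F : HomMap d} (hn : 3 ≤ n)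
    {l m : Fin n} {x : Fin n → Fin n → ℂ} (h : F.IsCritFamily x) {i a : Fin n} (hia : i ≠ a)
    (hm : x i m = 1) (hco : ∀ b, x b ∈ Submodule.span ℂ {x i, x a}) :
    rk (F.coeffSet (Finset.univ.erase l) ∪ pts x) +
      ∑ j ∈ Finset.univ.erase l, min (d j) (n - 1) + 5 ≤
      numCoeffs d (Finset.univ.erase l) + 4 * n := by
  classical
  -- The normalised `x i`, the point `x a` and two coefficients for each other point make n - 1 + n
  -- + 2(n - 2) = 4n - 5 parameters. Forms of degree e separate values on e + 1 rays, so component j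
  -- satisfies min(d_j, n - 1) independent equalities.
  have h1 := F.rk_union_coeffSet_add_le (Finset.univ.erase l) (pts x)
    (fun j => min (d j) (n - 1)) ?_
  · have h2 := rk_le_add_card_of_forall_notMem (S := ∅) (x i) {m}ᶜ (fun k hk => by
      have : k = m := by simpa using hk
      rw [this, hm]
      exact one_mem _)
    have h3 := rk_le_add_card_of_forall_notMem (S := Set.range (x i)) (x a) Finset.univ (by simp)
    rw [Finset.card_univ, Fintype.card_fin] at h3
    rw [Finset.card_compl, Fintype.card_fin, Finset.card_singleton, Set.empty_union,
      rk_empty] at h2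
    have hco' : ∀ b, ∃ p : ℂ × ℂ, p.1 • x i + p.2 • x a = x b := fun b => by
      obtain ⟨s, t, hst⟩ := Submodule.mem_span_pair.1 (hco b)
      exact ⟨(s, t), hst⟩
    choose p hp using hco'
    have h4 := rk_le_add_card (S := Set.range (x i) ∪ Set.range (x a)) (T := pts x)
      (fun q : (({i, a} : Finset (Fin n))ᶜ : Finset (Fin n)) × Fin 2 =>
        if q.2 = 0 then (p q.1).1 else (p q.1).2) ?_
    · rw [Fintype.card_prod, Fintype.card_coe, Fintype.card_fin, Finset.card_compl,
        Fintype.card_fin, Finset.card_pair hia] at h4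
      rw [Set.union_comm] at h1
      omega
    · rintro _ ⟨⟨b, k⟩, rfl⟩
      by_cases hbi : b = i
      · subst hbi
        exact subset_acl _ (Or.inl (Or.inl ⟨k, rfl⟩))
      by_cases hba : b = a
      · subst hba
        exact subset_acl _ (Or.inl (Or.inr ⟨k, rfl⟩))
      have hb : b ∈ ({i, a} : Finset (Fin n))ᶜ := by simp [hbi, hba]
      simp only
      rw [← hp b]
      refine add_mem (mul_mem ?_ ?_) (mul_mem ?_ ?_)
      · exact subset_acl _ (Or.inr ⟨(⟨b, hb⟩, 0), by simp⟩)
      · exact subset_acl _ (Or.inl (Or.inl ⟨k, rfl⟩))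
      · exact subset_acl _ (Or.inr ⟨(⟨b, hb⟩, 1), by simp⟩)
      · exact subset_acl _ (Or.inl (Or.inr ⟨k, rfl⟩))
  · intro j hj Y _ hXY
    have hk : min (d j) (n - 1) + 1 ≤ n := by omega
    have h2 := h.comp (Fin.castLE_injective hk)
    have hi : JetIndep (d j) (x ∘ Fin.castLE hk) 0 ∅ :=
      jetIndep_of_card_le h2.ne_zero h2.notMem_span (by simp) (by simp)
    have := hi.rk_of_eq (F.homogeneous j) Y (fun i k => hXY (subset_acl _ (mem_pts x _ k)))
      (by simp) 0 (fun i => h2.eval_eq i 0 j) (by simp)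
    simp only [Fintype.card_fin, Finset.card_empty] at this
    omega

/-- There are no `n` critical points on distinct rays in one fibre. -/
theorem Generic.not_isCritFamily {F : HomMap d} (hF : F.Generic) (hn : 2 ≤ n)
    (hd : ∀ i, 2 ≤ d i) {l : Fin n} (hl : 2 * n ≤ d l + 1 ∨ 3 ≤ n ∧ 2 * n ≤ d l + 2 ∨
      4 ≤ n ∧ 2 * n ≤ d l + 3 ∧ (∃ j, j ≠ l ∧ 3 ≤ d j) ∨ n = 3 ∧ d l = 3 ∧ ∀ j, j ≠ l → d j = 2)
    {x : Fin n → Fin n → ℂ} : ¬ F.IsCritFamily x := by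
  classical
  intro h
  have hl3 : 2 * n ≤ d l + 3 := by omega
  have hcof := hF.cof_ne_zero_of_isCritFamily hn hd hl3 h
  have key : ∀ (i m : Fin n) (c : ℂ), c ≠ 0 → F.IsCritFamily (fun i => c • x i) →
      (c • x i) m = 1 → ∀ T, JetIndep (d l) (fun i => c • x i) (fun i => F.cof l (c • x i)) T →
      T.card < n := by
    intro i m c hc hcx hm T hT
    have h1 := hF.rk_add_card_le (x := fun i => c • x i) (i₀ := i) hn hd hm hcx.mem_critSet
      (fun j k => hcx.eval_eq j i k) hT
    have h2 := hF.numCoeffs_le Finset.univ (pts fun i => c • x i)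
    rw [Set.union_comm] at h2
    omega
  have hcof' : ∀ c : ℂ, c ≠ 0 → ∀ i, F.cof l (c • x i) ≠ 0 := fun c hc i hi =>
    hcof i ((F.cof_smul_eq_zero_iff l hc (x i)).1 hi)
  by_cases hbig : 2 * n ≤ d l + 1
  · obtain ⟨m, c, hc, hcx, hm⟩ := h.exists_normalized ⟨0, by omega⟩
    have := key _ m c hc hcx hm Finset.univ (hcx.jetIndep hF hn hd (fun i _ => hcof' c hc i) (by
      rw [Finset.card_univ, Fintype.card_fin]; omega))
    rw [Finset.card_univ, Fintype.card_fin] at this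
    exact lt_irrefl _ this
  have hn3 : 3 ≤ n := by omega
  by_cases hpair : ∀ i, ∃ a b, a ≠ b ∧ a ≠ i ∧ b ≠ i ∧ x i ∉ Submodule.span ℂ {x a, x b}
  · obtain ⟨m, c, hc, hcx, hm⟩ := h.exists_normalized ⟨0, by omega⟩
    have hi : JetIndep (d l) (fun i => c • x i) (fun i => F.cof l (c • x i)) Finset.univ := by
      refine jetIndep_of_not_coplanar hcx.ne_zero hcx.notMem_span (fun i _ =>
        hF.cof_notMem_span hn hd (hcx.ne_zero i) (hcx.mem_critSet i) (hcof' c hc i)) ?_ ?_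
      · intro i
        obtain ⟨a, b, hab, hai, hbi, hi⟩ := hpair i
        refine ⟨a, b, hab, hai, hbi, fun hmem => hi ?_⟩
        obtain ⟨s, t, hst⟩ := Submodule.mem_span_pair.1 hmem
        refine Submodule.mem_span_pair.2 ⟨s, t, smul_right_injective _ hc ?_⟩
        simp only [smul_add, smul_comm c]
        exact hst
      · rw [Fintype.card_fin]; exact hl3
    have := key _ m c hc hcx hm Finset.univ hi
    rw [Finset.card_univ, Fintype.card_fin] at this
    exact lt_irrefl _ this
  -- Now some `x i` lies in the span of any two other points, so all the points lie in one plane.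
  push Not at hpair
  obtain ⟨i, hi⟩ := hpair
  have : Nontrivial (Fin n) := Fin.nontrivial_iff_two_le.2 hn
  obtain ⟨a, ha⟩ := exists_ne i
  obtain ⟨m, c, hc, hcx, hm⟩ := h.exists_normalized i
  have hco : ∀ b, c • x b ∈ Submodule.span ℂ {c • x i, c • x a} := by
    intro b
    by_cases hba : b = a
    · subst hba
      exact Submodule.subset_span (by simp)
    by_cases hbi : b = i
    · subst hbi
      exact Submodule.subset_span (by simp)
    obtain ⟨s, t, hst⟩ := Submodule.mem_span_pair.1 (hi b a hba hbi ha)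
    have hs : s ≠ 0 := by
      rintro rfl
      apply h.notMem_span i a ha.symm
      rw [← hst, zero_smul, zero_add]
      exact Submodule.smul_mem _ _ (Submodule.mem_span_singleton_self _)
    refine Submodule.mem_span_pair.2 ⟨s⁻¹, -(s⁻¹ * t), ?_⟩
    rw [← hst]
    simp only [smul_add, smul_smul]
    rw [show s⁻¹ * (c * s) = c by field_simp, add_assoc, ← add_smul,
      show s⁻¹ * (c * t) + -(s⁻¹ * t) * c = 0 by ring, zero_smul, add_zero]
  by_cases hspecial : n = 3 ∧ d l = 3 ∧ ∀ j, j ≠ l → d j = 2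
  · obtain ⟨hn', hdl, hdj⟩ := hspecial
    obtain ⟨k, hki, hka⟩ : ∃ k, k ≠ i ∧ k ≠ a := by
      have := Finset.exists_mem_notMem_of_card_lt_card (s := {i, a}) (t := Finset.univ) (by
        rw [Finset.card_pair ha.symm, Finset.card_univ, Fintype.card_fin]; omega)
      obtain ⟨k, -, hk⟩ := this
      simp only [Finset.mem_insert, Finset.mem_singleton, not_or] at hk
      exact ⟨k, hk⟩
    have hinj : Function.Injective ![i, a, k] := by
      intro p q hpq
      fin_cases p <;> fin_cases q <;> simp_all [eq_comm]
    have h3 := hcx.comp hinj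
    exact hF.not_coplanar_of_quadrics_cubic hn' hdl hdj h3 (fun p => hcof' c hc _) hm (hco k)
  · have h1 := hcx.rk_coplanar (l := l) hn3 ha.symm hm hco
    -- The second inequality is the degree needed for jets along `T`; the third says that the
    -- conditions on all components outnumber the 4n - 5 parameters of coplanar points.
    have hT : ∃ T : Finset (Fin n), T.card + 1 ≤ n ∧ T.card + n ≤ d l + 1 ∧
        3 * n ≤ T.card + ∑ j ∈ Finset.univ.erase l, min (d j) (n - 1) + 3 := by
      have hsum : ∀ j ∈ Finset.univ.erase l, 2 ≤ min (d j) (n - 1) := fun j _ =>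
        le_min (hd j) (by omega)
      have hc1 := card_univ_erase_add_one l
      rcases hl with hl | hl | hl | hl
      · exact absurd hl hbig
      · obtain ⟨T, -, hT⟩ := Finset.exists_subset_card_eq (s := Finset.univ.erase l) (n := n - 1)
          (by omega)
        refine ⟨T, by omega, by omega, ?_⟩
        have := Finset.card_nsmul_le_sum _ _ _ hsum
        rw [smul_eq_mul] at this
        omega
      · obtain ⟨T, -, hT⟩ := Finset.exists_subset_card_eq (s := Finset.univ.erase l) (n := n - 2)
          (by omega)
        obtain ⟨hn4, hl, j, hj, hdj⟩ := hl
        refine ⟨T, by omega, by omega, ?_⟩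
        have hjm : j ∈ Finset.univ.erase l := by simp [hj]
        have h2 := Finset.add_sum_erase _ (fun j => min (d j) (n - 1)) hjm
        have h3 := Finset.card_nsmul_le_sum ((Finset.univ.erase l).erase j)
          (fun j => min (d j) (n - 1)) 2 (fun k hk => hsum k (Finset.mem_of_mem_erase hk))
        have h4 := Finset.card_erase_add_one hjm
        have h5 : 3 ≤ min (d j) (n - 1) := le_min hdj (by omega)
        rw [smul_eq_mul] at h3
        omega
      · exact absurd hl hspecial
    obtain ⟨T, -, hT2, hT3⟩ := hT
    have h2 := rk_add_of_jetIndep i hcx.mem_critSet (fun j k => hcx.eval_eq j i k)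
      (hcx.jetIndep hF hn hd (l := l) (T := T) (fun j _ => hcof' c hc j) (by
        rw [Fintype.card_fin]; omega))
    have h3 := hF.numCoeffs_le Finset.univ (pts fun i => c • x i)
    rw [Set.union_comm] at h3
    have h4 := numCoeffs_univ d l
    rw [Fintype.card_fin] at h2
    omega

end HomMap

/-! ### Arithmetic of the degrees -/

/-- The condition on the degrees of the theorem, in symmetric form. -/
structure AlmostCoprime {n : ℕ} (d : Fin n → ℕ) : Prop where
  two_le : ∀ i, 2 ≤ d i
  gcd_le_two : ∀ i j, i ≠ j → Nat.gcd (d i) (d j) ≤ 2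
  gcd_eq_one : ∀ i j k, i ≠ j → i ≠ k → j ≠ k → Nat.gcd (Nat.gcd (d i) (d j)) (d k) = 1

namespace AlmostCoprime

variable {n : ℕ} {d : Fin n → ℕ}

theorem of_lt (hd : ∀ i, 2 ≤ d i) (hd2 : ∀ i j, i < j → Nat.gcd (d i) (d j) ≤ 2)
    (hd3 : ∀ i j k, i < j → j < k → Nat.gcd (Nat.gcd (d i) (d j)) (d k) = 1) :
    AlmostCoprime d := by
  refine ⟨hd, fun i j hij => ?_, fun i j k hij hik hjk => ?_⟩
  · rcases lt_or_gt_of_ne hij with h | h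
    · exact hd2 i j h
    · rw [Nat.gcd_comm]
      exact hd2 j i h
  · rcases lt_or_gt_of_ne hij with h1 | h1 <;> rcases lt_or_gt_of_ne hik with h2 | h2 <;>
      rcases lt_or_gt_of_ne hjk with h3 | h3
    · exact hd3 i j k h1 h3
    · rw [← hd3 i k j h2 h3]; ac_rfl
    · omega
    · rw [← hd3 k i j h2 h1]; ac_rfl
    · rw [← hd3 j i k h1 h2]; ac_rfl
    · omega
    · rw [← hd3 j k i h3 h2]; ac_rfl
    · rw [← hd3 k j i h3 h1]; ac_rfl

theorem two_dvd_of_not_coprime (h : AlmostCoprime d) {i j : Fin n} (hij : i ≠ j)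
    (hc : ¬ Nat.Coprime (d i) (d j)) : 2 ∣ d i ∧ 2 ∣ d j := by
  have h1 := h.gcd_le_two i j hij
  have h2 : Nat.gcd (d i) (d j) ≠ 0 := by
    have := h.two_le i
    intro h0
    have := Nat.eq_zero_of_gcd_eq_zero_left h0
    omega
  have h3 : Nat.gcd (d i) (d j) = 2 := by
    have : Nat.gcd (d i) (d j) ≠ 1 := hc
    omega
  exact ⟨h3 ▸ Nat.gcd_dvd_left _ _, h3 ▸ Nat.gcd_dvd_right _ _⟩

theorem eq_or_eq_of_two_dvd (h : AlmostCoprime d) {i j k : Fin n} (hij : i ≠ j)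
    (hi : 2 ∣ d i) (hj : 2 ∣ d j) (hk : 2 ∣ d k) : k = i ∨ k = j := by
  by_contra! hc
  have h1 := h.gcd_eq_one i j k hij hc.1.symm hc.2.symm
  have h2 : 2 ∣ Nat.gcd (Nat.gcd (d i) (d j)) (d k) := Nat.dvd_gcd (Nat.dvd_gcd hi hj) hk
  omega

theorem three_le_of_not_two_dvd (h : AlmostCoprime d) {i : Fin n} (hi : ¬ 2 ∣ d i) : 3 ≤ d i := by
  have := h.two_le i
  omega

theorem injOn_odd (h : AlmostCoprime d) : Set.InjOn d {i | ¬ 2 ∣ d i} := by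
  intro i hi j hj hij
  by_contra hne
  have h1 := h.gcd_le_two i j hne
  rw [← hij, Nat.gcd_self] at h1
  have := h.three_le_of_not_two_dvd hi
  omega

/-- Among `k > 0` odd degrees one is at least `2 * k + 1`. -/
theorem exists_odd_degree_ge (h : AlmostCoprime d) {s : Finset (Fin n)} (hs : s.Nonempty)
    (hodd : ∀ i ∈ s, ¬ 2 ∣ d i) : ∃ l ∈ s, 2 * s.card + 1 ≤ d l := by
  classical
  by_contra! hc
  -- Below 2k + 1 there are only the k - 1 odd numbers 3, 5, …, 2k - 1, and the odd degrees are
  -- distinct.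
  have hmaps : ∀ i ∈ s, (d i - 3) / 2 ∈ Finset.range (s.card - 1) := by
    intro i hi
    have h1 := hc i hi
    have h2 := hodd i hi
    have h3 := h.three_le_of_not_two_dvd h2
    rw [Finset.mem_range]
    omega
  have hpos := hs.card_pos
  obtain ⟨i, hi, j, hj, hij, he⟩ := Finset.exists_ne_map_eq_of_card_lt_of_maps_to
    (s := s) (t := Finset.range (s.card - 1)) (by rw [Finset.card_range]; omega) hmaps
  apply hij
  have h1 := hodd i hi
  have h2 := hodd j hj
  have h3 := h.three_le_of_not_two_dvd h1
  have h4 := h.three_le_of_not_two_dvd h2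
  exact h.injOn_odd h1 h2 (by omega)

/-- If all the degrees are coprime, one of them is large enough for interpolation at `n` points. -/
theorem exists_degree_ge (h : AlmostCoprime d) (hn : 2 ≤ n) (hgcd : Finset.univ.gcd d = 1) :
    ∃ l, 2 * n ≤ d l + 1 ∨ 3 ≤ n ∧ 2 * n ≤ d l + 2 ∨
      4 ≤ n ∧ 2 * n ≤ d l + 3 ∧ (∃ j, j ≠ l ∧ 3 ≤ d j) ∨
      n = 3 ∧ d l = 3 ∧ ∀ j, j ≠ l → d j = 2 := by
  classical
  set s := Finset.univ.filter fun i => ¬ 2 ∣ d i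
  have hs : ∀ i ∈ s, ¬ 2 ∣ d i := fun i hi => (Finset.mem_filter.1 hi).2
  have hns : s.card + (Finset.univ.filter fun i => 2 ∣ d i).card = n := by
    rw [add_comm, Finset.card_filter_add_card_filter_not, Finset.card_univ, Fintype.card_fin]
  have hne : s.Nonempty := by
    by_contra hc
    rw [Finset.not_nonempty_iff_eq_empty] at hc
    have : 2 ∣ Finset.univ.gcd d := Finset.dvd_gcd fun i _ => by
      by_contra hi
      have : i ∈ s := by simpa [s] using hi
      simp [hc] at this
    rw [hgcd] at this
    omega
  have heven : (Finset.univ.filter fun i => 2 ∣ d i).card ≤ 2 := by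
    by_contra! hc
    obtain ⟨i, j, k, hi, hj, hk, hij, hik, hjk⟩ := Finset.two_lt_card_iff.1 hc
    rcases h.eq_or_eq_of_two_dvd hij (Finset.mem_filter.1 hi).2 (Finset.mem_filter.1 hj).2
      (Finset.mem_filter.1 hk).2 with h | h
    · exact hik h.symm
    · exact hjk h.symm
  have hpos := hne.card_pos
  obtain ⟨l, hl, hdl⟩ := h.exists_odd_degree_ge hne hs
  -- With at most one even degree the largest odd one is at least 2n - 1; with two even degrees only
  -- 2n - 3 is guaranteed, and n = 3 is treated separately.
  by_cases h1 : n ≤ s.card + 1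
  · exact ⟨l, Or.inl (by omega)⟩
  by_cases hn4 : 4 ≤ n
  · obtain ⟨j, hj, hjl⟩ := Finset.exists_mem_ne (s := s) (by omega) l
    exact ⟨l, Or.inr <| Or.inr <| Or.inl ⟨hn4, by omega, j, hjl,
      h.three_le_of_not_two_dvd (hs j hj)⟩⟩
  have hn3 : n = 3 := by omega
  by_cases hl4 : 4 ≤ d l
  · exact ⟨l, Or.inr <| Or.inl ⟨by omega, by omega⟩⟩
  by_cases hall : ∀ j, j ≠ l → d j = 2
  · exact ⟨l, Or.inr <| Or.inr <| Or.inr ⟨hn3, by omega, hall⟩⟩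
  · push Not at hall
    obtain ⟨j, hjl, hj⟩ := hall
    have hjs : j ∉ s := fun hjs => hjl (Finset.card_le_one.1 (by omega) j hjs l hl)
    have hj2 : 2 ∣ d j := by
      by_contra hc
      exact hjs (Finset.mem_filter.2 ⟨Finset.mem_univ j, hc⟩)
    have := h.two_le j
    exact ⟨j, Or.inr <| Or.inl ⟨by omega, by omega⟩⟩

end AlmostCoprime

namespace HomMap

variable {n : ℕ} {d : Fin n → ℕ}

theorem toMap_smul (F : HomMap d) (c : ℂ) (x : Fin n → ℂ) (j : Fin n) :
    F.toMap (c • x) j = c ^ d j * F.toMap x j :=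
  eval_smul_of_isHomogeneous (F.homogeneous j) c x

theorem toMap_zero (F : HomMap d) (hd : ∀ i, 2 ≤ d i) : F.toMap 0 = 0 := by
  ext j
  have := F.toMap_smul 0 0 j
  rw [zero_smul, zero_pow (by have := hd j; omega), zero_mul] at this
  exact this

/-- Two points of a ray with the same image, provided that the first has at least two nonzero
components. -/
theorem eq_neg_one_of_toMap_smul_eq (hd : AlmostCoprime d) {F : HomMap d} {x : Fin n → ℂ}
    (hx : ∀ l, ∃ j, j ≠ l ∧ F.toMap x j ≠ 0) (i₀ : Fin n) {c : ℂ} (hc : c ≠ 1)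
    (h : F.toMap (c • x) = F.toMap x) :
    ∃ a b, a ≠ b ∧ ¬ Nat.Coprime (d a) (d b) ∧ c = -1 ∧
      ∀ j, j ≠ a → j ≠ b → F.toMap x j = 0 := by
  -- Two nonvanishing components force the order of `c` to divide a gcd at most 2, and a third one
  -- would force it to be 1.
  have hpow : ∀ j, F.toMap x j ≠ 0 → orderOf c ∣ d j := by
    intro j hj
    have h1 := congrFun h j
    rw [toMap_smul] at h1
    exact orderOf_dvd_of_pow_eq_one (mul_right_cancel₀ hj (h1.trans (one_mul _).symm))
  have hc1 : orderOf c ≠ 1 := fun h => hc (orderOf_eq_one_iff.1 h)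
  obtain ⟨a, -, ha⟩ := hx i₀
  obtain ⟨b, hba, hb⟩ := hx a
  have hab : orderOf c ∣ Nat.gcd (d a) (d b) := Nat.dvd_gcd (hpow a ha) (hpow b hb)
  have hcop : ¬ Nat.Coprime (d a) (d b) := fun hcop => by
    rw [hcop.gcd_eq_one, Nat.dvd_one] at hab
    exact hc1 hab
  refine ⟨a, b, hba.symm, hcop, ?_, fun j hja hjb => ?_⟩
  · have h1 := hd.gcd_le_two a b hba.symm
    have h2 : 0 < Nat.gcd (d a) (d b) := Nat.gcd_pos_of_pos_left _ (by
      have := hd.two_le a; omega)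
    have h3 := Nat.le_of_dvd h2 hab
    have h4 : orderOf c ≠ 0 := fun h => by
      rw [h, zero_dvd_iff] at hab
      omega
    have h5 : orderOf c = 2 := by omega
    have h6 := pow_orderOf_eq_one c
    rw [h5, sq] at h6
    exact (mul_self_eq_one_iff.1 h6).resolve_left hc
  · by_contra hj
    have := Nat.dvd_gcd hab (hpow j hj)
    rw [hd.gcd_eq_one a b j hba.symm hja.symm hjb.symm, Nat.dvd_one] at this
    exact hc1 this

end HomMap

/-! ### Elimination over ℚ -/

open Cardinal in
/-- A countable field of characteristic zero embeds into `ℂ`. -/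
theorem nonempty_ringHom_complex (K : Type) [Field K] [CharZero K] [Countable K] :
    Nonempty (K →+* ℂ) := by
  -- Adjoining continuum many variables gives `L` the cardinality of ℂ; algebraically closed fields
  -- of characteristic zero with this cardinality are isomorphic.
  let E := FractionRing (MvPolynomial ℂ K)
  let L := AlgebraicClosure E
  have h1 : #(MvPolynomial ℂ K) = #ℂ := by
    rw [MvPolynomial.cardinalMk_eq_max, Cardinal.mk_complex]
    have : #K ≤ ℵ₀ := Cardinal.mk_le_aleph0
    rw [max_eq_right (this.trans Cardinal.aleph0_le_continuum),
      max_eq_left Cardinal.aleph0_le_continuum]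
  have h2 : #E = #ℂ := by
    rw [← h1]
    exact Cardinal.mk_fractionRing _
  have h3 : #L = #ℂ := by
    apply le_antisymm
    · refine (Algebra.IsAlgebraic.cardinalMk_le_max E L).trans ?_
      rw [h2, Cardinal.mk_complex, max_eq_left Cardinal.aleph0_le_continuum]
    · rw [← h2]
      exact Cardinal.mk_le_of_injective (algebraMap E L).injective
  have : CharZero L := charZero_of_injective_algebraMap
    (((algebraMap E L).comp ((algebraMap (MvPolynomial ℂ K) E).comp C)).injective)
  obtain ⟨e⟩ := IsAlgClosed.ringEquiv_of_equiv_of_charZero (K := L) (L := ℂ)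
    (by rw [h3, Cardinal.mk_complex]; exact Cardinal.aleph0_lt_continuum) (Cardinal.eq.1 h3)
  exact ⟨e.toRingHom.comp ((algebraMap E L).comp ((algebraMap (MvPolynomial ℂ K) E).comp C))⟩

/-- Elimination: if no zero `(a, z)` of a family of polynomials has algebraically independent `a`,
then the first components of all the zeros satisfy a common nontrivial equation. -/
theorem exists_ne_zero_of_forall_not_algebraicIndependent {σ τ : Type} [Countable σ] [Countable τ]
    (P : Set (MvPolynomial (σ ⊕ τ) ℚ))
    (h : ∀ (a : σ → ℂ) (z : τ → ℂ), (∀ p ∈ P, aeval (Sum.elim a z) p = 0) →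
      ¬ AlgebraicIndependent ℚ a) :
    ∃ f : MvPolynomial σ ℚ, f ≠ 0 ∧ ∀ (a : σ → ℂ) (z : τ → ℂ),
      (∀ p ∈ P, aeval (Sum.elim a z) p = 0) → aeval a f = 0 := by
  -- If the ideal contains no nonzero polynomial in the first variables, neither does some prime
  -- above it. Embedding the countable fraction field of the quotient into ℂ gives a zero with
  -- algebraically independent first components.
  by_cases hdis : Disjoint ((Ideal.span P : Ideal _) : Set (MvPolynomial (σ ⊕ τ) ℚ))
    ((nonZeroDivisors (MvPolynomial σ ℚ)).map
      (rename Sum.inl : MvPolynomial σ ℚ →ₐ[ℚ] MvPolynomial (σ ⊕ τ) ℚ) : Submonoid _)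
  · exfalso
    obtain ⟨q, hq, hle, hqd⟩ := Ideal.exists_le_prime_disjoint _ _ hdis
    let A := MvPolynomial (σ ⊕ τ) ℚ ⧸ q
    have : Countable (MvPolynomial (σ ⊕ τ) ℚ) := by
      rw [← Cardinal.mk_le_aleph0_iff]
      refine MvPolynomial.cardinalMk_le_max.trans ?_
      simp
    let K := FractionRing A
    have : Countable A := (Ideal.Quotient.mk_surjective).countable
    have : Countable K := by
      rw [← Cardinal.mk_le_aleph0_iff, Cardinal.mk_fractionRing, Cardinal.mk_le_aleph0_iff]
      infer_instance
    have : CharZero K := charZero_of_injective_algebraMap (algebraMap ℚ K).injective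
    obtain ⟨φ⟩ := nonempty_ringHom_complex K
    let ψ : MvPolynomial (σ ⊕ τ) ℚ →+* ℂ :=
      φ.comp ((algebraMap A K).comp (Ideal.Quotient.mk q))
    have hψ : ∀ p, ψ p = 0 ↔ p ∈ q := by
      intro p
      rw [← Ideal.Quotient.eq_zero_iff_mem]
      simp only [ψ, RingHom.comp_apply, map_eq_zero_iff φ φ.injective,
        map_eq_zero_iff _ (IsFractionRing.injective A K)]
    have hae : ∀ p, aeval (fun s => ψ (X s)) p = ψ p := by
      intro p
      have : (aeval fun s => ψ (X s) : MvPolynomial (σ ⊕ τ) ℚ →ₐ[ℚ] ℂ) = ψ.toRatAlgHom := by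
        ext s
        simp
      rw [this]
      rfl
    have hsum : (Sum.elim (fun s => ψ (X (Sum.inl s))) fun t => ψ (X (Sum.inr t))) =
        fun s => ψ (X s) := by
      ext (s | t) <;> rfl
    refine h (fun s => ψ (X (Sum.inl s))) (fun t => ψ (X (Sum.inr t))) ?_ ?_
    · intro p hp
      rw [hsum, hae, hψ]
      exact hle (Ideal.subset_span hp)
    · rw [algebraicIndependent_iff]
      intro p hp
      by_contra hp0
      have h1 : aeval (fun s => ψ (X s)) (rename Sum.inl p) = 0 := by
        rw [aeval_rename]
        exact hp
      rw [hae, hψ] at h1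
      exact Set.disjoint_left.1 hqd h1 ⟨p, mem_nonZeroDivisors_of_ne_zero hp0, rfl⟩
  · obtain ⟨g, hg, hgs⟩ := Set.not_disjoint_iff.1 hdis
    obtain ⟨f, hf, rfl⟩ := hgs
    refine ⟨f, nonZeroDivisors.ne_zero hf, fun a z haz => ?_⟩
    have h1 : (Ideal.span P : Ideal _) ≤ RingHom.ker (aeval (Sum.elim a z) :
        MvPolynomial (σ ⊕ τ) ℚ →ₐ[ℚ] ℂ) := Ideal.span_le.2 haz
    have h2 : aeval (Sum.elim a z) (rename Sum.inl f) = 0 := h1 hg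
    rwa [aeval_rename] at h2

namespace HomMap

variable {n : ℕ} {d : Fin n → ℕ}

theorem poly_eq_sum_monomial (F : HomMap d) (j : Fin n) :
    F.poly j = ∑ m ∈ monos n (d j), monomial m ((F.poly j).coeff m) := by
  conv_lhs => rw [(F.poly j).as_sum]
  refine Finset.sum_subset (fun m hm => ?_) fun m _ hm => ?_
  · rw [mem_monos]
    by_contra hne
    exact mem_support_iff.1 hm ((F.homogeneous j).coeff_eq_zero hne)
  · rw [notMem_support_iff.1 hm, map_zero]

/-- The map with given coefficients. -/
noncomputable def ofCoeffs (a : (Σ j, monos n (d j)) → ℂ) : HomMap d where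
  poly j := ∑ m : monos n (d j), monomial m (a ⟨j, m⟩)
  homogeneous _ := IsHomogeneous.sum _ _ _ fun m _ =>
    isHomogeneous_monomial _ (mem_monos.1 m.2)

@[simp]
theorem coeffFamily_ofCoeffs (a : (Σ j, monos n (d j)) → ℂ) :
    (ofCoeffs a).coeffFamily = a := by
  classical
  ext ⟨j, m⟩
  simp [ofCoeffs, coeffFamily, coeff_sum, coeff_monomial]

/-- The coefficients of a map, parameters, and the coordinates of points, as one family. -/
def coords {κ ι : Type} (b : HomMap d × (κ → ℂ) × (ι → Fin n → ℂ)) :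
    (κ ⊕ Σ j, monos n (d j)) ⊕ (ι × Fin n) → ℂ :=
  Sum.elim (Sum.elim b.2.1 b.1.coeffFamily) fun q => b.2.2 q.1 q.2

/-- The functions of a map, parameters and points that are polynomials over `ℚ` in the coefficients,
the parameters and the coordinates. -/
noncomputable def polyFuns (d : Fin n → ℕ) (κ ι : Type) :
    Subalgebra ℚ (HomMap d × (κ → ℂ) × (ι → Fin n → ℂ) → ℂ) :=
  (aeval fun s b => coords b s : MvPolynomial ((κ ⊕ Σ j, monos n (d j)) ⊕ (ι × Fin n)) ℚ →ₐ[ℚ]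
    (HomMap d × (κ → ℂ) × (ι → Fin n → ℂ) → ℂ)).range

variable {κ ι : Type}

theorem aeval_coords_apply (p : MvPolynomial ((κ ⊕ Σ j, monos n (d j)) ⊕ (ι × Fin n)) ℚ)
    (b : HomMap d × (κ → ℂ) × (ι → Fin n → ℂ)) :
    (aeval fun s b => coords b s : _ →ₐ[ℚ] (HomMap d × (κ → ℂ) × (ι → Fin n → ℂ) → ℂ)) p b =
      aeval (coords b) p := by
  have : ((Pi.evalAlgHom ℚ (fun _ : HomMap d × (κ → ℂ) × (ι → Fin n → ℂ) => ℂ) b).comp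
      (aeval fun s b => coords b s)) = aeval (coords b) := by
    ext s
    simp
  rw [← this]
  rfl

theorem coords_mem (s : (κ ⊕ Σ j, monos n (d j)) ⊕ (ι × Fin n)) :
    (fun b => coords b s) ∈ polyFuns d κ ι := ⟨X s, by simp⟩

theorem param_mem (k : κ) : (fun b => b.2.1 k) ∈ polyFuns d κ ι := coords_mem (Sum.inl (Sum.inl k))

theorem point_mem (i : ι) (l : Fin n) : (fun b => b.2.2 i l) ∈ polyFuns d κ ι :=
  coords_mem (Sum.inr (i, l))

theorem coeff_mem {j : Fin n} {m : Fin n →₀ ℕ} (hm : m ∈ monos n (d j)) :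
    (fun b => (b.1.poly j).coeff m) ∈ polyFuns d κ ι :=
  coords_mem (Sum.inl (Sum.inr ⟨j, ⟨m, hm⟩⟩))

theorem sum_mem_polyFuns {α : Type*} (s : Finset α)
    {f : α → HomMap d × (κ → ℂ) × (ι → Fin n → ℂ) → ℂ} (h : ∀ a ∈ s, f a ∈ polyFuns d κ ι) :
    (fun b => ∑ a ∈ s, f a b) ∈ polyFuns d κ ι := by
  have := sum_mem h
  convert this using 1
  ext b
  simp

theorem prod_mem_polyFuns {α : Type*} (s : Finset α)
    {f : α → HomMap d × (κ → ℂ) × (ι → Fin n → ℂ) → ℂ} (h : ∀ a ∈ s, f a ∈ polyFuns d κ ι) :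
    (fun b => ∏ a ∈ s, f a b) ∈ polyFuns d κ ι := by
  have := prod_mem h
  convert this using 1
  ext b
  simp

theorem natCast_mem_polyFuns (k : ℕ) : (fun _ => (k : ℂ)) ∈ polyFuns d κ ι :=
  natCast_mem (polyFuns d κ ι) k

theorem intCast_mem_polyFuns (k : ℤ) : (fun _ => (k : ℂ)) ∈ polyFuns d κ ι :=
  intCast_mem (polyFuns d κ ι) k

theorem monomial_mem (i : ι) (m : Fin n →₀ ℕ) {c : HomMap d × (κ → ℂ) × (ι → Fin n → ℂ) → ℂ}
    (hc : c ∈ polyFuns d κ ι) :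
    (fun b => eval (b.2.2 i) (monomial m (c b))) ∈ polyFuns d κ ι := by
  simp only [eval_monomial, Finsupp.prod]
  exact mul_mem hc (prod_mem_polyFuns _ fun l _ => pow_mem (point_mem i l) _)

theorem eval_poly_mem (i : ι) (j : Fin n) :
    (fun b => eval (b.2.2 i) (b.1.poly j)) ∈ polyFuns d κ ι := by
  have : (fun b : HomMap d × (κ → ℂ) × (ι → Fin n → ℂ) => eval (b.2.2 i) (b.1.poly j)) =
      fun b => ∑ m ∈ monos n (d j), eval (b.2.2 i) (monomial m ((b.1.poly j).coeff m)) := by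
    ext b
    conv_lhs => rw [poly_eq_sum_monomial]
    rw [map_sum]
  rw [this]
  exact sum_mem_polyFuns _ fun m hm => monomial_mem i m (coeff_mem hm)

theorem eval_pderiv_mem (i : ι) (j k : Fin n) :
    (fun b => eval (b.2.2 i) (pderiv k (b.1.poly j))) ∈ polyFuns d κ ι := by
  have : (fun b : HomMap d × (κ → ℂ) × (ι → Fin n → ℂ) => eval (b.2.2 i) (pderiv k (b.1.poly j))) =
      fun b : HomMap d × (κ → ℂ) × (ι → Fin n → ℂ) => ∑ m ∈ monos n (d j), eval (b.2.2 i)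
        (monomial (m - Finsupp.single k 1) ((b.1.poly j).coeff m * (m k : ℕ))) := by
    ext b
    conv_lhs => rw [poly_eq_sum_monomial]
    simp_rw [map_sum, pderiv_monomial]
  rw [this]
  refine sum_mem_polyFuns _ fun m hm => monomial_mem i _ ?_
  exact mul_mem (coeff_mem hm) (natCast_mem_polyFuns (m k))

theorem eval_jacobian_mem (i : ι) :
    (fun b => eval (b.2.2 i) b.1.jacobian) ∈ polyFuns d κ ι := by
  simp only [jacobian, Matrix.det_apply', map_sum, map_mul, map_prod, Matrix.of_apply, map_intCast]
  exact sum_mem_polyFuns _ fun σ _ => mul_mem (intCast_mem_polyFuns _)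
    (prod_mem_polyFuns _ fun k _ => eval_pderiv_mem i _ k)

/-- A system of polynomial equations in the coefficients of `F`, parameters `t` and points `z` that
has no solution with algebraically independent `(t, F)` restricts `t` for general `F`. -/
theorem exists_eliminant [Finite κ] [Finite ι]
    {E : Set (HomMap d × (κ → ℂ) × (ι → Fin n → ℂ) → ℂ)} (hE : E ⊆ polyFuns d κ ι)
    (h : ∀ (F : HomMap d) (t : κ → ℂ) (z : ι → Fin n → ℂ),
      AlgebraicIndependent ℚ (Sum.elim t F.coeffFamily) → ¬ ∀ f ∈ E, f (F, t, z) = 0) :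
    ∃ p : MvPolynomial (Σ j, monos n (d j)) ℚ, p ≠ 0 ∧
      ∀ F : HomMap d, aeval F.coeffFamily p ≠ 0 → ∃ g : MvPolynomial κ ℂ, g ≠ 0 ∧
        ∀ t z, (∀ f ∈ E, f (F, t, z) = 0) → eval t g = 0 := by
  have key : ∀ (F : HomMap d) (t : κ → ℂ) (z : ι → Fin n → ℂ),
      (∀ p ∈ {p | (aeval fun s b => coords b s :
        MvPolynomial ((κ ⊕ Σ j, monos n (d j)) ⊕ (ι × Fin n)) ℚ →ₐ[ℚ]
        (HomMap d × (κ → ℂ) × (ι → Fin n → ℂ) → ℂ)) p ∈ E}, aeval (coords (F, t, z)) p = 0) ↔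
      ∀ f ∈ E, f (F, t, z) = 0 := by
    intro F t z
    constructor
    · intro hp f hf
      obtain ⟨p, rfl⟩ := hE hf
      exact (aeval_coords_apply p _).trans (hp p hf)
    · intro hf p hp
      exact (aeval_coords_apply p _).symm.trans (hf _ hp)
  obtain ⟨f, hf0, hf⟩ := exists_ne_zero_of_forall_not_algebraicIndependent
    {p | (aeval fun s b => coords b s :
        MvPolynomial ((κ ⊕ Σ j, monos n (d j)) ⊕ (ι × Fin n)) ℚ →ₐ[ℚ]
        (HomMap d × (κ → ℂ) × (ι → Fin n → ℂ) → ℂ)) p ∈ E} (by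
      intro a z hz hai
      have hc : coords (ofCoeffs (d := d) (a ∘ Sum.inr), a ∘ Sum.inl, fun i l => z (i, l)) =
          Sum.elim a z := by
        ext ((s | s) | s) <;> simp [coords]
      rw [← hc] at hz
      refine h _ _ _ ?_ ((key _ _ _).1 hz)
      rw [coeffFamily_ofCoeffs, Sum.elim_comp_inl_inr]
      exact hai)
  -- The eliminant is read as a polynomial in the parameters over the ring of polynomials in the
  -- coefficients of `F`. Where one chosen nonzero coefficient does not vanish, its specialisation
  -- stays nonzero.
  have hq : sumAlgEquiv ℚ κ (Σ j, monos n (d j)) f ≠ 0 := by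
    rwa [Ne, EmbeddingLike.map_eq_zero_iff]
  obtain ⟨m, hm⟩ := ne_zero_iff.1 hq
  refine ⟨_, hm, fun F hF => ⟨map (aeval F.coeffFamily : _ →ₐ[ℚ] ℂ).toRingHom
    (sumAlgEquiv ℚ κ (Σ j, monos n (d j)) f), ?_, fun t z htz => ?_⟩⟩
  · rw [ne_zero_iff]
    refine ⟨m, ?_⟩
    rw [coeff_map]
    exact hF
  · have h1 : ((aeval (Sum.elim t F.coeffFamily) : _ →ₐ[ℚ] ℂ) : _ →+* ℂ) =
        ((eval t).comp (map (aeval F.coeffFamily : _ →ₐ[ℚ] ℂ).toRingHom)).comp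
          (sumAlgEquiv ℚ κ (Σ j, monos n (d j))).toRingEquiv.toRingHom := by
      apply ringHom_ext
      · intro r
        simp
      · rintro (s | s) <;> simp
    have h2 := hf (Sum.elim t F.coeffFamily) (fun q => z q.1 q.2) ((key F t z).2 htz)
    exact (RingHom.congr_fun h1 f).symm.trans h2

end HomMap

/-! ### Multiple points of the critical set of a generic map -/

theorem AlmostCoprime.exists_third {n : ℕ} {d : Fin n → ℕ} (hd : AlmostCoprime d)
    (hgcd : Finset.univ.gcd d = 1) {a b : Fin n} (hab : a ≠ b)
    (hc : ¬ Nat.Coprime (d a) (d b)) : ∃ l, l ≠ a ∧ l ≠ b ∧ 3 ≤ d l := by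
  obtain ⟨ha, hb⟩ := hd.two_dvd_of_not_coprime hab hc
  obtain ⟨l, hl⟩ : ∃ l, ¬ 2 ∣ d l := by
    by_contra! h
    have : 2 ∣ Finset.univ.gcd d := Finset.dvd_gcd fun i _ => h i
    rw [hgcd] at this
    omega
  exact ⟨l, fun h => hl (h ▸ ha), fun h => hl (h ▸ hb), hd.three_le_of_not_two_dvd hl⟩

theorem Fin.three_le_of_ne {n : ℕ} {a b l : Fin n} (hab : a ≠ b) (hla : l ≠ a) (hlb : l ≠ b) :
    3 ≤ n := by
  have := Finset.card_le_univ ({l, a, b} : Finset (Fin n))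
  rwa [Finset.card_eq_three.2 ⟨l, a, b, hla, hlb, hab, rfl⟩, Fintype.card_fin] at this

namespace HomMap

variable {n : ℕ} {d : Fin n → ℕ}

theorem generic_of_algebraicIndependent_sumElim {F : HomMap d} {κ : Type} {t : κ → ℂ}
    (h : AlgebraicIndependent ℚ (Sum.elim t F.coeffFamily)) : F.Generic :=
  h.comp Sum.inr Sum.inr_injective

/-- The lower bound that contradicts the dimension counts when the parameters occur among the
coordinates of points. -/
theorem le_rk_of_algebraicIndependent_sumElim {F : HomMap d} {κ : Type} [Fintype κ] {t : κ → ℂ}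
    (h : AlgebraicIndependent ℚ (Sum.elim t F.coeffFamily)) {X : Set ℂ} [Finite X]
    (ht : ∀ k, t k ∈ X) :
    numCoeffs d Finset.univ + Fintype.card κ ≤ rk (F.coeffSet Finset.univ ∪ X) := by
  have h1 := rk_range_of_algebraicIndependent h
  rw [Fintype.card_sum, Fintype.card_sigma] at h1
  have h2 : ∑ j, Fintype.card (monos n (d j)) = numCoeffs d Finset.univ := by
    simp [numCoeffs]
  rw [← h2, add_comm, ← h1]
  apply rk_mono
  rintro _ ⟨k | ⟨j, m⟩, rfl⟩
  · exact subset_acl _ (Or.inr (ht k))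
  · exact acl_mono Set.subset_union_left (F.coeff_mem_acl (Finset.mem_univ j) m)

/-- Two critical points of one ray in one fibre, provided that critical points have at least two
nonzero components. -/
theorem eq_neg_of_mem_span (hd : AlmostCoprime d) {F : HomMap d}
    (hF : ∀ x, x ≠ 0 → x ∈ F.critSet → ∀ l, ∃ j, j ≠ l ∧ F.toMap x j ≠ 0) (i₀ : Fin n)
    {x y : Fin n → ℂ} (hx : x ≠ 0) (hxc : x ∈ F.critSet) (hxy : x ≠ y)
    (he : F.toMap x = F.toMap y) (hs : y ∈ Submodule.span ℂ {x}) :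
    ∃ a b, a ≠ b ∧ ¬ Nat.Coprime (d a) (d b) ∧ y = -x ∧
      ∀ j, j ≠ a → j ≠ b → F.toMap x j = 0 := by
  obtain ⟨c, rfl⟩ := Submodule.mem_span_singleton.1 hs
  have hc : c ≠ 1 := by
    rintro rfl
    exact hxy (one_smul ℂ x).symm
  obtain ⟨a, b, hab, hcop, rfl, h0⟩ :=
    eq_neg_one_of_toMap_smul_eq hd (hF x hx hxc) i₀ hc he.symm
  exact ⟨a, b, hab, hcop, by simp, h0⟩

theorem Generic.eq_zero_of_toMap_eq_zero {F : HomMap d} (hF : F.Generic) {x : Fin n → ℂ}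
    (h : F.toMap x = 0) : x = 0 :=
  hF.eq_zero_of_eval_eq_zero (J := Finset.univ) (B := ∅) (by simp) (by simp)
    fun j _ => congrFun h j

theorem isCritFamily_pair {F : HomMap d} {x y : Fin n → ℂ} (hx : x ≠ 0) (hy : y ≠ 0)
    (hxc : x ∈ F.critSet) (hyc : y ∈ F.critSet) (he : F.toMap x = F.toMap y)
    (hs : y ∉ Submodule.span ℂ {x}) : F.IsCritFamily ![x, y] where
  ne_zero i := by fin_cases i <;> simpa
  mem_critSet i := by fin_cases i <;> simpa
  eval_eq i i' j := by
    have := congrFun he j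
    simp only [toMap] at this
    fin_cases i <;> fin_cases i' <;> simp [this]
  notMem_span i j hij := by
    fin_cases i <;> fin_cases j
    · exact absurd rfl hij
    · intro h
      obtain ⟨c, hc⟩ := Submodule.mem_span_singleton.1 h
      have hc : c • y = x := hc
      have hc0 : c ≠ 0 := by
        rintro rfl
        exact hx (by rw [← hc, zero_smul])
      refine hs (Submodule.mem_span_singleton.2 ⟨c⁻¹, ?_⟩)
      rw [← hc, inv_smul_smul₀ hc0]
    · exact hs
    · exact absurd rfl hij

/-- The double points of the critical set have codimension one in it. -/
theorem Generic.rk_of_toMap_eq (hd : AlmostCoprime d) {F : HomMap d} (hF : F.Generic) (hn : 2 ≤ n)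
    (hgcd : Finset.univ.gcd d = 1) {x y : Fin n → ℂ} (hxc : x ∈ F.critSet) (hyc : y ∈ F.critSet)
    (hxy : x ≠ y) (he : F.toMap x = F.toMap y) :
    rk (F.coeffSet Finset.univ ∪ Set.range x) + 1 ≤ numCoeffs d Finset.univ + (n - 1) := by
  classical
  have hx : x ≠ 0 := by
    rintro rfl
    rw [toMap_zero _ hd.two_le] at he
    exact hxy (hF.eq_zero_of_toMap_eq_zero he.symm).symm
  have hy : y ≠ 0 := by
    rintro rfl
    rw [toMap_zero _ hd.two_le] at he
    exact hx (hF.eq_zero_of_toMap_eq_zero he)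
  -- On a common ray the normalised point is algebraic over `F` and the scalar adds one; this is
  -- small enough because the odd degree outside the even pair gives n ≥ 3.
  by_cases hs : y ∈ Submodule.span ℂ {x}
  · obtain ⟨a, b, hab, hcop, -, h0⟩ := eq_neg_of_mem_span hd
      (fun x hx hc l => hF.exists_eval_ne_zero hn hd.two_le hx hc l) ⟨0, by omega⟩ hx hxc hxy he hs
    obtain ⟨l, hla, hlb, -⟩ := hd.exists_third hgcd hab hcop
    have hn3 := Fin.three_le_of_ne hab hla hlb
    obtain ⟨m, hm⟩ := Function.ne_iff.1 hx
    have hm : x m ≠ 0 := hm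
    have h1 := hF.rk_isolated hn hd.two_le (x := (x m)⁻¹ • x) (m := m) (by simp [hm])
      (smul_mem_critSet hxc _) (Z := ({a, b} : Finset (Fin n))ᶜ) (by
        rw [Finset.card_compl, Fintype.card_fin, Finset.card_pair hab]; omega) (fun j hj => by
          simp only [Finset.mem_compl, Finset.mem_insert, Finset.mem_singleton, not_or] at hj
          have := F.toMap_smul (x m)⁻¹ x j
          rwa [h0 j hj.1 hj.2, mul_zero] at this)
    have h2 := rk_le_add_card (S := F.coeffSet Finset.univ ∪ Set.range ((x m)⁻¹ • x))
      (T := F.coeffSet Finset.univ ∪ Set.range x) (fun _ : Unit => (x m)⁻¹) (by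
        refine Set.union_subset ((Set.subset_union_left.trans Set.subset_union_left).trans
          (subset_acl _)) (range_subset_acl_of_smul (inv_ne_zero hm) fun k => ?_)
        exact subset_acl _ (Or.inr ⟨k, rfl⟩))
    rw [Fintype.card_unit] at h2
    omega
  · obtain ⟨l, hl⟩ : ∃ l, 3 ≤ d l := by
      obtain ⟨l, hl⟩ := hd.exists_degree_ge hn hgcd
      exact ⟨l, by omega⟩
    exact hF.rk_pair hn hd.two_le hl (isCritFamily_pair hx hy hxc hyc he hs) 0

/-- There are no `n` critical points in one fibre. -/
theorem Generic.not_injective (hd : AlmostCoprime d) {F : HomMap d} (hF : F.Generic) (hn : 2 ≤ n)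
    (hgcd : Finset.univ.gcd d = 1) {x : Fin n → Fin n → ℂ} (hxc : ∀ i, x i ∈ F.critSet)
    (he : ∀ i j, F.toMap (x i) = F.toMap (x j)) : ¬ Function.Injective x := by
  classical
  intro hinj
  have : Nontrivial (Fin n) := Fin.nontrivial_iff_two_le.2 hn
  have hx : ∀ i, x i ≠ 0 := by
    intro i hi
    obtain ⟨j, hj⟩ := exists_ne i
    apply hj
    apply hinj
    rw [hi]
    apply hF.eq_zero_of_toMap_eq_zero
    rw [he j i, hi, toMap_zero _ hd.two_le]
  have hB : ∀ x, x ≠ 0 → x ∈ F.critSet → ∀ l, ∃ j, j ≠ l ∧ F.toMap x j ≠ 0 :=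
    fun x hx hc l => hF.exists_eval_ne_zero hn hd.two_le hx hc l
  by_cases h : ∀ i j, i ≠ j → x i ∉ Submodule.span ℂ {x j}
  · obtain ⟨l, hl⟩ := hd.exists_degree_ge hn hgcd
    exact hF.not_isCritFamily hn hd.two_le hl ⟨hx, h, hxc, fun i j k => congrFun (he i j) k⟩
  -- Two of the points are opposite on a ray where all but two components vanish. As n ≥ 3 there is
  -- a third point; it cannot lie on this ray, and no other critical ray shares its values.
  · push Not at h
    obtain ⟨i, j, hij, hs⟩ := h
    obtain ⟨a, b, hab, hcop, hi, h0⟩ := eq_neg_of_mem_span hd hB i (hx j) (hxc j)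
      (hinj.ne hij.symm) (he j i) hs
    obtain ⟨l, hla, hlb, hl⟩ := hd.exists_third hgcd hab hcop
    have hn3 := Fin.three_le_of_ne hab hla hlb
    obtain ⟨k, -, hk⟩ := Finset.exists_mem_notMem_of_card_lt_card (s := {i, j})
      (t := Finset.univ) (by
        rw [Finset.card_pair hij, Finset.card_univ, Fintype.card_fin]; omega)
    simp only [Finset.mem_insert, Finset.mem_singleton, not_or] at hk
    by_cases hks : x k ∈ Submodule.span ℂ {x j}
    · obtain ⟨_, _, -, -, hk', -⟩ := eq_neg_of_mem_span hd hB i (hx j) (hxc j)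
        (hinj.ne (Ne.symm hk.2)) (he j k) hks
      exact hk.1 (hinj (hk'.trans hi.symm))
    · obtain ⟨p, hpa, hpb, hp⟩ := hF.exists_eval_ne_zero_of_pair hn hd.two_le hl hab hla hlb
        (isCritFamily_pair (hx j) (hx k) (hxc j) (hxc k) (he j k) hks)
      exact hp (h0 p hpa hpb)

end HomMap

/-! ### From generic maps to all maps outside a hypersurface -/

/-- Rabinowitsch's trick: an inequation becomes an equation with an auxiliary point, as the
elimination lemma requires. -/
theorem exists_sum_mul_eq_one_iff {n : ℕ} {x : Fin n → ℂ} :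
    (∃ w : Fin n → ℂ, ∑ l, w l * x l = 1) ↔ x ≠ 0 := by
  classical
  constructor
  · rintro ⟨w, hw⟩ rfl
    simp at hw
  · intro hx
    obtain ⟨m, hm⟩ := Function.ne_iff.1 hx
    exact ⟨Pi.single m (x m)⁻¹, by simp [Pi.single_apply, show x m ≠ 0 from hm]⟩

theorem finite_setOf_eval_eq_zero {g : MvPolynomial Unit ℂ} (hg : g ≠ 0) :
    {c : ℂ | eval (fun _ => c) g = 0}.Finite := by
  have h0 : (uniqueAlgEquiv ℂ Unit) g ≠ 0 := by
    rwa [Ne, EmbeddingLike.map_eq_zero_iff]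
  refine (Polynomial.finite_setOfPred_isRoot h0).subset fun c hc => ?_
  have : ((Polynomial.evalRingHom c).comp
      (uniqueAlgEquiv ℂ Unit).toRingEquiv.toRingHom) = eval fun _ => c := by
    apply ringHom_ext <;> simp
  exact (RingHom.congr_fun this g).trans hc

namespace HomMap

variable {n : ℕ} {d : Fin n → ℕ}

/-- `P` holds for all maps outside a hypersurface defined over `ℚ`. -/
def HoldsGenerally (P : HomMap d → Prop) : Prop :=
  ∃ p : MvPolynomial (Σ j, monos n (d j)) ℚ, p ≠ 0 ∧
    ∀ F : HomMap d, aeval F.coeffFamily p ≠ 0 → P F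

theorem HoldsGenerally.mono {P Q : HomMap d → Prop} (h : HoldsGenerally P)
    (hPQ : ∀ F, P F → Q F) : HoldsGenerally Q := by
  obtain ⟨p, hp, hP⟩ := h
  exact ⟨p, hp, fun F hF => hPQ F (hP F hF)⟩

theorem HoldsGenerally.forall {α : Type*} [Finite α] {P : α → HomMap d → Prop}
    (h : ∀ a, HoldsGenerally (P a)) : HoldsGenerally fun F => ∀ a, P a F := by
  have := Fintype.ofFinite α
  choose p hp hP using h
  refine ⟨∏ a, p a, Finset.prod_ne_zero_iff.2 fun a _ => hp a, fun F hF a => hP a F fun h0 => hF ?_⟩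
  rw [map_prod]
  exact Finset.prod_eq_zero (Finset.mem_univ a) h0

theorem HoldsGenerally.and {P Q : HomMap d → Prop} (hP : HoldsGenerally P)
    (hQ : HoldsGenerally Q) : HoldsGenerally fun F => P F ∧ Q F := by
  obtain ⟨p, hp, hP⟩ := hP
  obtain ⟨q, hq, hQ⟩ := hQ
  refine ⟨p * q, mul_ne_zero hp hq, fun F hF => ?_⟩
  rw [map_mul] at hF
  exact ⟨hP F (left_ne_zero_of_mul hF), hQ F (right_ne_zero_of_mul hF)⟩

theorem HoldsGenerally.imp {a : Prop} {P : HomMap d → Prop} (h : a → HoldsGenerally P) :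
    HoldsGenerally fun F => a → P F := by
  by_cases ha : a
  · exact (h ha).mono fun _ hF _ => hF
  · exact ⟨1, one_ne_zero, fun _ _ h => absurd h ha⟩

theorem toMap_mem {κ ι : Type} (i : ι) (j : Fin n) :
    (fun b => b.1.toMap (b.2.2 i) j) ∈ polyFuns d κ ι := eval_poly_mem i j

theorem witness_mem {κ ι : Type} (w : ι) {x : Fin n → HomMap d × (κ → ℂ) × (ι → Fin n → ℂ) → ℂ}
    (hx : ∀ l, x l ∈ polyFuns d κ ι) :
    (fun b => ∑ l, b.2.2 w l * x l b - 1) ∈ polyFuns d κ ι :=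
  sub_mem (sum_mem_polyFuns _ fun l _ => mul_mem (point_mem w l) (hx l)) (one_mem _)

/-- Without parameters the eliminant is a nonzero constant, so the system has no solution at all. -/
theorem holdsGenerally_of_forall_ne {ι : Type} [Finite ι]
    {E : Set (HomMap d × (Empty → ℂ) × (ι → Fin n → ℂ) → ℂ)} (hE : E ⊆ polyFuns d Empty ι)
    (h : ∀ (F : HomMap d) (z : ι → Fin n → ℂ), F.Generic → ¬ ∀ f ∈ E, f (F, Empty.elim, z) = 0) :
    HoldsGenerally fun F : HomMap d =>
      ∀ z : ι → Fin n → ℂ, ¬ ∀ f ∈ E, f (F, Empty.elim, z) = 0 := by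
  obtain ⟨p, hp, hP⟩ := exists_eliminant hE (fun F t z ht => by
    rw [Subsingleton.elim t Empty.elim]
    exact h F z (generic_of_algebraicIndependent_sumElim ht))
  refine ⟨p, hp, fun F hF z hz => ?_⟩
  obtain ⟨g, hg, hG⟩ := hP F hF
  have h1 := hG _ z hz
  rw [eq_C_of_isEmpty g] at h1 hg
  rw [eval_C] at h1
  exact hg (by rw [h1, C_0])

theorem holdsGenerally_preimage_zero (hd : AlmostCoprime d) :
    HoldsGenerally fun F : HomMap d => F.toMap ⁻¹' {0} = {0} := by
  refine (holdsGenerally_of_forall_ne (ι := Fin 2)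
    (E := insert (fun b => ∑ l, b.2.2 1 l * b.2.2 0 l - 1)
      (Set.range fun j b => b.1.toMap (b.2.2 0) j)) ?_ ?_).mono ?_
  · rintro f (rfl | ⟨j, rfl⟩)
    · exact witness_mem 1 fun l => point_mem 0 l
    · exact toMap_mem 0 j
  · intro F z hF hz
    simp only [Set.forall_mem_insert, Set.forall_mem_range, sub_eq_zero] at hz
    exact exists_sum_mul_eq_one_iff.1 ⟨_, hz.1⟩ (hF.eq_zero_of_toMap_eq_zero (funext hz.2))
  · intro F hF
    ext x
    simp only [Set.mem_preimage, Set.mem_singleton_iff]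
    constructor
    · intro hx
      by_contra hx0
      obtain ⟨w, hw⟩ := exists_sum_mul_eq_one_iff.2 hx0
      apply hF ![x, w]
      simp only [Set.forall_mem_insert, Set.forall_mem_range, sub_eq_zero]
      exact ⟨hw, fun j => congrFun hx j⟩
    · rintro rfl
      exact toMap_zero F hd.two_le

theorem holdsGenerally_exists_toMap_ne_zero (hd : AlmostCoprime d) (hn : 2 ≤ n) :
    HoldsGenerally fun F : HomMap d =>
      ∀ x, x ≠ 0 → x ∈ F.critSet → ∀ l, ∃ j, j ≠ l ∧ F.toMap x j ≠ 0 := by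
  refine (HoldsGenerally.forall (P := fun l F => ∀ x, x ≠ 0 → x ∈ F.critSet →
    ∃ j, j ≠ l ∧ F.toMap x j ≠ 0) fun l => ?_).mono fun F hF x hx hc l => hF l x hx hc
  refine (holdsGenerally_of_forall_ne (ι := Fin 2)
    (E := insert (fun b => ∑ l, b.2.2 1 l * b.2.2 0 l - 1)
      (insert (fun b => eval (b.2.2 0) b.1.jacobian)
      (Set.range fun (j : {j // j ≠ l}) b => b.1.toMap (b.2.2 0) j))) ?_ ?_).mono ?_
  · rintro f (rfl | rfl | ⟨j, rfl⟩)
    · exact witness_mem 1 fun l => point_mem 0 l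
    · exact eval_jacobian_mem 0
    · exact toMap_mem 0 j.1
  · intro F z hF hz
    simp only [Set.forall_mem_insert, Set.forall_mem_range, sub_eq_zero] at hz
    obtain ⟨j, hj, hj0⟩ := hF.exists_eval_ne_zero hn hd.two_le
      (exists_sum_mul_eq_one_iff.1 ⟨_, hz.1⟩) hz.2.1 l
    exact hj0 (hz.2.2 ⟨j, hj⟩)
  · intro F hF x hx hc
    by_contra! h0
    obtain ⟨w, hw⟩ := exists_sum_mul_eq_one_iff.2 hx
    apply hF ![x, w]
    simp only [Set.forall_mem_insert, Set.forall_mem_range, sub_eq_zero]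
    exact ⟨hw, hc, fun j => h0 j j.2⟩

theorem holdsGenerally_finite_normalized (hd : AlmostCoprime d) (hn : 2 ≤ n) :
    HoldsGenerally fun F : HomMap d => ∀ a b, a ≠ b → ∀ l, {x | x l = 1 ∧ x ∈ F.critSet ∧
      ∀ j, j ≠ a → j ≠ b → F.toMap x j = 0}.Finite := by
  refine (HoldsGenerally.forall (P := fun a F => ∀ b, a ≠ b → ∀ l, {x | x l = 1 ∧ x ∈ F.critSet ∧
      ∀ j, j ≠ a → j ≠ b → F.toMap x j = 0}.Finite) fun a => HoldsGenerally.forall fun b =>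
    HoldsGenerally.imp fun hab => HoldsGenerally.forall fun l => ?_)
  -- Finiteness is checked one coordinate at a time: taken as the only parameter, the coordinate is
  -- never independent of `F`, so it satisfies an equation in one variable.
  suffices h : HoldsGenerally fun F : HomMap d => ∀ m, {c | ∃ x, x m = c ∧ x l = 1 ∧ x ∈ F.critSet ∧
      ∀ j, j ≠ a → j ≠ b → F.toMap x j = 0}.Finite from h.mono fun F hF =>
    (Set.Finite.pi' hF).subset fun x hx m => ⟨x, rfl, hx⟩
  refine HoldsGenerally.forall fun m => ?_
  obtain ⟨p, hp, hP⟩ := exists_eliminant (d := d) (κ := Unit) (ι := Unit)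
    (E := insert (fun b => b.2.2 () m - b.2.1 ()) (insert (fun b => b.2.2 () l - 1)
      (insert (fun b => eval (b.2.2 ()) b.1.jacobian)
      (Set.range fun (j : {j // j ≠ a ∧ j ≠ b}) b => b.1.toMap (b.2.2 ()) j)))) (by
    rintro f (rfl | rfl | rfl | ⟨j, rfl⟩)
    · exact sub_mem (point_mem () m) (param_mem ())
    · exact sub_mem (point_mem () l) (one_mem _)
    · exact eval_jacobian_mem ()
    · exact toMap_mem () j.1) (by
    intro F t z ht hz
    simp only [Set.forall_mem_insert, Set.forall_mem_range, sub_eq_zero] at hz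
    have h1 := (generic_of_algebraicIndependent_sumElim ht).rk_isolated hn hd.two_le hz.2.1
      hz.2.2.1 (Z := ({a, b} : Finset (Fin n))ᶜ) (by
        rw [Finset.card_compl, Fintype.card_fin, Finset.card_pair hab]; omega) (fun j hj => by
          simp only [Finset.mem_compl, Finset.mem_insert, Finset.mem_singleton, not_or] at hj
          exact hz.2.2.2 ⟨j, hj⟩)
    have h2 := le_rk_of_algebraicIndependent_sumElim ht (X := Set.range (z ()))
      fun k => ⟨m, hz.1⟩
    rw [Fintype.card_unit] at h2
    omega)
  refine ⟨p, hp, fun F hF => ?_⟩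
  obtain ⟨g, hg, hG⟩ := hP F hF
  refine (finite_setOf_eval_eq_zero hg).subset ?_
  rintro c ⟨x, hxc, hx⟩
  refine hG (fun _ => c) (fun _ => x) ?_
  simp only [Set.forall_mem_insert, Set.forall_mem_range, sub_eq_zero]
  exact ⟨hxc, hx.1, hx.2.1, fun j => hx.2.2 j j.2.1 j.2.2⟩

/-- A double point has rank at most n - 2 over the coefficients, so no n - 1 of its coordinates are
independent of them. -/
theorem holdsGenerally_double_points (hd : AlmostCoprime d) (hn : 2 ≤ n)
    (hgcd : Finset.univ.gcd d = 1) :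
    HoldsGenerally fun F : HomMap d => ∀ I : Finset (Fin n), I.card = n - 1 →
      ∃ g : MvPolynomial I ℂ, g ≠ 0 ∧ ∀ x y, x ∈ F.critSet → y ∈ F.critSet → x ≠ y →
        F.toMap x = F.toMap y → eval (fun i : I => x i) g = 0 := by
  refine HoldsGenerally.forall fun I => HoldsGenerally.imp fun hI => ?_
  obtain ⟨p, hp, hP⟩ := exists_eliminant (d := d) (κ := I) (ι := Fin 3)
    (E := insert (fun b => ∑ l, b.2.2 2 l * (b.2.2 0 l - b.2.2 1 l) - 1)
      (insert (fun b => eval (b.2.2 0) b.1.jacobian) (insert (fun b => eval (b.2.2 1) b.1.jacobian)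
      ((Set.range fun j b => b.1.toMap (b.2.2 0) j - b.1.toMap (b.2.2 1) j) ∪
        Set.range fun i b => b.2.2 0 i.1 - b.2.1 i)))) (by
    rintro f (rfl | rfl | rfl | ⟨j, rfl⟩ | ⟨i, rfl⟩)
    · exact witness_mem 2 fun l => sub_mem (point_mem 0 l) (point_mem 1 l)
    · exact eval_jacobian_mem 0
    · exact eval_jacobian_mem 1
    · exact sub_mem (toMap_mem 0 j) (toMap_mem 1 j)
    · exact sub_mem (point_mem 0 i.1) (param_mem i)) (by
    intro F t z ht hz
    simp only [Set.forall_mem_insert, Set.mem_union, or_imp, forall_and, Set.forall_mem_range,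
      sub_eq_zero] at hz
    have h1 := (generic_of_algebraicIndependent_sumElim ht).rk_of_toMap_eq hd hn hgcd hz.2.1
      hz.2.2.1 (fun h => exists_sum_mul_eq_one_iff.1 ⟨_, hz.1⟩ (by ext l; simp [h]))
      (funext hz.2.2.2.1)
    have h2 := le_rk_of_algebraicIndependent_sumElim ht (X := Set.range (z 0))
      fun k => ⟨k, hz.2.2.2.2 k⟩
    rw [Fintype.card_coe] at h2
    omega)
  refine ⟨p, hp, fun F hF => ?_⟩
  obtain ⟨g, hg, hG⟩ := hP F hF
  refine ⟨g, hg, fun x y hx hy hxy he => ?_⟩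
  obtain ⟨w, hw⟩ := exists_sum_mul_eq_one_iff.2 (sub_ne_zero.2 hxy)
  refine hG (fun i => x i) ![x, y, w] ?_
  simp only [Set.forall_mem_insert, Set.mem_union, or_imp, forall_and, Set.forall_mem_range,
      sub_eq_zero]
  exact ⟨hw, hx, hy, fun j => congrFun he j, fun i => rfl⟩

theorem holdsGenerally_not_injective (hd : AlmostCoprime d) (hn : 2 ≤ n)
    (hgcd : Finset.univ.gcd d = 1) :
    HoldsGenerally fun F : HomMap d => ∀ x : Fin n → Fin n → ℂ, (∀ i, x i ∈ F.critSet) →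
      (∀ i j, F.toMap (x i) = F.toMap (x j)) → ¬ Function.Injective x := by
  refine (holdsGenerally_of_forall_ne (ι := Fin n ⊕ {q : Fin n × Fin n // q.1 ≠ q.2})
    (E := (Set.range fun i b => eval (b.2.2 (Sum.inl i)) b.1.jacobian) ∪
      ((Set.range fun (q : Fin n × Fin n × Fin n) b => b.1.toMap (b.2.2 (Sum.inl q.1)) q.2.2 -
        b.1.toMap (b.2.2 (Sum.inl q.2.1)) q.2.2) ∪
      Set.range fun (q : {q : Fin n × Fin n // q.1 ≠ q.2}) b => ∑ l, b.2.2 (Sum.inr q) l *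
        (b.2.2 (Sum.inl q.1.1) l - b.2.2 (Sum.inl q.1.2) l) - 1)) ?_ ?_).mono ?_
  · rintro f (⟨i, rfl⟩ | ⟨q, rfl⟩ | ⟨q, rfl⟩)
    · exact eval_jacobian_mem _
    · exact sub_mem (toMap_mem _ _) (toMap_mem _ _)
    · exact witness_mem _ fun l => sub_mem (point_mem _ l) (point_mem _ l)
  · intro F z hF hz
    simp only [Set.mem_union, or_imp, forall_and, Set.forall_mem_range, sub_eq_zero] at hz
    have h0 : ∀ i j k, F.toMap (z (Sum.inl i)) k = F.toMap (z (Sum.inl j)) k := fun i j k =>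
      hz.2.1 (i, j, k)
    refine hF.not_injective hd hn hgcd (x := fun i => z (Sum.inl i)) hz.1
      (fun i j => funext (h0 i j)) ?_
    intro i j hij
    by_contra hne
    have h1 := hz.2.2 ⟨(i, j), hne⟩
    have h2 : z (Sum.inl i) = z (Sum.inl j) := hij
    simp [h2] at h1
  · intro F hF x hx he hinj
    have hw : ∀ q : {q : Fin n × Fin n // q.1 ≠ q.2},
        ∃ w : Fin n → ℂ, ∑ l, w l * (x q.1.1 - x q.1.2) l = 1 := fun q =>
      exists_sum_mul_eq_one_iff.2 (sub_ne_zero.2 (hinj.ne q.2))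
    choose w hw using hw
    apply hF (Sum.elim x w)
    simp only [Set.mem_union, or_imp, forall_and, Set.forall_mem_range, sub_eq_zero]
    exact ⟨hx, fun q => congrFun (he q.1 q.2.1) _, hw⟩

end HomMap

/-! ### Codimension two in the Zariski topology -/

theorem isClosed_zariski_iff {ι : Type*} {Z : Set (ι → ℂ)} :
    @IsClosed _ (zariski ι) Z ↔ ∃ S : Set (MvPolynomial ι ℂ), Z = zeroSet S := by
  rw [← @isOpen_compl_iff _ _ (zariski ι)]
  change Zᶜᶜ ∈ _ ↔ _
  rw [compl_compl]
  rfl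

theorem isClosed_zeroSet {ι : Type*} (S : Set (MvPolynomial ι ℂ)) :
    @IsClosed _ (zariski ι) (zeroSet S) := isClosed_zariski_iff.2 ⟨S, rfl⟩

theorem exists_degreeOf_ne_zero_of_irreducible {σ : Type*} {f : MvPolynomial σ ℂ}
    (hf : Irreducible f) :
    ∃ i, f.degreeOf i ≠ 0 := by
  by_contra! h
  have h1 : f.vars = ∅ := by
    rw [Finset.eq_empty_iff_forall_notMem]
    intro i hi
    exact mem_vars_iff_degreeOf_ne_zero.1 hi (h i)
  rw [vars_eq_empty_iff_eq_C] at h1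
  have h2 : f.coeff 0 ≠ 0 := fun h0 => hf.ne_zero (by rw [h1, h0, C_0])
  refine hf.not_isUnit ?_
  rw [h1]
  exact (isUnit_iff_ne_zero.2 h2).map C

/-- A prime ideal containing, for every variable, a nonzero polynomial that does not involve this
variable has height at least two. -/
theorem two_le_height_of_degreeOf_eq_zero {σ : Type*} [Nonempty σ]
    {p : PrimeSpectrum (MvPolynomial σ ℂ)}
    (h : ∀ i, ∃ g ∈ p.asIdeal, g ≠ 0 ∧ g.degreeOf i = 0) : 2 ≤ Order.height p := by
  obtain ⟨i₀⟩ := ‹Nonempty σ›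
  obtain ⟨g, hgp, hg0, -⟩ := h i₀
  -- The chain will be 0 < (f) < p. It is strict because `f` involves some variable, and a nonzero
  -- element of `p` free of that variable is no multiple of `f`.
  obtain ⟨f, hf, hfp⟩ : ∃ f, Irreducible f ∧ f ∈ p.asIdeal := by
    induction g using WfDvdMonoid.induction_on_irreducible with
    | zero => exact absurd rfl hg0
    | unit u hu => exact absurd (Ideal.eq_top_of_isUnit_mem _ hgp hu) p.isPrime.ne_top
    | mul a i ha hi ih =>
      rcases p.isPrime.mem_or_mem hgp with h | h
      · exact ⟨i, hi, h⟩
      · exact ih h ha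
  obtain ⟨i, hi⟩ := exists_degreeOf_ne_zero_of_irreducible hf
  obtain ⟨g, hgp, hg0, hgi⟩ := h i
  have hfg : ¬ f ∣ g := by
    rintro ⟨q, rfl⟩
    rw [degreeOf_mul_eq hf.ne_zero (right_ne_zero_of_mul hg0)] at hgi
    omega
  let q : PrimeSpectrum (MvPolynomial σ ℂ) :=
    ⟨Ideal.span {f}, (Ideal.span_singleton_prime hf.ne_zero).2 hf.prime⟩
  let b : PrimeSpectrum (MvPolynomial σ ℂ) := ⟨⊥, Ideal.isPrime_bot⟩
  have h1 : b < q := by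
    refine lt_of_le_of_ne (show (⊥ : Ideal _) ≤ _ from bot_le) fun he => hf.ne_zero ?_
    have : f ∈ b.asIdeal := by
      rw [he]
      exact Ideal.mem_span_singleton_self f
    exact this
  have h2 : q < p := by
    refine lt_of_le_of_ne (show q.asIdeal ≤ p.asIdeal from
      (Ideal.span_singleton_le_iff_mem _).2 hfp) fun he => hfg ?_
    rw [← he] at hgp
    exact Ideal.mem_span_singleton.1 hgp
  have h3 := Order.height_add_one_le h1
  have h4 := Order.height_add_one_le h2
  calc (2 : ℕ∞) ≤ Order.height b + 1 + 1 := by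
        rw [add_assoc, one_add_one_eq_two]
        exact le_add_self
    _ ≤ Order.height q + 1 := by gcongr
    _ ≤ Order.height p := h4

theorem isClosed_induced_zariski_iff {ι : Type*} {Z : Set (ι → ℂ)} [t : TopologicalSpace Z]
    (ht : t = TopologicalSpace.induced Subtype.val (zariski ι)) {C : Set Z} :
    IsClosed C ↔ ∃ S, C = Subtype.val ⁻¹' zeroSet S := by
  subst ht
  rw [@isClosed_induced_iff _ _ (zariski ι)]
  constructor
  · rintro ⟨T, hT, rfl⟩
    obtain ⟨S, rfl⟩ := isClosed_zariski_iff.1 hT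
    exact ⟨S, rfl⟩
  · rintro ⟨S, rfl⟩
    exact ⟨_, isClosed_zeroSet S, rfl⟩

/-- The ideal of polynomials vanishing on an irreducible closed subset. -/
noncomputable def primeOfIrreducible {ι : Type*} {Z : Set (ι → ℂ)} [t : TopologicalSpace Z]
    (ht : t = TopologicalSpace.induced Subtype.val (zariski ι))
    (W : TopologicalSpace.IrreducibleCloseds Z) : PrimeSpectrum (MvPolynomial ι ℂ) where
  asIdeal := vanishingIdeal ℂ (Subtype.val '' W.carrier)
  isPrime := by
    constructor
    · intro h
      obtain ⟨x, hx⟩ := W.isIrreducible'.1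
      have h1 : (1 : MvPolynomial ι ℂ) ∈ vanishingIdeal ℂ (Subtype.val '' W.carrier) := by
        rw [h]
        trivial
      have := h1 x.1 ⟨x, hx, rfl⟩
      simp at this
    · intro p q hpq
      have hc : ∀ p : MvPolynomial ι ℂ, IsClosed {x : Z | eval x.1 p = 0} := fun p =>
        (isClosed_induced_zariski_iff ht).2 ⟨{p}, by ext x; simp [zeroSet]⟩
      have := isPreirreducible_iff_isClosed_union_isClosed.1 W.isIrreducible'.2 _ _ (hc p) (hc q)
        (fun x hx => by
          have := hpq x.1 ⟨x, hx, rfl⟩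
          rw [aeval_eq_eval, map_mul] at this
          exact mul_eq_zero.1 this)
      refine this.imp ?_ ?_ <;>
      · rintro h _ ⟨x, hx, rfl⟩
        rw [aeval_eq_eval]
        exact h hx

/-- A closed set is recovered from its vanishing ideal, so chains of irreducible sets give strict
chains of primes. -/
theorem primeOfIrreducible_lt {ι : Type*} {Z : Set (ι → ℂ)} [t : TopologicalSpace Z]
    (ht : t = TopologicalSpace.induced Subtype.val (zariski ι))
    {V W : TopologicalSpace.IrreducibleCloseds Z} (h : V < W) :
    primeOfIrreducible ht W < primeOfIrreducible ht V := by
  have hVW : V.carrier ⊆ W.carrier := h.le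
  refine lt_of_le_not_ge (vanishingIdeal_anti_mono (Set.image_mono hVW)) fun hle => h.not_ge ?_
  obtain ⟨S, hS⟩ := (isClosed_induced_zariski_iff ht).1 V.isClosed'
  intro x hx
  change x ∈ V.carrier
  rw [hS]
  intro p hp
  have h1 : p ∈ (primeOfIrreducible ht V).asIdeal := by
    rintro _ ⟨y, hy, rfl⟩
    rw [aeval_eq_eval]
    rw [hS] at hy
    exact hy p hp
  have h2 := hle h1 x.1 ⟨x, hx, rfl⟩
  rwa [aeval_eq_eval] at h2

/-- An algebraic set on which any `n - 1` coordinates are dependent has codimension at least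
two. -/
theorem zariskiDim_le_of_degreeOf_eq_zero {n : ℕ} (hn : 2 ≤ n) {Z : Set (Fin n → ℂ)}
    (h : ∀ i, ∃ g : MvPolynomial (Fin n) ℂ, g ≠ 0 ∧ g.degreeOf i = 0 ∧ ∀ x ∈ Z, eval x g = 0) :
    zariskiDim Z ≤ ((n - 2 : ℕ) : WithBot ℕ∞) := by
  let t : TopologicalSpace Z := TopologicalSpace.induced Subtype.val (zariski (Fin n))
  have ht : t = TopologicalSpace.induced Subtype.val (zariski (Fin n)) := rfl
  have : Nonempty (Fin n) := ⟨⟨0, by omega⟩⟩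
  refine iSup_le fun s => ?_
  let Φ : TopologicalSpace.IrreducibleCloseds Z → (PrimeSpectrum (MvPolynomial (Fin n) ℂ))ᵒᵈ :=
    fun W => OrderDual.toDual (primeOfIrreducible ht W)
  have hΦ : StrictMono Φ := fun V W hVW => primeOfIrreducible_lt ht hVW
  have h1 : (s.length : ℕ∞) ≤ Order.coheight (primeOfIrreducible ht s.last) :=
    Order.length_le_height_last (p := s.map Φ hΦ)
  have h2 : 2 ≤ Order.height (primeOfIrreducible ht s.last) := by
    refine two_le_height_of_degreeOf_eq_zero fun i => ?_
    obtain ⟨g, hg0, hgi, hg⟩ := h i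
    refine ⟨g, ?_, hg0, hgi⟩
    rintro _ ⟨x, -, rfl⟩
    rw [aeval_eq_eval]
    exact hg x.1 x.2
  have h3 : ringKrullDim (MvPolynomial (Fin n) ℂ) = (n : ℕ) := by
    rw [MvPolynomial.ringKrullDim_of_isNoetherianRing, ringKrullDim_eq_zero_of_field]
    simp
  -- Height plus coheight is at most n. The prime of the largest set of the chain has height at
  -- least 2, and the length of the chain is at most its coheight.
  rw [ringKrullDim, Order.krullDim_eq_iSup_height_add_coheight_of_nonempty] at h3
  have h4 := (le_iSup (fun a : PrimeSpectrum (MvPolynomial (Fin n) ℂ) =>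
    Order.height a + Order.coheight a) (primeOfIrreducible ht s.last)).trans_eq
    (WithBot.coe_injective h3)
  have h5 : (2 : ℕ∞) + s.length ≤ (n : ℕ) := (add_le_add h2 h1).trans h4
  have h6 : 2 + s.length ≤ n := by exact_mod_cast h5
  have h7 : s.length ≤ n - 2 := by omega
  exact_mod_cast h7

/-! ### The dense open set, and the conclusions on rays and fibres -/

namespace HomMap

variable {n : ℕ} {d : Fin n → ℕ}

/-- The position of a coefficient of a form among all the coefficients. -/
def coeffIndex (s : Σ j, monos n (d j)) : Fin n × (Fin n →₀ ℕ) := (s.1, s.2)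

theorem eval_coeffs_rename (F : HomMap d) (p : MvPolynomial (Σ j, monos n (d j)) ℚ) :
    eval F.coeffs (map (algebraMap ℚ ℂ) (rename coeffIndex p)) = aeval F.coeffFamily p := by
  rw [eval_map, ← aeval_def, aeval_rename]
  rfl

open Classical in
/-- A polynomial in all the coefficients, restricted to the maps of the given degrees. -/
noncomputable def restrictCoeffs (d : Fin n → ℕ) (q : MvPolynomial (Fin n × (Fin n →₀ ℕ)) ℂ) :
    MvPolynomial (Σ j, monos n (d j)) ℂ :=
  aeval (fun s : Fin n × (Fin n →₀ ℕ) =>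
    if h : s.2 ∈ monos n (d s.1) then X ⟨s.1, ⟨s.2, h⟩⟩ else 0) q

theorem eval_restrictCoeffs (F : HomMap d) (q : MvPolynomial (Fin n × (Fin n →₀ ℕ)) ℂ) :
    eval F.coeffFamily (restrictCoeffs d q) = eval F.coeffs q := by
  rw [restrictCoeffs, ← aeval_eq_eval, ← AlgHom.comp_apply, comp_aeval, ← aeval_eq_eval]
  congr 2
  ext ⟨j, m⟩
  by_cases h : m ∈ monos n (d j)
  · simp [h, coeffFamily, coeffs]
  · simp only [h, dite_false, map_zero, coeffs]
    rw [mem_monos] at h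
    exact ((F.homogeneous j).coeff_eq_zero h).symm

theorem HoldsGenerally.exists_isOpen_dense {P : HomMap d → Prop} (h : HoldsGenerally P) :
    ∃ U : Set (HomMap d), IsOpen U ∧ Dense U ∧ ∀ F ∈ U, P F := by
  obtain ⟨p, hp, hP⟩ := h
  refine ⟨{F | aeval F.coeffFamily p ≠ 0}, ?_, ?_, hP⟩
  · rw [← isClosed_compl_iff]
    refine (@isClosed_induced_iff _ _ (zariski _) _ _).2
      ⟨_, isClosed_zeroSet {map (algebraMap ℚ ℂ) (rename coeffIndex p)}, ?_⟩
    ext F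
    simp [zeroSet, ← eval_coeffs_rename]
  -- Some polynomial `q` in the coefficients is nonzero at a point of `V` and vanishes off `V`. Its
  -- restriction times `p` is a nonzero polynomial in finitely many variables, hence has a nonzero
  -- value.
  · rw [dense_iff_inter_open]
    rintro V hV ⟨F₀, hF₀⟩
    obtain ⟨T, hT, hTV⟩ := (@isClosed_induced_iff _ _ (zariski _) _ _).1 hV.isClosed_compl
    obtain ⟨S, rfl⟩ := isClosed_zariski_iff.1 hT
    have hmem : ∀ F : HomMap d, F ∈ V ↔ F.coeffs ∉ zeroSet S := fun F => by
      rw [← Set.mem_preimage, hTV, Set.notMem_compl_iff]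
    have h0 := (hmem F₀).1 hF₀
    simp only [zeroSet, Set.mem_ofPred_eq, not_forall] at h0
    obtain ⟨q, hq, hq0⟩ := h0
    rw [← eval_restrictCoeffs] at hq0
    have h1 : map (algebraMap ℚ ℂ) p * restrictCoeffs d q ≠ 0 := by
      refine mul_ne_zero ?_ fun h => hq0 (by rw [h, map_zero])
      rwa [Ne, map_eq_zero_iff _ (map_injective _ (algebraMap ℚ ℂ).injective)]
    obtain ⟨a, ha⟩ : ∃ a, eval a (map (algebraMap ℚ ℂ) p * restrictCoeffs d q) ≠ 0 := by
      by_contra! hc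
      exact h1 (MvPolynomial.funext fun a => by rw [hc a, map_zero])
    rw [map_mul] at ha
    refine ⟨ofCoeffs a, (hmem _).2 fun hz => right_ne_zero_of_mul ha ?_, ?_⟩
    · rw [← hz q hq, ← eval_restrictCoeffs, coeffFamily_ofCoeffs]
    · have := left_ne_zero_of_mul ha
      rw [eval_map, ← aeval_def] at this
      simpa using this

theorem mem_span_of_mem_ray {L : Set (Fin n → ℂ)} (hL : IsRay L) {x y : Fin n → ℂ} (hx : x ∈ L)
    (hx0 : x ≠ 0) : y ∈ L ↔ y ∈ Submodule.span ℂ {x} := by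
  obtain ⟨p, hp, rfl⟩ := hL
  obtain ⟨c, rfl⟩ := hx
  have hc : c ≠ 0 := by
    rintro rfl
    exact hx0 (zero_smul ℂ p)
  rw [Submodule.mem_span_singleton]
  constructor
  · rintro ⟨c', rfl⟩
    exact ⟨c' * c⁻¹, by rw [smul_smul, mul_assoc, inv_mul_cancel₀ hc, mul_one]⟩
  · rintro ⟨a, rfl⟩
    exact ⟨a * c, by simp [smul_smul]⟩

theorem injOn_ray_of_forall (hd : AlmostCoprime d) {F : HomMap d} (i₀ : Fin n)
    (h0 : F.toMap ⁻¹' {0} = {0})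
    (hB : ∀ x, x ≠ 0 → x ∈ F.critSet → ∀ l, ∃ j, j ≠ l ∧ F.toMap x j ≠ 0)
    {L : Set (Fin n → ℂ)} (hL : IsRay L) (hLc : L ⊆ F.critSet)
    (h : ∀ x ∈ L, x ≠ 0 → ∀ a b, a ≠ b → ¬ Nat.Coprime (d a) (d b) →
      ¬ ∀ j, j ≠ a → j ≠ b → F.toMap x j = 0) : Set.InjOn F.toMap L := by
  intro x hx y hy he
  have hz : ∀ z, F.toMap z = 0 → z = 0 := fun z hz => by
    have : z ∈ F.toMap ⁻¹' {0} := hz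
    rwa [h0] at this
  by_contra hne
  have hx0 : x ≠ 0 := by
    rintro rfl
    rw [toMap_zero F hd.two_le] at he
    exact hne (hz y he.symm).symm
  obtain ⟨a, b, hab, hc, -, hj⟩ := eq_neg_of_mem_span hd hB i₀ hx0 (hLc hx) hne he
    ((mem_span_of_mem_ray hL hx hx0).1 hy)
  exact h x hx hx0 a b hab hc hj

theorem finite_rays {F : HomMap d} {a b : Fin n}
    (h : ∀ l, {x | x l = 1 ∧ x ∈ F.critSet ∧ ∀ j, j ≠ a → j ≠ b → F.toMap x j = 0}.Finite) :
    {L | IsRay L ∧ L ⊆ F.critSet ∧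
      ∀ j, j ≠ a → j ≠ b → ∀ x ∈ L, F.toMap x j = 0}.Finite := by
  refine (Set.finite_iUnion fun l => (h l).image fun p => Set.range fun c : ℂ => c • p).subset ?_
  rintro L ⟨hL, hLc, hLj⟩
  obtain ⟨p, hp, hLp⟩ := id hL
  obtain ⟨l, hl⟩ := Function.ne_iff.1 hp
  have hl : p l ≠ 0 := hl
  have hmem : (p l)⁻¹ • p ∈ L := hLp ▸ ⟨(p l)⁻¹, rfl⟩
  refine Set.mem_iUnion.2 ⟨l, (p l)⁻¹ • p, ⟨by simp [hl], hLc hmem, fun j ha hb =>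
    hLj j ha hb _ hmem⟩, ?_⟩
  ext y
  rw [mem_span_of_mem_ray hL hmem (smul_ne_zero (inv_ne_zero hl) hp),
    Submodule.mem_span_singleton]
  rfl

theorem encard_fiber_ray (hd : AlmostCoprime d) {F : HomMap d}
    (hB : ∀ x, x ≠ 0 → x ∈ F.critSet → ∀ l, ∃ j, j ≠ l ∧ F.toMap x j ≠ 0)
    {L : Set (Fin n → ℂ)} (hL : IsRay L) (hLc : L ⊆ F.critSet) {a b : Fin n}
    (ha : 2 ∣ d a) (hb : 2 ∣ d b)
    (h : ∀ j, j ≠ a → j ≠ b → ∀ x ∈ L, F.toMap x j = 0) {x : Fin n → ℂ} (hx : x ∈ L)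
    (hx0 : x ≠ 0) : {y ∈ L | F.toMap y = F.toMap x}.encard = 2 := by
  have hne : x ≠ -x := fun he => hx0 (self_eq_neg.1 he)
  rw [← Set.encard_pair hne]
  congr 1
  ext y
  simp only [Set.mem_ofPred_eq, Set.mem_insert_iff, Set.mem_singleton_iff]
  constructor
  · rintro ⟨hy, he⟩
    by_contra! hc
    obtain ⟨_, _, -, -, hyx, -⟩ := eq_neg_of_mem_span hd hB a hx0 (hLc hx) (Ne.symm hc.1) he.symm
      ((mem_span_of_mem_ray hL hx hx0).1 hy)
    exact hc.2 hyx
  · rintro (rfl | rfl)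
    · exact ⟨hx, rfl⟩
    · have hmem : -x ∈ L := (mem_span_of_mem_ray hL hx hx0).2
        (neg_mem (Submodule.mem_span_singleton_self x))
      refine ⟨hmem, ?_⟩
      ext j
      by_cases hj : j = a ∨ j = b
      · have heven : Even (d j) := even_iff_two_dvd.2 (by
          rcases hj with rfl | rfl
          · exact ha
          · exact hb)
        have := F.toMap_smul (-1) x j
        rwa [heven.neg_one_pow, one_mul, neg_one_smul] at this
      · push Not at hj
        rw [h j hj.1 hj.2 x hx, h j hj.1 hj.2 _ hmem]

/-- For each coordinate there is an equation for the double points that is free of it; the common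
zero set of these n equations serves as `Z`. -/
theorem exists_isAlgebraicSet_injOn {F : HomMap d} (hn : 2 ≤ n)
    (h : ∀ I : Finset (Fin n), I.card = n - 1 →
      ∃ g : MvPolynomial I ℂ, g ≠ 0 ∧ ∀ x y, x ∈ F.critSet → y ∈ F.critSet → x ≠ y →
        F.toMap x = F.toMap y → eval (fun i : I => x i) g = 0) :
    ∃ Z : Set (Fin n → ℂ), IsAlgebraicSet Z ∧ zariskiDim Z ≤ ((n - 2 : ℕ) : WithBot ℕ∞) ∧
      Set.InjOn F.toMap (F.critSet \ Z) := by
  classical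
  have hcard : ∀ i : Fin n, (Finset.univ.erase i).card = n - 1 := fun i => by
    have := card_univ_erase_add_one i
    omega
  choose g hg0 hg using fun i => h _ (hcard i)
  refine ⟨zeroSet (Set.range fun i => rename Subtype.val (g i)), isClosed_zeroSet _,
    zariskiDim_le_of_degreeOf_eq_zero hn fun i => ⟨rename Subtype.val (g i), ?_, ?_, ?_⟩, ?_⟩
  · rw [Ne, map_eq_zero_iff _ (rename_injective _ Subtype.val_injective)]
    exact hg0 i
  · by_contra hne
    rw [← Ne, ← mem_vars_iff_degreeOf_ne_zero] at hne
    obtain ⟨k, -, hk⟩ := Finset.mem_image.1 (vars_rename _ _ hne)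
    exact Finset.ne_of_mem_erase k.2 hk
  · exact fun x hx => hx _ ⟨i, rfl⟩
  · rintro x ⟨hx, hxZ⟩ y ⟨hy, -⟩ he
    by_contra hne
    apply hxZ
    rintro _ ⟨i, rfl⟩
    rw [eval_rename]
    exact hg i x y hx hy hne he

theorem encard_fiber_le {F : HomMap d} (hn : 2 ≤ n)
    (h : ∀ x : Fin n → Fin n → ℂ, (∀ i, x i ∈ F.critSet) →
      (∀ i j, F.toMap (x i) = F.toMap (x j)) → ¬ Function.Injective x) (p : Fin n → ℂ) :
    (F.toMap ⁻¹' {p} ∩ F.critSet).encard ≤ ((n - 1 : ℕ) : ℕ∞) := by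
  by_contra! hc
  have h1 : ((n : ℕ) : ℕ∞) ≤ (F.toMap ⁻¹' {p} ∩ F.critSet).encard := by
    have := Order.add_one_le_of_lt hc
    rwa [← Nat.cast_add_one, Nat.sub_add_cancel (by omega)] at this
  obtain ⟨t, ht, htn⟩ := Set.exists_subset_encard_eq h1
  have : Finite t := Set.finite_of_encard_eq_coe htn
  have h2 : Nat.card t = n := by
    rw [Nat.card_coe_set_eq, Set.ncard, htn]
    rfl
  let e := (Finite.equivFinOfCardEq h2).symm
  exact h (fun i => e i) (fun i => (ht (e i).2).2)
    (fun i j => (ht (e i).2).1.trans (ht (e j).2).1.symm)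
    (Subtype.val_injective.comp e.injective)

end HomMap

theorem theorem3p1 (n : ℕ) (hn : 2 ≤ n) (d : Fin n → ℕ) (hd : ∀ i, 2 ≤ d i)
    (hd2 : ∀ i j, i < j → Nat.gcd (d i) (d j) ≤ 2)
    (hd3 : ∀ i j k, i < j → j < k → Nat.gcd (Nat.gcd (d i) (d j)) (d k) = 1) :
    ∃ U : Set (HomMap d), IsOpen U ∧ Dense U ∧ ∀ F ∈ U,
      -- the fibre over the origin
      F.toMap ⁻¹' {0} = {0} ∧
      -- critical rays, pairwise coprime degrees
      ((∀ i j, i ≠ j → Nat.Coprime (d i) (d j)) →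
        ∀ L, IsRay L → L ⊆ F.critSet → Set.InjOn F.toMap L) ∧
      -- critical rays, two degrees that are not coprime
      (∀ i₁ i₂, i₁ ≠ i₂ → ¬ Nat.Coprime (d i₁) (d i₂) →
        (∀ j, j ≠ i₁ → j ≠ i₂ → ∀ L, IsRay L → L ⊆ F.critSet →
          (∀ x ∈ L, x ≠ 0 → F.toMap x j ≠ 0) → Set.InjOn F.toMap L) ∧
        {L | IsRay L ∧ L ⊆ F.critSet ∧
          ∀ j, j ≠ i₁ → j ≠ i₂ → ∀ x ∈ L, F.toMap x j = 0}.Finite ∧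
        (∀ L, IsRay L → L ⊆ F.critSet →
          (∀ j, j ≠ i₁ → j ≠ i₂ → ∀ x ∈ L, F.toMap x j = 0) →
          ∀ x ∈ L, x ≠ 0 → {y ∈ L | F.toMap y = F.toMap x}.encard = 2)) ∧
      -- for n ≥ 3 the condition on the gcd of all degrees is automatic
      (Finset.univ.gcd d = 1 →
        -- injectivity on the critical set
        (∃ Z : Set (Fin n → ℂ), IsAlgebraicSet Z ∧ zariskiDim Z ≤ ((n - 2 : ℕ) : WithBot ℕ∞) ∧
          Set.InjOn F.toMap (F.critSet \ Z)) ∧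
        -- number of critical preimages
        (∀ p ∈ F.discr, (F.toMap ⁻¹' {p} ∩ F.critSet).encard ≤ ((n - 1 : ℕ) : ℕ∞))) := by
  have hc := AlmostCoprime.of_lt hd hd2 hd3
  obtain ⟨U, hU, hUd, hF⟩ := ((HomMap.holdsGenerally_preimage_zero hc).and
    ((HomMap.holdsGenerally_exists_toMap_ne_zero hc hn).and
    ((HomMap.holdsGenerally_finite_normalized hc hn).and
    (HomMap.HoldsGenerally.imp fun hgcd => (HomMap.holdsGenerally_double_points hc hn hgcd).and
      (HomMap.holdsGenerally_not_injective hc hn hgcd))))).exists_isOpen_dense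
  refine ⟨U, hU, hUd, fun F hFU => ?_⟩
  obtain ⟨h0, hB, hfin, hgen⟩ := hF F hFU
  have i₀ : Fin n := ⟨0, by omega⟩
  refine ⟨h0, fun hcop L hL hLc => ?_, fun i₁ i₂ hi hcop => ⟨fun j hj₁ hj₂ L hL hLc hj => ?_,
    HomMap.finite_rays (hfin i₁ i₂ hi), fun L hL hLc hLj x hx hx0 => ?_⟩, fun hgcd =>
    ⟨HomMap.exists_isAlgebraicSet_injOn hn (hgen hgcd).1, fun p _ =>
      HomMap.encard_fiber_le hn (hgen hgcd).2 p⟩⟩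
  · exact HomMap.injOn_ray_of_forall hc i₀ h0 hB hL hLc
      fun x _ _ a b hab hnc => absurd (hcop a b hab) hnc
  · obtain ⟨h₁, h₂⟩ := hc.two_dvd_of_not_coprime hi hcop
    -- Only `i₁` and `i₂` have even degree, so `j` lies outside every pair that is not coprime.
    refine HomMap.injOn_ray_of_forall hc i₀ h0 hB hL hLc fun x hx hx0 a b hab hnc hzero =>
      hj x hx hx0 (hzero j ?_ ?_)
    · rintro rfl
      rcases hc.eq_or_eq_of_two_dvd hi h₁ h₂ (hc.two_dvd_of_not_coprime hab hnc).1 with h | h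
      · exact hj₁ h
      · exact hj₂ h
    · rintro rfl
      rcases hc.eq_or_eq_of_two_dvd hi h₁ h₂ (hc.two_dvd_of_not_coprime hab hnc).2 with h | h
      · exact hj₁ h
      · exact hj₂ h
  · obtain ⟨h₁, h₂⟩ := hc.two_dvd_of_not_coprime hi hcop
    exact HomMap.encard_fiber_ray hc hB hL hLc h₁ h₂ hLj hx hx0
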